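/- Let $\tilde F=\mathbb R^4\oplus\mathbb R\delta\oplus\mathbb Ra\oplus\mathbb R\Lambda_0$ be the hyperbolic extension for the elliptic root system of type $D_4^{(1,1)}$, with the symmetric bilinear form $\tilde I$ that is the standard scalar product on $\mathbb R^4$ (with standard basis $e_1,\dots,e_4$), has $\tilde I(\delta,\Lambda_0)=1$, and vanishes on all other pairs of the summands. Let $\alpha_1=e_1-e_2$, $\alpha_2=e_2-e_3$, $\alpha_3=e_3-e_4$, $\alpha_4=e_3+e_4$, $\alpha_0=\delta-(e_1+e_2)$; let $\Lambda_i=a_i^\vee\Lambda_0+\omega_i$ $(1\le i\le 4)$, where $(a_1^\vee,\dots,a_4^\vee)=(1,2,1,1)$ and $\omega_i\in\mathbb R^4$ is given by $\tilde I(\omega_i,\alpha_j)=\delta_{ij}$ $(1\le j\le4)$; and let $\rho=\sum_{i=0}^4\Lambda_i$. Let $W_{\mathrm{af}}\subset GL(\tilde F)$ be the group generated by the reflections $u\mapsto u-\tilde I(u,\alpha_i)\alpha_i$ $(0\le i\le 4)$ and $\varepsilon:W_{\mathrm{af}}\to\{\pm1\}$ the parity of the number of reflections. On $$Y=\{x\in\mathrm{Hom}_{\mathbb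 R}(\tilde F,\mathbb C)\mid \langle a,x\rangle=-2\pi\sqrt{-1},\ \mathrm{Re}\langle\delta,x\rangle>0\}$$ write $e^\lambda(x)=e^{\langle\lambda,x\rangle}$ and let $$ch_{\Lambda_i}=\frac{\sum_{w\in W_{\mathrm{af}}}\varepsilon(w)e^{w(\rho+\Lambda_i)}}{\sum_{w\in W_{\mathrm{af}}}\varepsilon(w)e^{w(\rho)}},\qquad \chi_{\Lambda_i}=e^{-m_{\Lambda_i}\delta}ch_{\Lambda_i},\qquad m_{\Lambda_i}=\frac{\tilde I(\Lambda_i+\rho,\Lambda_i+\rho)}{2\tilde I(\Lambda_i+\rho,\delta)}-\frac{\tilde I(\rho,\rho)}{2\tilde I(\rho,\delta)},$$ the quotient being extended by continuity across the zeros of the denominator. For $\tau$ in the upper half-plane $\mathbb H$ let $\chi^\natural_{\Lambda_i}(\tau)$ be the value of $\chi_{\Lambda_i}$ at the point $x\in Y$ with $\langle\delta,x\rangle=-2\pi\sqrt{-1}\,\tau$, $x|_{\mathbb R^4}=0$ and $\langle\Lambda_0,x\rangle=0$. Put $q=e^{2\pi\sqrt{-1}\tau}$, $f'=q\frac{df}{dq}=\frac1{2\pi\sqrt{-1}}\frac{df}{d\tau}$,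 $\eta=q^{1/24}\prod_{n\ge1}(1-q^n)$, $\sigma_k(n)=\sum_{d\mid n}d^k$, $E_2=1-24\sum_{n\ge1}\sigma_1(n)q^n$, $E_4=1+240\sum_{n\ge1}\sigma_3(n)q^n$, $E_6=1-504\sum_{n\ge1}\sigma_5(n)q^n$. Then $\eta^4\chi^\natural_{\Lambda_0}$, $\eta^4\chi^\natural_{\Lambda_1}$ and $\eta'/\eta$ are holomorphic on $\mathbb H$ and satisfy $$(\eta^4\chi^\natural_{\Lambda_0})'=4(\eta^4\chi^\natural_{\Lambda_0})\frac{\eta'}{\eta}-\frac16(\eta^4\chi^\natural_{\Lambda_0})^2+\frac12(\eta^4\chi^\natural_{\Lambda_1})^2,$$ $$(\eta^4\chi^\natural_{\Lambda_1})'=4(\eta^4\chi^\natural_{\Lambda_1})\frac{\eta'}{\eta}+\frac13(\eta^4\chi^\natural_{\Lambda_0})(\eta^4\chi^\natural_{\Lambda_1}),$$ $$\left(\frac{\eta'}{\eta}\right)'=2\left(\frac{\eta'}{\eta}\right)^2-\frac1{2^5 3^2}\left[(\eta^4\chi^\natural_{\Lambda_0})^2+3(\eta^4\chi^\natural_{\Lambda_1})^2\right],$$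 and $$E_2=24\frac{\eta'}{\eta},\qquad E_4=(\eta^4\chi^\natural_{\Lambda_0})^2+3(\eta^4\chi^\natural_{\Lambda_1})^2,\qquad E_6=(\eta^4\chi^\natural_{\Lambda_0})^3-9(\eta^4\chi^\natural_{\Lambda_0})(\eta^4\chi^\natural_{\Lambda_1})^2.$$ -/

import Mathlib

open Complex Filter Topology
open scoped Matrix

noncomputable section

namespace EllipticD4

/-- The hyperbolic extension `F̃ = F_cl ⊕ ℝδ ⊕ ℝa ⊕ ℝΛ₀` for the elliptic root system of type
`D₄^(1,1)`, whose roots are `α + mδ + na` with `α = ±eᵢ ± eⱼ` (`i ≠ j`) and `m, n ∈ ℤ`.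
An element is `(v, d, c, k)`, standing for `v + dδ + ca + kΛ₀`, where `v ∈ F_cl = ℝ⁴`. -/
abbrev FTilde : Type := (Fin 4 → ℝ) × ℝ × ℝ × ℝ

/-- The inclusion of `F_cl`. -/
def cl (v : Fin 4 → ℝ) : FTilde := (v, 0, 0, 0)

def delta : FTilde := (0, 1, 0, 0)

def a : FTilde := (0, 0, 1, 0)

def Lambda0 : FTilde := (0, 0, 0, 1)

/-- The symmetric bilinear form `Ĩ`: the standard scalar product on `F_cl`, `Ĩ(δ, Λ₀) = 1`,
`Ĩ(Λ₀, Λ₀) = 0`, and radical `ℝa`. -/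
def form : LinearMap.BilinForm ℝ FTilde :=
  LinearMap.mk₂ ℝ (fun u v => u.1 ⬝ᵥ v.1 + u.2.1 * v.2.2.2 + u.2.2.2 * v.2.1)
    (by intro x y z; simp [add_dotProduct]; ring)
    (by intro c x y; simp [smul_dotProduct]; ring)
    (by intro x y z; simp [dotProduct_add]; ring)
    (by intro c x y; simp [dotProduct_smul]; ring)

/-- The highest root `θ = α₁ + 2α₂ + α₃ + α₄`. -/
def theta : FTilde := cl ![1, 1, 0, 0]

/-- The simple roots `α₀ = δ - θ, α₁, …, α₄`; the central node of the Dynkin diagram of `D₄`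
is `α₂`. -/
def simpleRoot : Fin 5 → FTilde :=
  ![delta - theta, cl ![1, -1, 0, 0], cl ![0, 1, -1, 0], cl ![0, 0, 1, -1], cl ![0, 0, 1, 1]]

/-- The colabels `aᵢ^∨`. -/
def colabel : Fin 5 → ℝ := ![1, 1, 2, 1, 1]

/-- The fundamental weights `ω₁, …, ω₄` of the finite root system (with `ω₀ = 0`). -/
def omega : Fin 5 → FTilde :=
  ![0, cl ![1, 0, 0, 0], cl ![1, 1, 0, 0], cl ![1/2, 1/2, 1/2, -1/2], cl ![1/2, 1/2, 1/2, 1/2]]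

/-- The affine fundamental weights `Λᵢ = aᵢ^∨ Λ₀ + ωᵢ`. -/
def fundWeight (i : Fin 5) : FTilde := colabel i • Lambda0 + omega i

/-- `ρ = Λ₀ + ⋯ + Λ₄`. -/
def rho : FTilde := ∑ i, fundWeight i

/-- The coroot `α^∨ = 2α / Ĩ(α, α)`. -/
def coroot (x : FTilde) : FTilde := (2 / form x x) • x

theorem form_simpleRoot_self (i : Fin 5) : form (simpleRoot i) (simpleRoot i) = 2 := by
  fin_cases i <;>
    simp [form, simpleRoot, cl, delta, theta, dotProduct, Fin.sum_univ_four] <;> norm_num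

theorem coroot_simpleRoot (i : Fin 5) : coroot (simpleRoot i) = simpleRoot i := by
  simp [coroot, form_simpleRoot_self]

theorem form_fundWeight_coroot (i j : Fin 5) :
    form (fundWeight i) (coroot (simpleRoot j)) = if i = j then 1 else 0 := by
  rw [coroot_simpleRoot]
  fin_cases i <;> fin_cases j <;>
    simp [form, fundWeight, colabel, omega, Lambda0, simpleRoot, cl, delta, theta,
      dotProduct, Fin.sum_univ_four] <;> norm_num

theorem form_flip_coroot_simpleRoot (i : Fin 5) :
    form.flip (coroot (simpleRoot i)) (simpleRoot i) = 2 := by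
  rw [coroot_simpleRoot]
  exact form_simpleRoot_self i

/-- The reflection `u ↦ u - Ĩ(u, αᵢ^∨) αᵢ`. -/
def simpleReflection (i : Fin 5) : FTilde ≃ₗ[ℝ] FTilde :=
  Module.reflection (form_flip_coroot_simpleRoot i)

theorem simpleReflection_apply (i : Fin 5) (u : FTilde) :
    simpleReflection i u = u - form u (coroot (simpleRoot i)) • simpleRoot i := rfl

/-- The affine Weyl group, generated by the reflections in `α₀, …, α₄`. -/
def affineWeylGroup : Subgroup (FTilde ≃ₗ[ℝ] FTilde) :=
  Subgroup.closure (Set.range simpleReflection)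

/-- The sign character of the affine Weyl group, as the determinant. By
`weylSign_prod_simpleReflection` it is the parity of the number of reflections in any
expression of `w` as a product of simple reflections. -/
def weylSign (w : affineWeylGroup) : ℝ := LinearMap.det (w.1 : FTilde →ₗ[ℝ] FTilde)

theorem det_simpleReflection (i : Fin 5) :
    LinearMap.det (simpleReflection i : FTilde →ₗ[ℝ] FTilde) = -1 := by
  have h : (simpleReflection i : FTilde →ₗ[ℝ] FTilde) =
      LinearMap.transvection (-(form.flip (coroot (simpleRoot i)))) (simpleRoot i) := by
    refine LinearMap.ext fun u => ?_
    simp [simpleReflection_apply, LinearMap.transvection.apply, sub_eq_add_neg]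
  rw [h, LinearMap.transvection.det, LinearMap.neg_apply, form_flip_coroot_simpleRoot]
  norm_num

theorem weylSign_prod_simpleReflection (w : affineWeylGroup) (s : List (Fin 5))
    (hw : w.1 = (s.map simpleReflection).prod) : weylSign w = (-1) ^ s.length := by
  rw [weylSign, hw]
  clear hw
  induction s with
  | nil => exact LinearMap.det_id
  | cons i s ih =>
    rw [List.map_cons, List.prod_cons, List.length_cons, pow_succ', ← ih, ← det_simpleReflection i]
    exact LinearMap.det_comp _ _

/-- The dual space `Hom_ℝ(F̃, ℂ)`, with its topology as a finite-dimensional space. -/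
abbrev DualC : Type := FTilde →L[ℝ] ℂ

/-- The domain `Y = {x | ⟨a, x⟩ = -2πi, Re ⟨δ, x⟩ > 0}`. -/
def Y : Set DualC := {x | x a = -(2 * Real.pi * I) ∧ 0 < (x delta).re}

/-- The alternating sum `∑_{w ∈ W_af} ε(w) e^{w(lam)}`, as a function on `Y`, where
`e^lam (x) = exp ⟨lam, x⟩`. -/
def alternant (lam : FTilde) (x : DualC) : ℂ :=
  ∑' w : affineWeylGroup, (weylSign w : ℂ) * Complex.exp (x (w.1 lam))

/-- The character `ch_lam`: the quotient of the alternating sums for `ρ + lam` and for `ρ`,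
extended continuously from the dense subset of `Y` where the denominator does not vanish to
all of `Y`. -/
def ch (lam : FTilde) (x : DualC) : ℂ :=
  limUnder (𝓝[{y | y ∈ Y ∧ alternant rho y ≠ 0}] x)
    (fun y => alternant (rho + lam) y / alternant rho y)

/-- The exponent `m_lam = |lam + ρ|² / (2 Ĩ(lam + ρ, δ)) - |ρ|² / (2 Ĩ(ρ, δ))`. -/
def modularExponent (lam : FTilde) : ℝ :=
  form (lam + rho) (lam + rho) / (2 * form (lam + rho) delta)
    - form rho rho / (2 * form rho delta)

/-- The normalized character `χ_lam = e^{-m_lam δ} ch_lam`. -/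
def chi (lam : FTilde) (x : DualC) : ℂ :=
  Complex.exp (-(modularExponent lam : ℂ) * x delta) * ch lam x

/-- The inverse of the isomorphism `Y ≃ ℍ × Hom_ℝ(F_cl, ℂ) × ℂ`: the point with
`⟨a, x⟩ = -2πi`, `⟨δ, x⟩ = -2πiτ`, `⟨γ, x⟩ = 2πi z(γ)` for `γ ∈ F_cl`, and `⟨Λ₀, x⟩ = 2πi t`. -/
def point (τ : UpperHalfPlane) (z : (Fin 4 → ℝ) →L[ℝ] ℂ) (t : ℂ) : DualC :=
  LinearMap.toContinuousLinearMap
    { toFun := fun u => 2 * Real.pi * I *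
        (z u.1 - (τ : ℂ) * (u.2.1 : ℂ) - (u.2.2.1 : ℂ) + t * (u.2.2.2 : ℂ))
      map_add' := by intro u v; simp; ring
      map_smul' := by intro c u; simp; ring }

theorem point_mem_Y (τ : UpperHalfPlane) (z : (Fin 4 → ℝ) →L[ℝ] ℂ) (t : ℂ) :
    point τ z t ∈ Y := by
  constructor
  · simp [point, a]
  · have := τ.im_pos
    simp [point, delta]
    positivity

/-- The specialization `χ^♮_{Λᵢ}(τ) = χ_{Λᵢ}(τ, 0, 0)`. -/
def chiNat (i : Fin 5) (τ : UpperHalfPlane) : ℂ := chi (fundWeight i) (point τ 0 0)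

/-- `q = e^{2πiτ}`. -/
def qExp (τ : UpperHalfPlane) : ℂ := Complex.exp (2 * Real.pi * I * τ)

def E2 (τ : UpperHalfPlane) : ℂ :=
  1 - 24 * ∑' n : ℕ+, (ArithmeticFunction.sigma 1 n : ℂ) * qExp τ ^ (n : ℕ)

def E4 (τ : UpperHalfPlane) : ℂ :=
  1 + 240 * ∑' n : ℕ+, (ArithmeticFunction.sigma 3 n : ℂ) * qExp τ ^ (n : ℕ)

def E6 (τ : UpperHalfPlane) : ℂ :=
  1 - 504 * ∑' n : ℕ+, (ArithmeticFunction.sigma 5 n : ℂ) * qExp τ ^ (n : ℕ)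

/-- The Dedekind eta function `q^{1/24} ∏_{n ≥ 1} (1 - q^n)` on the upper half-plane. -/
def eta (τ : UpperHalfPlane) : ℂ := ModularForm.eta τ

/-- The function `η⁴ χ^♮_{Λᵢ}`. -/
def etaChi (i : Fin 5) (τ : UpperHalfPlane) : ℂ := eta τ ^ 4 * chiNat i τ

/-- The derivation `f ↦ f' = q df/dq = (2πi)⁻¹ df/dτ`. -/
abbrev qDeriv (f : UpperHalfPlane → ℂ) : UpperHalfPlane → ℂ :=
  Derivative.normalizedDerivOfComplex f

/-- The function `η'/η`. -/
def etaLog (τ : UpperHalfPlane) : ℂ := qDeriv eta τ / eta τ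

/-- Holomorphic functions on the upper half-plane. -/
abbrev Holo (f : UpperHalfPlane → ℂ) : Prop :=
  MDifferentiable (modelWithCornersSelf ℂ ℂ) (modelWithCornersSelf ℂ ℂ) f

end EllipticD4

end

noncomputable section

namespace EllipticD4

/-! ### The infinite `q`-Pochhammer symbol -/

/-- The infinite `q`-Pochhammer symbol `(x; q)_∞ = ∏_{n ≥ 0} (1 - x qⁿ)`. -/
def poch (x q : ℂ) : ℂ := ∏' n : ℕ, (1 - x * q ^ n)

theorem summable_norm_mul_pow (x : ℂ) {q : ℂ} (hq : ‖q‖ < 1) :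
    Summable fun n : ℕ => ‖-(x * q ^ n)‖ := by
  simp only [norm_neg, norm_mul, norm_pow]
  exact (summable_geometric_of_lt_one (norm_nonneg _) hq).mul_left _

theorem multipliable_poch (x : ℂ) {q : ℂ} (hq : ‖q‖ < 1) :
    Multipliable fun n : ℕ => 1 - x * q ^ n := by
  simpa [sub_eq_add_neg] using multipliable_one_add_of_summable (summable_norm_mul_pow x hq)

theorem poch_ne_zero {x q : ℂ} (hq : ‖q‖ < 1) (hx : ∀ n : ℕ, x * q ^ n ≠ 1) : poch x q ≠ 0 := by
  have := tprod_one_add_ne_zero_of_summable (f := fun n : ℕ => -(x * q ^ n))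
    (fun n => by rw [← sub_eq_add_neg]; exact sub_ne_zero.2 (hx n).symm)
    (summable_norm_mul_pow x hq)
  simpa [poch, sub_eq_add_neg] using this

theorem mul_pow_ne_one {x q : ℂ} (hq : ‖q‖ < 1) (hx : ‖x‖ < 1) (n : ℕ) : x * q ^ n ≠ 1 := by
  intro h
  have h1 : ‖x‖ * ‖q‖ ^ n = 1 := by simpa using congrArg norm h
  have h2 : ‖q‖ ^ n ≤ 1 := pow_le_one₀ (norm_nonneg _) hq.le
  nlinarith [norm_nonneg x]

theorem poch_self_ne_zero {q : ℂ} (hq : ‖q‖ < 1) : poch q q ≠ 0 :=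
  poch_ne_zero hq (mul_pow_ne_one hq hq)

theorem poch_eq_mul (x : ℂ) {q : ℂ} (hq : ‖q‖ < 1) : poch x q = (1 - x) * poch (x * q) q := by
  have h : HasProd (fun n : ℕ => 1 - x * q ^ (n + 1)) (poch (x * q) q) := by
    have := (multipliable_poch (x * q) hq).hasProd
    rw [← poch] at this
    simpa only [pow_succ', mul_assoc] using this
  have h2 := HasProd.prod_range_mul (f := fun n : ℕ => 1 - x * q ^ n) (k := 1) h
  rw [poch, h2.tprod_eq, Finset.prod_range_one, pow_zero, mul_one]

theorem tendsto_prod_poch (x : ℂ) {q : ℂ} (hq : ‖q‖ < 1) :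
    Tendsto (fun N => ∏ n ∈ Finset.range N, (1 - x * q ^ n)) atTop (𝓝 (poch x q)) :=
  (multipliable_poch x hq).hasProd.tendsto_prod_nat

theorem norm_pow_lt_one {q : ℂ} (hq : ‖q‖ < 1) {m : ℕ} (hm : m ≠ 0) : ‖q ^ m‖ < 1 := by
  rw [norm_pow]; exact pow_lt_one₀ (norm_nonneg _) hq hm

/-- Splitting the factors of `(x; q)_∞` according to the residue of the exponent mod `m`. -/
theorem prod_poch_mul_pow (x : ℂ) {q : ℂ} (hq : ‖q‖ < 1) {m : ℕ} (hm : m ≠ 0) :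
    ∏ r ∈ Finset.range m, poch (x * q ^ r) (q ^ m) = poch x q := by
  have h1 := tendsto_finsetProd (Finset.range m) fun r _ =>
    tendsto_prod_poch (x * q ^ r) (norm_pow_lt_one hq hm)
  have h2 : Tendsto (fun N : ℕ => m * N) atTop atTop :=
    tendsto_id.const_mul_atTop' (Nat.pos_of_ne_zero hm)
  refine tendsto_nhds_unique (h1.congr fun N => ?_) ((tendsto_prod_poch x hq).comp h2)
  simp only [Function.comp_apply]
  induction N with
  | zero => simp
  | succ N ih =>
    rw [mul_add, mul_one, Finset.prod_range_add, ← ih, ← Finset.prod_mul_distrib]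
    refine Finset.prod_congr rfl fun r _ => ?_
    rw [Finset.prod_range_succ]
    ring

/-- The product of `(ζ x; q)_∞` over all `m`-th roots of unity `ζ`. -/
theorem prod_poch_root_mul {m : ℕ} (hm : m ≠ 0) {ζ : ℂ} (hζ : IsPrimitiveRoot ζ m) (x : ℂ) {q : ℂ}
    (hq : ‖q‖ < 1) :
    ∏ k ∈ Finset.range m, poch (ζ ^ k * x) q = poch (x ^ m) (q ^ m) := by
  have h1 := tendsto_finsetProd (Finset.range m) fun k _ => tendsto_prod_poch (ζ ^ k * x) hq
  refine tendsto_nhds_unique (h1.congr fun N => ?_)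
    (tendsto_prod_poch (x ^ m) (norm_pow_lt_one hq hm))
  rw [Finset.prod_comm]
  refine Finset.prod_congr rfl fun n _ => ?_
  have := congrArg (Polynomial.eval 1)
    (X_pow_sub_C_eq_prod hζ (Nat.pos_of_ne_zero hm) (α := x * q ^ n) rfl)
  simp only [Polynomial.eval_sub, Polynomial.eval_pow, Polynomial.eval_X, Polynomial.eval_C,
    Polynomial.eval_prod, one_pow, mul_pow] at this
  rw [← pow_mul, mul_comm m n, pow_mul, this]
  exact Finset.prod_congr rfl fun k _ => by rw [mul_assoc]

/-! ### The Jacobi triple product -/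

/-- The theta series `∑ p^{n²} Xⁿ`. -/
def theta1 (p X : ℂ) : ℂ := ∑' n : ℤ, p ^ (n ^ 2) * X ^ n

/-- The finite `q`-factorial `∏_{k = 1}^{n} (1 - q^k)`. -/
def qFact (q : ℂ) (n : ℕ) : ℂ := ∏ k ∈ Finset.range n, (1 - q ^ (k + 1))

/-- The Gaussian binomial coefficient, by the Pascal recursion. -/
def gaussBinom (q : ℂ) : ℕ → ℕ → ℂ
  | _, 0 => 1
  | 0, _ + 1 => 0
  | n + 1, k + 1 => gaussBinom q n k + q ^ (k + 1) * gaussBinom q n (k + 1)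

theorem gaussBinom_zero (q : ℂ) (n : ℕ) : gaussBinom q n 0 = 1 := by
  cases n <;> rfl

theorem gaussBinom_of_lt (q : ℂ) {n k : ℕ} (h : n < k) : gaussBinom q n k = 0 := by
  induction n generalizing k with
  | zero => obtain ⟨k, rfl⟩ := Nat.exists_eq_succ_of_ne_zero h.ne'; rfl
  | succ n ih =>
    obtain ⟨k, rfl⟩ := Nat.exists_eq_succ_of_ne_zero (by omega : k ≠ 0)
    simp [gaussBinom, ih (by omega : n < k), ih (by omega : n < k + 1)]

theorem gaussBinom_self (q : ℂ) (n : ℕ) : gaussBinom q n n = 1 := by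
  induction n with
  | zero => rfl
  | succ n ih => simp [gaussBinom, ih, gaussBinom_of_lt]

theorem gaussBinom_mul_qFact (q : ℂ) (a b : ℕ) :
    gaussBinom q (a + b) a * (qFact q a * qFact q b) = qFact q (a + b) := by
  induction h : a + b generalizing a b with
  | zero =>
    obtain ⟨rfl, rfl⟩ : a = 0 ∧ b = 0 := by omega
    simp [gaussBinom, qFact]
  | succ n ih =>
    rcases a with _ | a
    · simp [gaussBinom_zero, qFact, show b = n + 1 by omega]
    rcases b with _ | b
    · simp [show a = n by omega, gaussBinom_self, qFact]
    have h1 := ih a (b + 1) (by omega)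
    have h2 := ih (a + 1) b (by omega)
    have e1 : qFact q (n + 1) = qFact q n * (1 - q ^ (a + 1) * q ^ (b + 1)) := by
      rw [qFact, Finset.prod_range_succ, ← qFact, ← pow_add]; congr 3; omega
    have e2 : qFact q (a + 1) = qFact q a * (1 - q ^ (a + 1)) := by
      rw [qFact, Finset.prod_range_succ, ← qFact]
    have e3 : qFact q (b + 1) = qFact q b * (1 - q ^ (b + 1)) := by
      rw [qFact, Finset.prod_range_succ, ← qFact]
    rw [gaussBinom, e1]
    rw [e3] at h1
    rw [e2] at h2
    rw [e2, e3]
    linear_combination (1 - q ^ (a + 1)) * h1 + q ^ (a + 1) * (1 - q ^ (b + 1)) * h2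

/-- The `q`-binomial theorem. -/
theorem prod_one_add_mul_pow (q x : ℂ) (n : ℕ) :
    ∏ k ∈ Finset.range n, (1 + x * q ^ k) =
      ∑ k ∈ Finset.range (n + 1), gaussBinom q n k * q ^ (k.choose 2) * x ^ k := by
  induction n generalizing x with
  | zero => simp [gaussBinom]
  | succ n ih =>
    rw [Finset.prod_range_succ']
    have : ∀ k ∈ Finset.range n, (1 + x * q ^ (k + 1)) = 1 + (x * q) * q ^ k := by
      intro k _; ring
    rw [Finset.prod_congr rfl this, ih, Finset.sum_range_succ' _ (n + 1)]
    have e : ∀ k, gaussBinom q (n + 1) (k + 1) * q ^ ((k + 1).choose 2) * x ^ (k + 1) =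
        gaussBinom q n k * q ^ (k.choose 2) * (x * q) ^ k * x +
          gaussBinom q n (k + 1) * q ^ ((k + 1).choose 2) * (x * q) ^ (k + 1) := by
      intro k
      rw [gaussBinom, Nat.choose_succ_succ' k 1, Nat.choose_one_right]
      ring
    simp only [e, Finset.sum_add_distrib]
    rw [Finset.sum_range_succ (fun k => gaussBinom q n (k + 1) * q ^ ((k + 1).choose 2) *
      (x * q) ^ (k + 1)) n, gaussBinom_of_lt q (Nat.lt_succ_self n), Finset.sum_range_succ' _ n,
      ← Finset.sum_mul, Finset.sum_range_succ' _ n]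
    simp [gaussBinom_zero]
    ring

theorem prod_mul_prod_eq_sum {p X : ℂ} (hp : p ≠ 0) (hX : X ≠ 0) (N : ℕ) :
    (∏ k ∈ Finset.range N, (1 + p * X * (p ^ 2) ^ k)) *
      ∏ k ∈ Finset.range N, (1 + p * X⁻¹ * (p ^ 2) ^ k) =
    ∑ n ∈ Finset.Icc (-N : ℤ) N,
      gaussBinom (p ^ 2) (2 * N) (n + N).toNat * (p ^ (n ^ 2) * X ^ n) := by
  have h := prod_one_add_mul_pow (p ^ 2) (p ^ (1 - 2 * N : ℤ) * X) (2 * N)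
  have e1 : ∏ k ∈ Finset.range (2 * N), (1 + p ^ (1 - 2 * N : ℤ) * X * (p ^ 2) ^ k) =
      (p ^ (-(N : ℤ) ^ 2) * X ^ N) * ((∏ k ∈ Finset.range N, (1 + p * X * (p ^ 2) ^ k)) *
      ∏ k ∈ Finset.range N, (1 + p * X⁻¹ * (p ^ 2) ^ k)) := by
    have hc : ∏ k ∈ Finset.range N, (p ^ (-1 - 2 * k : ℤ) * X) = p ^ (-(N : ℤ) ^ 2) * X ^ N := by
      rw [Finset.prod_mul_distrib, Finset.prod_const, Finset.card_range]
      congr 1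
      clear h
      induction N with
      | zero => simp
      | succ N ih =>
        rw [Finset.prod_range_succ, ih, ← zpow_add₀ hp]
        congr 1; push_cast; ring
    have h1 : ∏ k ∈ Finset.range N, (1 + p ^ (1 - 2 * N : ℤ) * X * (p ^ 2) ^ k) =
        ∏ k ∈ Finset.range N, (p ^ (-1 - 2 * k : ℤ) * X * (1 + p * X⁻¹ * (p ^ 2) ^ k)) := by
      rw [← Finset.prod_range_reflect]
      refine Finset.prod_congr rfl fun k hk => ?_
      have hk := Finset.mem_range.1 hk
      rw [← pow_mul, ← zpow_natCast, ← pow_mul, ← zpow_natCast p (2 * k), mul_right_comm,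
        ← zpow_add₀ hp, mul_right_comm p X⁻¹, ← zpow_one_add₀ hp, mul_add, mul_one,
        mul_mul_mul_comm, ← zpow_add₀ hp, mul_inv_cancel₀ hX, add_comm]
      congr 1
      · congr 2; push_cast [Nat.cast_sub (by omega : k ≤ N - 1), Nat.cast_sub (by omega : 1 ≤ N)]
        ring
      · rw [mul_one, ← zpow_zero p]; congr 1; push_cast; ring
    have h2 : ∏ k ∈ Finset.range N, (1 + p ^ (1 - 2 * N : ℤ) * X * (p ^ 2) ^ (N + k)) =
        ∏ k ∈ Finset.range N, (1 + p * X * (p ^ 2) ^ k) := by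
      refine Finset.prod_congr rfl fun k _ => ?_
      rw [← pow_mul, ← zpow_natCast, ← pow_mul, ← zpow_natCast p (2 * k), mul_right_comm,
        ← zpow_add₀ hp, mul_right_comm p X, ← zpow_one_add₀ hp]
      congr 3; push_cast; ring
    rw [two_mul, Finset.prod_range_add, h1, h2, Finset.prod_mul_distrib, hc]
    ring
  rw [e1] at h
  have hc0 : p ^ (-(N : ℤ) ^ 2) * X ^ N ≠ 0 := mul_ne_zero (zpow_ne_zero _ hp) (pow_ne_zero _ hX)
  refine mul_left_cancel₀ hc0 (h.trans ?_)
  rw [Finset.mul_sum]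
  symm
  refine Finset.sum_bij' (fun n _ => (n + N).toNat) (fun k _ => (k : ℤ) - N) ?_ ?_ ?_ ?_ ?_
  · intro n hn; simp only [Finset.mem_Icc] at hn; simp only [Finset.mem_range]; omega
  · intro k hk; simp only [Finset.mem_range] at hk; simp only [Finset.mem_Icc]; omega
  · intro n hn; simp only [Finset.mem_Icc] at hn; omega
  · intro k hk; omega
  · intro n hn
    simp only [Finset.mem_Icc] at hn
    obtain ⟨k, hk⟩ : ∃ k : ℕ, n + N = k := ⟨(n + N).toNat, by omega⟩
    obtain rfl : n = k - N := by omega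
    simp only [sub_add_cancel, Int.toNat_natCast]
    have hch : (2 : ℤ) * ((k.choose 2 : ℕ) : ℤ) = k * k - k := by
      have := Nat.choose_two_right k
      have h2 : 2 * (k * (k - 1) / 2) = k * (k - 1) :=
        Nat.mul_div_cancel' (Nat.even_mul_pred_self k).two_dvd
      rw [this]
      rcases k with _ | k
      · simp
      · have := congrArg (Nat.cast (R := ℤ)) h2
        rw [Nat.add_sub_cancel] at this ⊢
        push_cast at this ⊢
        linarith
    have hX' : X ^ N * X ^ (k - N : ℤ) = X ^ k := by
      rw [← zpow_natCast, ← zpow_natCast, ← zpow_add₀ hX]; congr 1; ring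
    have hp' : p ^ (-(N : ℤ) ^ 2) * p ^ ((k - N : ℤ) ^ 2) =
        (p ^ 2) ^ (k.choose 2) * (p ^ (1 - 2 * N : ℤ)) ^ k := by
      rw [← pow_mul, ← zpow_natCast, ← zpow_natCast (p ^ _) k, ← zpow_mul, ← zpow_add₀ hp,
        ← zpow_add₀ hp]
      congr 1; push_cast; rw [hch]; ring
    rw [mul_pow, ← hX']
    linear_combination gaussBinom (p ^ 2) (2 * N) k * X ^ N * X ^ (k - N : ℤ) * hp'

theorem tendsto_qFact {q : ℂ} (hq : ‖q‖ < 1) : Tendsto (qFact q) atTop (𝓝 (poch q q)) := by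
  have := (multipliable_poch q hq).hasProd.tendsto_prod_nat
  refine this.congr fun n => ?_
  simp [qFact, pow_succ']

theorem qFact_ne_zero {q : ℂ} (hq : ‖q‖ < 1) (n : ℕ) : qFact q n ≠ 0 :=
  Finset.prod_ne_zero_iff.2 fun k _ => sub_ne_zero.2 fun h =>
    mul_pow_ne_one hq hq k (by rw [← pow_succ', ← h])

theorem summable_theta1 {p X : ℂ} (hp0 : p ≠ 0) (hp : ‖p‖ < 1) (hX : X ≠ 0) :
    Summable fun n : ℤ => ‖p ^ (n ^ 2) * X ^ n‖ := by
  have h := (summable_jacobiTheta₂_term_iff (Complex.log X / (2 * Real.pi * I))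
    (Complex.log p / (Real.pi * I))).2 (by
      have : Complex.log p / (Real.pi * I) = -(Complex.log p * I) / Real.pi := by
        field_simp; rw [I_sq]; ring
      rw [this, div_ofReal_im]
      simp only [neg_im, mul_im, I_im, I_re, mul_one, mul_zero, add_zero, log_re]
      have := Real.log_neg (norm_pos_iff.2 hp0) hp
      exact div_pos (by linarith) Real.pi_pos)
  refine h.norm.congr fun n => ?_
  congr 1
  rw [jacobiTheta₂_term, Complex.exp_add]
  have hpi : (Real.pi : ℂ) ≠ 0 := by exact_mod_cast Real.pi_ne_zero
  have e1 : 2 * (Real.pi : ℂ) * I * n * (Complex.log X / (2 * Real.pi * I)) =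
      (n : ℂ) * Complex.log X := by field_simp
  have e2 : (Real.pi : ℂ) * I * n ^ 2 * (Complex.log p / (Real.pi * I)) =
      ((n ^ 2 : ℤ) : ℂ) * Complex.log p := by push_cast; field_simp
  rw [e1, e2, Complex.exp_int_mul, Complex.exp_int_mul, Complex.exp_log hX, Complex.exp_log hp0,
    mul_comm]

theorem bounded_gaussBinom {q : ℂ} (hq : ‖q‖ < 1) : ∃ K : ℝ, ∀ a b, ‖gaussBinom q (a + b) a‖ ≤ K := by
  obtain ⟨K₁, hK₁⟩ := (tendsto_qFact hq).norm.bddAbove_range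
  obtain ⟨K₂, hK₂⟩ := ((tendsto_qFact hq).inv₀ (poch_self_ne_zero hq)).norm.bddAbove_range
  have h1 : ∀ n, ‖qFact q n‖ ≤ K₁ := fun n => hK₁ ⟨n, rfl⟩
  have h2 : ∀ n, ‖(qFact q n)⁻¹‖ ≤ K₂ := fun n => hK₂ ⟨n, rfl⟩
  refine ⟨K₁ * (K₂ * K₂), fun a b => ?_⟩
  have : gaussBinom q (a + b) a = qFact q (a + b) * ((qFact q a)⁻¹ * (qFact q b)⁻¹) := by
    rw [← gaussBinom_mul_qFact, ← mul_inv, mul_assoc, mul_inv_cancel₀, mul_one]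
    exact mul_ne_zero (qFact_ne_zero hq a) (qFact_ne_zero hq b)
  rw [this, norm_mul, norm_mul]
  have hK1 := (norm_nonneg _).trans (h1 0)
  have hK2 := (norm_nonneg _).trans (h2 0)
  gcongr <;> simp only [h1, h2]

theorem tendsto_gaussBinom {q : ℂ} (hq : ‖q‖ < 1) (n : ℤ) :
    Tendsto (fun N : ℕ => gaussBinom q (2 * N) (n + N).toNat) atTop (𝓝 (poch q q)⁻¹) := by
  have hA : Tendsto (fun N : ℕ => (n + N).toNat) atTop atTop :=
    tendsto_atTop.2 fun b => (eventually_ge_atTop (b + n.natAbs)).mono fun N hN => by omega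
  have hB : Tendsto (fun N : ℕ => (N - n).toNat) atTop atTop :=
    tendsto_atTop.2 fun b => (eventually_ge_atTop (b + n.natAbs)).mono fun N hN => by omega
  have hC : Tendsto (fun N : ℕ => 2 * N) atTop atTop :=
    tendsto_atTop.2 fun b => (eventually_ge_atTop b).mono fun N hN => by omega
  have h0 := poch_self_ne_zero hq
  have h := ((tendsto_qFact hq).comp hC).mul
    ((((tendsto_qFact hq).comp hA).mul ((tendsto_qFact hq).comp hB)).inv₀ (mul_ne_zero h0 h0))
  rw [mul_inv, mul_inv_cancel_left₀ h0] at h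
  refine h.congr' ((eventually_ge_atTop n.natAbs).mono fun N hN => ?_)
  simp only [Function.comp_apply]
  rw [show 2 * N = (n + N).toNat + (N - n).toNat by omega, ← gaussBinom_mul_qFact, mul_assoc,
    mul_inv_cancel₀ (mul_ne_zero (qFact_ne_zero hq _) (qFact_ne_zero hq _)), mul_one]

/-- The Jacobi triple product identity. -/
theorem theta1_eq_poch {p X : ℂ} (hp0 : p ≠ 0) (hp : ‖p‖ < 1) (hX : X ≠ 0) :
    theta1 p X = poch (p ^ 2) (p ^ 2) * (poch (-(p * X)) (p ^ 2) * poch (-(p * X⁻¹)) (p ^ 2)) := by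
  have hq : ‖p ^ 2‖ < 1 := norm_pow_lt_one hp two_ne_zero
  have h1 := (tendsto_prod_poch (-(p * X)) hq).mul (tendsto_prod_poch (-(p * X⁻¹)) hq)
  simp only [neg_mul, sub_neg_eq_add] at h1
  obtain ⟨K, hK⟩ := bounded_gaussBinom hq
  have h2 : Tendsto (fun N : ℕ => ∑' n : ℤ, (if n ∈ Finset.Icc (-N : ℤ) N then
      gaussBinom (p ^ 2) (2 * N) (n + N).toNat * (p ^ (n ^ 2) * X ^ n) else 0)) atTop
      (𝓝 (∑' n : ℤ, (poch (p ^ 2) (p ^ 2))⁻¹ * (p ^ (n ^ 2) * X ^ n))) := by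
    refine tendsto_tsum_of_dominated_convergence ((summable_theta1 hp0 hp hX).mul_left K)
      (fun n => ?_) (Eventually.of_forall fun N n => ?_)
    · refine ((tendsto_gaussBinom hq n).mul_const _).congr'
        ((eventually_ge_atTop n.natAbs).mono fun N hN => ?_)
      have hN' : n ∈ Finset.Icc (-N : ℤ) N := Finset.mem_Icc.2 (by omega)
      simp only [if_pos hN']
    · split_ifs with hn
      · rw [norm_mul]
        gcongr
        have := Finset.mem_Icc.1 hn
        have := hK (n + N).toNat (N - n).toNat
        rwa [show (n + N).toNat + (N - n).toNat = 2 * N by omega] at this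
      · rw [norm_zero]
        exact mul_nonneg ((norm_nonneg _).trans (hK 0 0)) (norm_nonneg _)
  have h3 := tendsto_nhds_unique h1 (h2.congr fun N => by
    rw [prod_mul_prod_eq_sum hp0 hX, tsum_eq_sum (s := Finset.Icc (-N : ℤ) N)
      (fun n hn => if_neg hn)]
    exact Finset.sum_congr rfl fun n hn => if_pos hn)
  rw [h3, tsum_mul_left, mul_inv_cancel_left₀ (poch_self_ne_zero hq)]
  rfl

/-! ### Even theta functions of a given degree -/

/-- Even theta functions of degree `k`: `g(X) = ∑ cₙ Xⁿ` with `c₋ₙ = cₙ` and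
`cₙ₊ₖ = p^{k + 2n} cₙ`. -/
def IsEvenTheta (p : ℂ) (k : ℕ) (g : ℂ → ℂ) : Prop :=
  ∃ c : ℤ → ℂ, (∀ n, c (-n) = c n) ∧ (∀ n, c (n + k) = p ^ (k + 2 * n) * c n) ∧
    ∀ X : ℂ, X ≠ 0 → Summable (fun n => ‖c n * X ^ n‖) ∧ g X = ∑' n, c n * X ^ n

theorem IsEvenTheta.one (p : ℂ) : IsEvenTheta p 0 fun _ => 1 := by
  refine ⟨fun n => if n = 0 then 1 else 0, by simp, fun n => ?_, fun X hX => ⟨?_, ?_⟩⟩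
  · by_cases h : n = 0 <;> simp [h]
  · exact summable_of_ne_finset_zero (s := {0}) (by intro b hb; simp_all)
  · rw [tsum_eq_single 0 (by intro b hb; simp [hb])]; simp

theorem IsEvenTheta.mul {p : ℂ} (hp : p ≠ 0) {a b : ℕ} {g h : ℂ → ℂ} (hg : IsEvenTheta p a g)
    (hh : IsEvenTheta p b h) : IsEvenTheta p (a + b) fun X => g X * h X := by
  obtain ⟨c, hc, hca, hcs⟩ := hg
  obtain ⟨d, hd, hdb, hds⟩ := hh
  let e : ℤ × ℤ ≃ ℤ × ℤ :=
    { toFun := fun x => (x.2, x.1 - x.2)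
      invFun := fun x => (x.1 + x.2, x.1)
      left_inv := fun x => by ext <;> simp
      right_inv := fun x => by ext <;> simp }
  have key : ∀ X : ℂ, X ≠ 0 → ∀ x : ℤ × ℤ, (c (e x).1 * X ^ (e x).1) * (d (e x).2 * X ^ (e x).2) =
      c x.2 * d (x.1 - x.2) * X ^ x.1 := by
    rintro X hX ⟨n, m⟩
    have : X ^ n = X ^ m * X ^ (n - m) := by rw [← zpow_add₀ hX]; congr 1; ring
    simp only [e, Equiv.coe_fn_mk, this]; ring
  have hs : ∀ X : ℂ, X ≠ 0 →
      Summable fun x : ℤ × ℤ => ‖c x.2 * d (x.1 - x.2) * X ^ x.1‖ := fun X hX => by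
    have h1 := (hcs X hX).1.mul_norm (hds X hX).1
    exact ((e.summable_iff).2 h1).congr fun x => by
      rw [← key X hX]; rfl
  refine ⟨fun n => ∑' m, c m * d (n - m), fun n => ?_, fun n => ?_, fun X hX => ⟨?_, ?_⟩⟩
  · beta_reduce
    rw [← (Equiv.neg ℤ).tsum_eq]
    refine tsum_congr fun m => ?_
    rw [Equiv.neg_apply, hc, show -n - -m = -(n - m) by ring, hd]
  · beta_reduce
    rw [← (Equiv.addRight (a : ℤ)).tsum_eq, ← tsum_mul_left]
    refine tsum_congr fun m => ?_
    rw [Equiv.coe_addRight, hca, show n + ((a + b : ℕ) : ℤ) - (m + a) = n - m + b by push_cast; ring,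
      hdb]
    have : p ^ (((a + b : ℕ) : ℤ) + 2 * n) = p ^ ((a : ℤ) + 2 * m) * p ^ ((b : ℤ) + 2 * (n - m)) := by
      rw [← zpow_add₀ hp]; congr 1; push_cast; ring
    rw [this]; ring
  · refine Summable.of_nonneg_of_le (fun _ => norm_nonneg _) (fun n => ?_) (hs X hX).prod
    rw [← tsum_mul_right]
    exact norm_tsum_le_tsum_norm ((hs X hX).prod_factor n)
  · beta_reduce
    rw [(hcs X hX).2, (hds X hX).2, tsum_mul_tsum_of_summable_norm (hcs X hX).1 (hds X hX).1,
      ← e.tsum_eq]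
    rw [tsum_congr (key X hX), (hs X hX).of_norm.tsum_prod]
    simp only [tsum_mul_right]

theorem IsEvenTheta.pow {p : ℂ} (hp : p ≠ 0) {a : ℕ} {g : ℂ → ℂ} (hg : IsEvenTheta p a g) (l : ℕ) :
    IsEvenTheta p (l * a) fun X => g X ^ l := by
  induction l with
  | zero => simpa using IsEvenTheta.one p
  | succ l ih => simpa [add_mul, pow_succ] using ih.mul hp hg

/-- The theta series `∑ₙ p^{kn² + 2rn} X^{r + kn}`. -/
def levelTheta (p : ℂ) (k : ℕ) (r : ℤ) (X : ℂ) : ℂ := X ^ r * theta1 (p ^ k) (p ^ (2 * r) * X ^ k)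

theorem levelTheta_term {p X : ℂ} (hp : p ≠ 0) (hX : X ≠ 0) (k : ℕ) (r n : ℤ) :
    X ^ r * ((p ^ k) ^ (n ^ 2) * (p ^ (2 * r) * X ^ k) ^ n) =
      p ^ (k * n ^ 2 + 2 * r * n) * X ^ (r + k * n) := by
  rw [mul_zpow, ← zpow_natCast, ← zpow_natCast, ← zpow_mul, ← zpow_mul, ← zpow_mul, zpow_add₀ hp,
    zpow_add₀ hX]
  ring

theorem levelTheta_eq_tsum {p X : ℂ} (hp : p ≠ 0) (hX : X ≠ 0) (k : ℕ) (r : ℤ) :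
    levelTheta p k r X = ∑' n : ℤ, p ^ (k * n ^ 2 + 2 * r * n) * X ^ (r + k * n) := by
  rw [levelTheta, theta1, ← tsum_mul_left]
  exact tsum_congr fun n => levelTheta_term hp hX k r n

theorem summable_levelTheta {p X : ℂ} (hp0 : p ≠ 0) (hp : ‖p‖ < 1) (hX : X ≠ 0) {k : ℕ} (hk : k ≠ 0)
    (r : ℤ) : Summable fun n : ℤ => ‖p ^ (k * n ^ 2 + 2 * r * n) * X ^ (r + k * n)‖ := by
  have := (summable_theta1 (p := p ^ k) (X := p ^ (2 * r) * X ^ k) (pow_ne_zero _ hp0)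
    (norm_pow_lt_one hp hk) (mul_ne_zero (zpow_ne_zero _ hp0) (pow_ne_zero _ hX))).mul_left ‖X ^ r‖
  refine this.congr fun n => ?_
  rw [← norm_mul, levelTheta_term hp0 hX]

theorem levelTheta_sub {p X : ℂ} (hp : p ≠ 0) (hX : X ≠ 0) (k : ℕ) (r : ℤ) :
    levelTheta p k (k - r) X = p ^ (2 * r - k) * levelTheta p k r X⁻¹ := by
  rw [levelTheta_eq_tsum hp hX, levelTheta_eq_tsum hp (inv_ne_zero hX), ← tsum_mul_left,
    ← ((Equiv.neg ℤ).trans (Equiv.subRight (1 : ℤ))).tsum_eq]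
  refine tsum_congr fun n => ?_
  rw [inv_zpow', ← mul_assoc, ← zpow_add₀ hp]
  simp only [Equiv.trans_apply, Equiv.neg_apply, Equiv.subRight_apply]
  congr 2 <;> ring

theorem levelTheta_zero_inv {p X : ℂ} (hp : p ≠ 0) (hX : X ≠ 0) (k : ℕ) :
    levelTheta p k 0 X⁻¹ = levelTheta p k 0 X := by
  rw [levelTheta_eq_tsum hp hX, levelTheta_eq_tsum hp (inv_ne_zero hX), ← (Equiv.neg ℤ).tsum_eq]
  refine tsum_congr fun n => ?_
  rw [inv_zpow']
  simp only [Equiv.neg_apply]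
  congr 2 <;> ring

/-- The even theta series `∑ₙ p^{kn² + 2rn} (X^{r + kn} + X^{-r - kn})`. -/
def evenTheta (p : ℂ) (k : ℕ) (r : ℤ) (X : ℂ) : ℂ := levelTheta p k r X + levelTheta p k r X⁻¹

theorem coeff_add_mul {p : ℂ} (hp : p ≠ 0) {k : ℕ} {c : ℤ → ℂ}
    (hc : ∀ n, c (n + k) = p ^ (k + 2 * n) * c n) (r m : ℤ) :
    c (r + k * m) = p ^ (k * m ^ 2 + 2 * r * m) * c r := by
  have step : ∀ m : ℤ, c (r + k * (m + 1)) = p ^ (k + 2 * (r + k * m)) * c (r + k * m) := fun m => by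
    rw [← hc]; congr 1; ring
  induction m with
  | zero => simp
  | succ m ih =>
    rw [step, ih, ← mul_assoc, ← zpow_add₀ hp]; congr 2; ring
  | pred m ih =>
    have := step (-m - 1)
    rw [sub_add_cancel, ih] at this
    refine mul_left_cancel₀ (zpow_ne_zero (k + 2 * (r + k * (-m - 1))) hp) (this.symm.trans ?_)
    rw [← mul_assoc, ← zpow_add₀ hp]; congr 2; ring

theorem tsum_eq_sum_levelTheta {p : ℂ} (hp : p ≠ 0) {k : ℕ} [NeZero k] {c : ℤ → ℂ}
    (hc : ∀ n, c (n + k) = p ^ (k + 2 * n) * c n) {X : ℂ} (hX : X ≠ 0)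
    (hs : Summable fun n => ‖c n * X ^ n‖) :
    ∑' n, c n * X ^ n = ∑ r : Fin k, c r * levelTheta p k r X := by
  let e : Fin k × ℤ ≃ ℤ := (Equiv.prodComm _ _).trans (Int.divModEquiv k).symm
  have he : ∀ x, c (e x) * X ^ e x =
      c x.1 * (p ^ (k * x.2 ^ 2 + 2 * (x.1 : ℤ) * x.2) * X ^ ((x.1 : ℤ) + k * x.2)) := by
    rintro ⟨r, m⟩
    have : e (r, m) = r + k * m := by simp [e, Int.divModEquiv_symm_apply]; ring
    rw [this, coeff_add_mul hp hc]; ring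
  have h1 : Summable fun x => c (e x) * X ^ e x :=
    (e.summable_iff (f := fun n => c n * X ^ n)).2 hs.of_norm
  rw [← e.tsum_eq, h1.tsum_prod, tsum_fintype]
  refine Finset.sum_congr rfl fun r _ => ?_
  rw [levelTheta_eq_tsum hp hX, ← tsum_mul_left]
  exact tsum_congr fun m => he (r, m)

theorem isEvenTheta_levelTheta_two {p : ℂ} (hp0 : p ≠ 0) (hp : ‖p‖ < 1) (r : ℤ) :
    IsEvenTheta p 2 (levelTheta p 2 r) := by
  let c : ℤ → ℂ := fun m => if (m - r) % 2 = 0 then p ^ ((m ^ 2 - r ^ 2) / 2) else 0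
  have hc : ∀ n : ℤ, c (r + 2 * n) = p ^ ((2 : ℕ) * n ^ 2 + 2 * r * n) := fun n => by
    simp only [c]
    rw [if_pos (by omega)]
    congr 1
    rw [show (r + 2 * n) ^ 2 - r ^ 2 = 2 * ((2 : ℕ) * n ^ 2 + 2 * r * n) by push_cast; ring]
    exact Int.mul_ediv_cancel_left _ two_ne_zero
  have hi : Function.Injective fun n : ℤ => r + 2 * n := fun a b h => by simpa using h
  have h0 : ∀ m, m ∉ Set.range (fun n : ℤ => r + 2 * n) → c m = 0 := fun m hm =>
    if_neg fun h => hm ⟨(m - r) / 2, by dsimp only; omega⟩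
  refine ⟨c, fun n => ?_, fun n => ?_, fun X hX => ⟨?_, ?_⟩⟩
  · simp only [c, neg_sq, show (-n - r) % 2 = 0 ↔ (n - r) % 2 = 0 by omega]
  · by_cases h : (n - r) % 2 = 0
    · obtain ⟨m, rfl⟩ : ∃ m, n = r + 2 * m := ⟨(n - r) / 2, by omega⟩
      rw [hc, show r + 2 * m + ((2 : ℕ) : ℤ) = r + 2 * (m + 1) by push_cast; ring, hc,
        ← zpow_add₀ hp0]
      congr 1; push_cast; ring
    · simp only [c, if_neg h]
      rw [if_neg (by push_cast; omega), mul_zero]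
  · refine (hi.summable_iff fun m hm => by rw [h0 m hm]; simp).1 ?_
    refine (summable_levelTheta hp0 hp hX two_ne_zero r).congr fun n => ?_
    simp only [Function.comp_apply, hc]
    rfl
  · rw [levelTheta_eq_tsum hp0 hX, ← hi.tsum_eq (f := fun m => c m * X ^ m)]
    · exact tsum_congr fun n => by rw [hc]; rfl
    · intro m hm
      by_contra h
      exact hm (by simp [h0 m h])

theorem isEvenTheta_theta1 {p : ℂ} (hp0 : p ≠ 0) (hp : ‖p‖ < 1) : IsEvenTheta p 1 (theta1 p) := by
  refine ⟨fun n => p ^ (n ^ 2), by simp, fun n => ?_, fun X hX => ⟨summable_theta1 hp0 hp hX, rfl⟩⟩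
  beta_reduce
  rw [← zpow_add₀ hp0, Nat.cast_one]; congr 1; ring

/-- The weight `(3, 2, 1, 0)`. -/
def wt : Fin 4 → ℤ := ![3, 2, 1, 0]

theorem evenTheta_pair {p : ℂ} (hp : p ≠ 0) {k : ℕ} {c : ℤ → ℂ} (hc : ∀ n, c (-n) = c n)
    (hck : ∀ n, c (n + k) = p ^ (k + 2 * n) * c n) {X : ℂ} (hX : X ≠ 0) {r s : ℤ} (hrs : s = k - r) :
    c r * levelTheta p k r X + c s * levelTheta p k s X = c r * evenTheta p k r X := by
  have h1 : c s = p ^ (k - 2 * r) * c r := by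
    rw [hrs, sub_eq_neg_add, hck, hc]; congr 2; ring
  have h2 : p ^ (k - 2 * r) * p ^ (2 * r - k) = 1 := by
    rw [← zpow_add₀ hp, ← zpow_zero p]; congr 1; ring
  rw [hrs] at h1 ⊢
  rw [levelTheta_sub hp hX, h1, evenTheta]
  linear_combination c r * levelTheta p k r X⁻¹ * h2

theorem evenTheta_zero {p X : ℂ} (hp : p ≠ 0) (hX : X ≠ 0) (k : ℕ) :
    evenTheta p k 0 X = 2 * levelTheta p k 0 X := by
  rw [evenTheta, levelTheta_zero_inv hp hX, two_mul]

theorem IsEvenTheta.exists_six {p : ℂ} (hp : p ≠ 0) {g : ℂ → ℂ} (hg : IsEvenTheta p 6 g) :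
    ∃ m : Fin 4 → ℂ, ∀ X, X ≠ 0 → g X = ∑ i, m i * evenTheta p 6 (wt i) X := by
  obtain ⟨c, hc, hck, hs⟩ := hg
  refine ⟨![c 3 / 2, c 2, c 1, c 0 / 2], fun X hX => ?_⟩
  have h1 := evenTheta_pair hp hc hck hX (r := 1) (s := 5) (by norm_num)
  have h2 := evenTheta_pair hp hc hck hX (r := 2) (s := 4) (by norm_num)
  have h3 := evenTheta_pair hp hc hck hX (r := 3) (s := 3) (by norm_num)
  have h0 := evenTheta_zero hp hX 6
  rw [(hs X hX).2, tsum_eq_sum_levelTheta hp hck hX (hs X hX).1]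
  simp [Fin.sum_univ_succ, wt, Fin.succ] 
  linear_combination h1 + h2 + h3 / 2 - c 0 / 2 * h0

theorem IsEvenTheta.exists_seven {p : ℂ} (hp : p ≠ 0) {g : ℂ → ℂ} (hg : IsEvenTheta p 7 g) :
    ∃ m : Fin 4 → ℂ, ∀ X, X ≠ 0 → g X = ∑ i, m i * evenTheta p 7 (wt i) X := by
  obtain ⟨c, hc, hck, hs⟩ := hg
  refine ⟨![c 3, c 2, c 1, c 0 / 2], fun X hX => ?_⟩
  have h1 := evenTheta_pair hp hc hck hX (r := 1) (s := 6) (by norm_num)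
  have h2 := evenTheta_pair hp hc hck hX (r := 2) (s := 5) (by norm_num)
  have h3 := evenTheta_pair hp hc hck hX (r := 3) (s := 4) (by norm_num)
  have h0 := evenTheta_zero hp hX 7
  rw [(hs X hX).2, tsum_eq_sum_levelTheta hp hck hX (hs X hX).1]
  simp [Fin.sum_univ_succ, wt, Fin.succ]
  linear_combination h1 + h2 + h3 - c 0 / 2 * h0

/-! ### The addition formula -/

theorem levelTheta_two_addition {p X Y : ℂ} (hp0 : p ≠ 0) (hp : ‖p‖ < 1) (hX : X ≠ 0) (hY : Y ≠ 0) :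
    levelTheta p 2 0 X * levelTheta p 2 1 Y - levelTheta p 2 0 Y * levelTheta p 2 1 X =
      Y * (theta1 p (-(p * (X * Y))) * theta1 p (-(p * (Y * X⁻¹)))) := by
  have hX' := inv_ne_zero hX
  have hp' : ∀ {Z : ℂ}, Z ≠ 0 → -(p * Z) ≠ 0 := fun hZ => neg_ne_zero.2 (mul_ne_zero hp0 hZ)
  have hu : ∀ {X : ℂ}, X ≠ 0 → ∀ r : ℤ, HasSum (fun n : ℤ => p ^ ((2 : ℕ) * n ^ 2 + 2 * r * n) *
      X ^ (r + (2 : ℕ) * n)) (levelTheta p 2 r X) := fun {X} hX r => by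
    rw [levelTheta_eq_tsum hp0 hX]
    exact (summable_levelTheta hp0 hp hX two_ne_zero r).of_norm.hasSum
  let R : ℤ × ℤ → ℂ := fun x => Y * ((p ^ (x.1 ^ 2) * (-(p * (X * Y))) ^ x.1) *
    (p ^ (x.2 ^ 2) * (-(p * (Y * X⁻¹))) ^ x.2))
  have hR : HasSum R (Y * (theta1 p (-(p * (X * Y))) * theta1 p (-(p * (Y * X⁻¹))))) := by
    have h1 := summable_theta1 hp0 hp (hp' (mul_ne_zero hX hY))
    have h2 := summable_theta1 hp0 hp (hp' (mul_ne_zero hY hX'))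
    have h3 := summable_mul_of_summable_norm h1 h2
    have h4 := (h1.of_norm.hasSum.mul h2.of_norm.hasSum h3).mul_left Y
    exact h4
  have hprod : ∀ {X Y : ℂ}, X ≠ 0 → Y ≠ 0 → HasSum (fun x : ℤ × ℤ =>
      (p ^ ((2 : ℕ) * x.1 ^ 2 + 2 * 0 * x.1) * X ^ (0 + (2 : ℕ) * x.1)) *
      (p ^ ((2 : ℕ) * x.2 ^ 2 + 2 * 1 * x.2) * Y ^ (1 + (2 : ℕ) * x.2)))
      (levelTheta p 2 0 X * levelTheta p 2 1 Y) := fun {X Y} hX hY => by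
    have h3 := summable_mul_of_summable_norm (summable_levelTheta hp0 hp hX two_ne_zero 0)
      (summable_levelTheta hp0 hp hY two_ne_zero 1)
    have h4 := (hu hX 0).mul (hu hY 1) h3
    exact h4
  have hRe : ∀ s t : ℤ, R (s, t) =
      (-1) ^ (s + t) * p ^ (s ^ 2 + s + t ^ 2 + t) * X ^ (s - t) * Y ^ (s + t + 1) := fun s t => by
    simp only [R]
    rw [neg_eq_neg_one_mul, neg_eq_neg_one_mul (p * (Y * X⁻¹))]
    simp only [mul_zpow, inv_zpow', zpow_add₀ (neg_ne_zero.2 (one_ne_zero (α := ℂ))),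
      zpow_add₀ hp0, zpow_add₀ hY, sub_eq_add_neg, zpow_add₀ hX, zpow_one]
    ring
  let i₁ : ℤ × ℤ → ℤ × ℤ := fun x => (x.1 + x.2, x.2 - x.1)
  let i₂ : ℤ × ℤ → ℤ × ℤ := fun x => (x.1 + x.2, x.1 - x.2 - 1)
  have hi₁ : Function.Injective i₁ := by
    rintro ⟨a, b⟩ ⟨c, d⟩ h
    simp only [i₁, Prod.mk.injEq] at h ⊢
    omega
  have hi₂ : Function.Injective i₂ := by
    rintro ⟨a, b⟩ ⟨c, d⟩ h
    simp only [i₂, Prod.mk.injEq] at h ⊢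
    omega
  have hcompl : IsCompl (Set.range i₁) (Set.range i₂) := by
    constructor
    · rw [Set.disjoint_iff]
      rintro _ ⟨⟨⟨a, b⟩, rfl⟩, ⟨⟨c, d⟩, h⟩⟩
      simp only [i₁, i₂, Prod.mk.injEq] at h
      omega
    · rw [codisjoint_iff_le_sup]
      rintro ⟨s, t⟩ -
      rcases Int.emod_two_eq_zero_or_one (s + t) with h | h
      · exact Or.inl ⟨((s - t) / 2, (s + t) / 2), by simp only [i₁, Prod.mk.injEq]; omega⟩
      · exact Or.inr ⟨((s + t + 1) / 2, (s - t) / 2), by simp only [i₂, Prod.mk.injEq]; omega⟩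
  have h1 : HasSum (R ∘ i₁) (levelTheta p 2 0 X * levelTheta p 2 1 Y) := by
    refine (hprod hX hY).congr_fun ?_
    rintro ⟨n, m⟩
    simp only [Function.comp_apply, i₁]
    rw [hRe, show n + m + (m - n) = 2 * m by ring, zpow_mul, show ((-1 : ℂ) ^ (2 : ℤ)) = 1 by norm_num,
      one_zpow, one_mul, mul_mul_mul_comm, ← zpow_add₀ hp0, mul_assoc]
    congr 2
    · push_cast; ring
    · congr 1; push_cast; ring
    · congr 1; push_cast; ring
  have h2 : HasSum (R ∘ i₂) (-(levelTheta p 2 0 Y * levelTheta p 2 1 X)) := by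
    refine (hprod hY hX).neg.congr_fun ?_
    rintro ⟨n, m⟩
    simp only [Function.comp_apply, i₂]
    rw [hRe, show n + m + (n - m - 1) = 2 * (n - 1) + 1 by ring,
      zpow_add₀ (neg_ne_zero.2 (one_ne_zero (α := ℂ))), zpow_mul,
      show ((-1 : ℂ) ^ (2 : ℤ)) = 1 by norm_num, one_zpow, one_mul, zpow_one, mul_mul_mul_comm,
      ← zpow_add₀ hp0, mul_comm (Y ^ _) (X ^ _), neg_one_mul, neg_mul, neg_mul, mul_assoc]
    congr 3
    · push_cast; ring
    · congr 1; push_cast; ring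
    · congr 1; push_cast; ring
  have h3 := HasSum.add_isCompl hcompl (hi₁.hasSum_range_iff.2 h1) (hi₂.hasSum_range_iff.2 h2)
  rw [sub_eq_add_neg]
  exact h3.unique hR

/-! ### The determinant identity between levels six and seven -/

/-- The product `(q; q)_∞ (qZ; q)_∞ (q/Z; q)_∞` with `q = p²`. -/
def thetaProd (p Z : ℂ) : ℂ :=
  poch (p ^ 2) (p ^ 2) * (poch (p ^ 2 * Z) (p ^ 2) * poch (p ^ 2 * Z⁻¹) (p ^ 2))

theorem thetaProd_inv (p Z : ℂ) : thetaProd p Z⁻¹ = thetaProd p Z := by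
  rw [thetaProd, thetaProd, inv_inv]; ring

theorem theta1_neg {p Z : ℂ} (hp0 : p ≠ 0) (hp : ‖p‖ < 1) (hZ : Z ≠ 0) :
    theta1 p (-(p * Z)) = (1 - Z⁻¹) * thetaProd p Z := by
  have hq : ‖p ^ 2‖ < 1 := norm_pow_lt_one hp two_ne_zero
  rw [theta1_eq_poch hp0 hp (neg_ne_zero.2 (mul_ne_zero hp0 hZ)),
    show -(p * -(p * Z)) = p ^ 2 * Z by ring, show -(p * (-(p * Z))⁻¹) = Z⁻¹ by field_simp,
    poch_eq_mul Z⁻¹ hq, thetaProd, mul_comm Z⁻¹]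
  ring

theorem levelTheta_two_addition' {p X Y : ℂ} (hp0 : p ≠ 0) (hp : ‖p‖ < 1) (hX : X ≠ 0)
    (hY : Y ≠ 0) :
    levelTheta p 2 0 X * levelTheta p 2 1 Y - levelTheta p 2 0 Y * levelTheta p 2 1 X =
      ((Y + Y⁻¹) - (X + X⁻¹)) * (thetaProd p (X * Y) * thetaProd p (X * Y⁻¹)) := by
  rw [levelTheta_two_addition hp0 hp hX hY, theta1_neg hp0 hp (mul_ne_zero hX hY),
    theta1_neg hp0 hp (mul_ne_zero hY (inv_ne_zero hX)), ← thetaProd_inv p (X * Y⁻¹), mul_inv,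
    mul_inv, mul_inv, inv_inv, inv_inv, mul_comm X⁻¹ Y]
  field_simp
  ring

/-- The matrix of the even theta series of degree `k` for the weight `(3, 2, 1, 0)`. -/
def thetaMatrix (p : ℂ) (k : ℕ) (X : Fin 4 → ℂ) : Matrix (Fin 4) (Fin 4) ℂ :=
  Matrix.of fun i j => evenTheta p k (wt i) (X j)

/-- The product of the `u(Xⱼ) v(Xᵢ) - u(Xᵢ) v(Xⱼ)` for `i < j`, where `u`, `v` are the theta series
of degree two. -/
def thetaVandermonde (p : ℂ) (X : Fin 4 → ℂ) : ℂ :=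
  ∏ i, ∏ j ∈ Finset.Ioi i, (levelTheta p 2 0 (X j) * levelTheta p 2 1 (X i) -
    levelTheta p 2 0 (X i) * levelTheta p 2 1 (X j))

theorem thetaVandermonde_eq_det (p : ℂ) (X : Fin 4 → ℂ) : thetaVandermonde p X =
    (Matrix.of fun l j : Fin 4 => levelTheta p 2 0 (X j) ^ (l : ℕ) *
      levelTheta p 2 1 (X j) ^ (l.rev : ℕ)).det := by
  rw [thetaVandermonde, ← Matrix.det_projVandermonde (fun j => levelTheta p 2 0 (X j))
    (fun j => levelTheta p 2 1 (X j)), ← Matrix.det_transpose]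
  rfl

theorem isEvenTheta_monomial {p : ℂ} (hp0 : p ≠ 0) (hp : ‖p‖ < 1) (l : Fin 4) :
    IsEvenTheta p 6 fun X => levelTheta p 2 0 X ^ (l : ℕ) * levelTheta p 2 1 X ^ (l.rev : ℕ) := by
  have h := ((isEvenTheta_levelTheta_two hp0 hp 0).pow hp0 l).mul hp0
    ((isEvenTheta_levelTheta_two hp0 hp 1).pow hp0 l.rev)
  rwa [← add_mul, show (l : ℕ) + l.rev = 3 by simp only [Fin.val_rev]; omega] at h

theorem exists_thetaVandermonde_six {p : ℂ} (hp0 : p ≠ 0) (hp : ‖p‖ < 1) :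
    ∃ m : ℂ, ∀ X : Fin 4 → ℂ, (∀ j, X j ≠ 0) →
      thetaVandermonde p X = m * (thetaMatrix p 6 X).det := by
  choose M hM using fun l => (isEvenTheta_monomial hp0 hp l).exists_six hp0
  refine ⟨(Matrix.of M).det, fun X hX => ?_⟩
  rw [thetaVandermonde_eq_det, ← Matrix.det_mul]
  congr 1
  ext l j
  rw [Matrix.of_apply, hM l (X j) (hX j), Matrix.mul_apply]
  rfl

theorem exists_thetaVandermonde_seven {p : ℂ} (hp0 : p ≠ 0) (hp : ‖p‖ < 1) :
    ∃ m : ℂ, ∀ X : Fin 4 → ℂ, (∀ j, X j ≠ 0) →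
      thetaVandermonde p X * ∏ j, theta1 p (X j) = m * (thetaMatrix p 7 X).det := by
  choose M hM using fun l =>
    ((isEvenTheta_monomial hp0 hp l).mul hp0 (isEvenTheta_theta1 hp0 hp)).exists_seven hp0
  refine ⟨(Matrix.of M).det, fun X hX => ?_⟩
  rw [thetaVandermonde_eq_det, ← Matrix.det_mul, mul_comm, ← Matrix.det_mul_row]
  congr 1
  ext l j
  rw [Matrix.of_apply, Matrix.of_apply, mul_comm, Matrix.mul_apply]
  exact hM l (X j) (hX j)

theorem prod_prod_Ioi_fin_four (F : Fin 4 → Fin 4 → ℂ) :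
    ∏ i, ∏ j ∈ Finset.Ioi i, F i j = F 0 1 * F 0 2 * F 0 3 * F 1 2 * F 1 3 * F 2 3 := by
  rw [Fin.prod_univ_four, show Finset.Ioi (0 : Fin 4) = {1, 2, 3} by decide,
    show Finset.Ioi (1 : Fin 4) = {2, 3} by decide, show Finset.Ioi (2 : Fin 4) = {3} by decide,
    show Finset.Ioi (3 : Fin 4) = ∅ by decide]
  simp [-mul_eq_mul_right_iff, -mul_eq_mul_left_iff]
  ring

/-- The Weyl denominator of `D₄` (up to a factor two) as a Vandermonde determinant. -/
theorem det_zpow_add_zpow (x : Fin 4 → ℂ) (hx : ∀ j, x j ≠ 0) :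
    (Matrix.of fun i j : Fin 4 => x j ^ wt i + (x j)⁻¹ ^ wt i).det =
      2 * ∏ i, ∏ j ∈ Finset.Ioi i, ((x i + (x i)⁻¹) - (x j + (x j)⁻¹)) := by
  have h : (Matrix.of fun i j : Fin 4 => x j ^ wt i + (x j)⁻¹ ^ wt i) =
      Matrix.of ![fun j => (x j + (x j)⁻¹) ^ 3 - 3 * (x j + (x j)⁻¹),
        fun j => (x j + (x j)⁻¹) ^ 2 - 2, fun j => x j + (x j)⁻¹, fun _ => 2] := by
    ext i j
    have := hx j
    fin_cases i
    · simp [wt, zpow_ofNat]; field_simp; ring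
    · simp [wt, zpow_ofNat]; field_simp; ring
    · simp [wt]
    · simp [wt]; norm_num
  rw [h, prod_prod_Ioi_fin_four]
  simp [Matrix.det_succ_row_zero, Fin.sum_univ_succ, Fin.succAbove]
  ring

theorem evenTheta_root {p ζ : ℂ} {k : ℕ} (hζ : ζ ^ k = 1) (r : ℤ) (n : ℕ) :
    evenTheta p k r (ζ ^ n) = theta1 (p ^ k) (p ^ (2 * r)) * ((ζ ^ n) ^ r + (ζ ^ n)⁻¹ ^ r) := by
  have h : (ζ ^ n) ^ k = 1 := by rw [← pow_mul, mul_comm, pow_mul, hζ, one_pow]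
  rw [evenTheta, levelTheta, levelTheta, inv_pow, h, inv_one, mul_one]; ring

theorem det_thetaMatrix_root {p ζ : ℂ} {k : ℕ} (hζ : ζ ^ k = 1) (hζ0 : ζ ≠ 0) :
    (thetaMatrix p k fun j => ζ ^ (j : ℕ)).det = (∏ i, theta1 (p ^ k) (p ^ (2 * wt i))) *
      (2 * ∏ i : Fin 4, ∏ j ∈ Finset.Ioi i, ((ζ ^ (i : ℕ) + (ζ ^ (i : ℕ))⁻¹) -
        (ζ ^ (j : ℕ) + (ζ ^ (j : ℕ))⁻¹))) := by
  rw [← det_zpow_add_zpow _ fun j => pow_ne_zero _ hζ0, ← Matrix.det_mul_column]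
  congr 1
  ext i j
  exact evenTheta_root hζ _ _

theorem root_prod_ne_zero {k : ℕ} (hk : 5 < k) {ζ : ℂ} (hζ : IsPrimitiveRoot ζ k) :
    ∏ i : Fin 4, ∏ j ∈ Finset.Ioi i, ((ζ ^ (i : ℕ) + (ζ ^ (i : ℕ))⁻¹) -
        (ζ ^ (j : ℕ) + (ζ ^ (j : ℕ))⁻¹)) ≠ 0 := by
  have hζ0 : ζ ≠ 0 := hζ.ne_zero (by omega)
  refine Finset.prod_ne_zero_iff.2 fun i _ => Finset.prod_ne_zero_iff.2 fun j hj => ?_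
  have hij : (i : ℕ) < j := Fin.lt_def.1 (Finset.mem_Ioi.1 hj)
  obtain ⟨d, hd⟩ := Nat.exists_eq_add_of_lt hij
  rw [show (j : ℕ) = i + (d + 1) by omega]
  have h1 : ζ ^ (d + 1) ≠ 1 := hζ.pow_ne_one_of_pos_of_lt (by omega) (by omega)
  have h2 : ζ ^ ((i : ℕ) + (i + (d + 1))) ≠ 1 := hζ.pow_ne_one_of_pos_of_lt (by omega) (by omega)
  have h3 := pow_ne_zero i hζ0
  have h4 := pow_ne_zero (d + 1) hζ0
  have e : ((ζ ^ (i : ℕ) + (ζ ^ (i : ℕ))⁻¹) - (ζ ^ ((i : ℕ) + (d + 1)) +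
      (ζ ^ ((i : ℕ) + (d + 1)))⁻¹)) * ζ ^ ((i : ℕ) + (d + 1)) =
      (1 - ζ ^ (d + 1)) * (ζ ^ ((i : ℕ) + (i + (d + 1))) - 1) := by
    rw [pow_add ζ i, pow_add ζ i, pow_add ζ i]
    field_simp
    ring
  intro h0
  rw [h0, zero_mul] at e
  exact (mul_ne_zero (sub_ne_zero.2 h1.symm) (sub_ne_zero.2 h2)) e.symm

theorem thetaVandermonde_root {p ζ : ℂ} (hp0 : p ≠ 0) (hp : ‖p‖ < 1) (hζ0 : ζ ≠ 0) :
    thetaVandermonde p (fun j => ζ ^ (j : ℕ)) =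
      (∏ i : Fin 4, ∏ j ∈ Finset.Ioi i, ((ζ ^ (i : ℕ) + (ζ ^ (i : ℕ))⁻¹) -
        (ζ ^ (j : ℕ) + (ζ ^ (j : ℕ))⁻¹))) *
      (thetaProd p ζ ^ 4 * thetaProd p (ζ ^ 2) ^ 3 * thetaProd p (ζ ^ 3) ^ 3 *
        thetaProd p (ζ ^ 4) * thetaProd p (ζ ^ 5)) := by
  rw [thetaVandermonde]
  simp only [levelTheta_two_addition' hp0 hp (pow_ne_zero _ hζ0) (pow_ne_zero _ hζ0)]
  simp only [Finset.prod_mul_distrib, prod_prod_Ioi_fin_four]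
  have h1 : ζ ^ 2 * ζ⁻¹ = ζ := by field_simp
  have h2 : ζ ^ 3 * ζ⁻¹ = ζ ^ 2 := by field_simp
  have h3 : ζ ^ 3 * (ζ ^ 2)⁻¹ = ζ := by field_simp
  simp [h1, h2, h3, ← pow_succ, ← pow_add, -mul_eq_mul_right_iff, -mul_eq_mul_left_iff]
  ring

section Torsion

variable {p : ℂ}

theorem thetaVandermonde_six_root (hp0 : p ≠ 0) (hp : ‖p‖ < 1) {ζ : ℂ}
    (hζ : IsPrimitiveRoot ζ 6) :
    2 * (thetaProd p ζ ^ 4 * thetaProd p (ζ ^ 2) ^ 3 * thetaProd p (ζ ^ 3) ^ 3 *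
        thetaProd p (ζ ^ 4) * thetaProd p (ζ ^ 5)) =
      poch (p ^ 2) (p ^ 2) ^ 8 * ∏ i, theta1 (p ^ 6) (p ^ (2 * wt i)) := by
  have h6 := hζ.pow_eq_one
  have hq : ‖p ^ 2‖ < 1 := norm_pow_lt_one hp two_ne_zero
  have hζ3 : ζ ^ 3 = -1 := by
    have h1 : ζ ^ 3 ≠ 1 := hζ.pow_ne_one_of_pos_of_lt (by norm_num) (by norm_num)
    have h2 : (ζ ^ 3 - 1) * (ζ ^ 3 + 1) = 0 := by linear_combination h6
    exact eq_neg_of_add_eq_zero_left ((mul_eq_zero.1 h2).resolve_left (sub_ne_zero.2 h1))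
  have i1 : ζ⁻¹ = ζ ^ 5 := inv_eq_of_mul_eq_one_right (by rw [← h6]; ring)
  have i2 : (ζ ^ 2)⁻¹ = ζ ^ 4 := inv_eq_of_mul_eq_one_right (by rw [← h6]; ring)
  have i3 : (ζ ^ 3)⁻¹ = ζ ^ 3 := inv_eq_of_mul_eq_one_right (by rw [← h6]; ring)
  rw [← i2, thetaProd_inv, ← i1, thetaProd_inv]
  set q := p ^ 2 with hqdef
  have r6 := prod_poch_root_mul (by norm_num) hζ q hq
  have hζ2 : IsPrimitiveRoot (ζ ^ 2) 3 := hζ.pow (by norm_num) (by norm_num)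
  have r3 := prod_poch_root_mul (by norm_num) hζ2 (ζ * q) hq
  have d6 := prod_poch_mul_pow (-q) hq (m := 6) (by norm_num)
  have hq3 : ‖q ^ 3‖ < 1 := norm_pow_lt_one hq three_ne_zero
  have hq6 : ‖q ^ 6‖ < 1 := norm_pow_lt_one hq (by norm_num)
  have d2 := prod_poch_mul_pow (-q ^ 3) hq3 (m := 2) (by norm_num)
  have hp6 : ‖p ^ 6‖ < 1 := norm_pow_lt_one hp (by norm_num)
  have hth : ∀ r : ℤ, ∀ a b : ℕ, 3 + r = a → 3 - r = b → theta1 (p ^ 6) (p ^ (2 * r)) =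
      poch (q ^ 6) (q ^ 6) * (poch (-q ^ a) (q ^ 6) * poch (-q ^ b) (q ^ 6)) := by
    intro r a b ha hb
    rw [theta1_eq_poch (pow_ne_zero _ hp0) hp6 (zpow_ne_zero _ hp0)]
    have e1 : p ^ 6 * p ^ (2 * r) = q ^ a := by
      rw [hqdef, ← pow_mul, ← zpow_natCast, ← zpow_natCast, ← zpow_add₀ hp0]
      congr 1; push_cast; omega
    have e2 : p ^ 6 * (p ^ (2 * r))⁻¹ = q ^ b := by
      rw [hqdef, ← pow_mul, ← zpow_natCast, ← zpow_natCast, ← zpow_neg, ← zpow_add₀ hp0]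
      congr 1; push_cast; omega
    rw [e1, e2, show (p ^ 6) ^ 2 = q ^ 6 by rw [hqdef]; ring]
  have hm1 : poch (-q ^ 0) (q ^ 6) = 2 * poch (-q ^ 6) (q ^ 6) := by
    rw [poch_eq_mul _ hq6]; norm_num
  rw [Fin.prod_univ_four]
  simp only [wt, Matrix.cons_val]
  rw [hth 3 6 0 (by norm_num) (by norm_num), hth 2 5 1 (by norm_num) (by norm_num),
    hth 1 4 2 (by norm_num) (by norm_num), hth 0 3 3 (by norm_num) (by norm_num), hm1]
  simp only [Finset.prod_range_succ, Finset.prod_range_zero, one_mul] at r6 r3 d6 d2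
  simp only [pow_zero, pow_one, one_mul, mul_one, neg_mul, ← pow_succ', ← pow_mul, ← pow_add,
    ← mul_assoc, ← pow_succ, mul_pow, hζ3, Nat.reduceAdd, Nat.reduceMul] at r6 r3 d6 d2
  simp only [thetaProd, ← hqdef, i1, i2, i3, mul_comm q]
  simp only [hζ3, neg_one_mul, pow_one]
  rw [← sq] at d6
  rw [← r6]
  linear_combination (-2) * poch q q ^ 12 * (poch (ζ * q) q * poch (ζ ^ 5 * q) q) ^ 4 *
    (poch (ζ ^ 2 * q) q * poch (ζ ^ 4 * q) q) ^ 4 * poch (-q) q ^ 4 *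
    ((poch (-q ^ 3) (q ^ 6) * poch (-q ^ 6) (q ^ 6)) * d6 + poch (-q) q * (d2 - r3))

theorem thetaVandermonde_seven_root (hp0 : p ≠ 0) (hp : ‖p‖ < 1) {ζ : ℂ}
    (hζ : IsPrimitiveRoot ζ 7) :
    (thetaProd p ζ ^ 4 * thetaProd p (ζ ^ 2) ^ 3 * thetaProd p (ζ ^ 3) ^ 3 *
        thetaProd p (ζ ^ 4) * thetaProd p (ζ ^ 5)) * ∏ j : Fin 4, theta1 p (ζ ^ (j : ℕ)) =
      poch (p ^ 2) (p ^ 2) ^ 12 * ∏ i, theta1 (p ^ 7) (p ^ (2 * wt i)) := by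
  have h7 := hζ.pow_eq_one
  have hζ0 : ζ ≠ 0 := hζ.ne_zero (by norm_num)
  have hq : ‖p ^ 2‖ < 1 := norm_pow_lt_one hp two_ne_zero
  have i1 : ζ⁻¹ = ζ ^ 6 := inv_eq_of_mul_eq_one_right (by rw [← h7]; ring)
  have i2 : (ζ ^ 2)⁻¹ = ζ ^ 5 := inv_eq_of_mul_eq_one_right (by rw [← h7]; ring)
  have i3 : (ζ ^ 3)⁻¹ = ζ ^ 4 := inv_eq_of_mul_eq_one_right (by rw [← h7]; ring)
  rw [← i3, thetaProd_inv, ← i2, thetaProd_inv]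
  have r7 := prod_poch_root_mul (by norm_num) hζ (p ^ 2) hq
  have s7 := prod_poch_root_mul (by norm_num) hζ (-p) hq
  have d7 := prod_poch_mul_pow (-p) hq (m := 7) (by norm_num)
  have hp7 : ‖p ^ 7‖ < 1 := norm_pow_lt_one hp (by norm_num)
  have hth : ∀ r : ℤ, ∀ a b : ℕ, 7 + 2 * r = a → 7 - 2 * r = b → theta1 (p ^ 7) (p ^ (2 * r)) =
      poch (p ^ 14) (p ^ 14) * (poch (-p ^ a) (p ^ 14) * poch (-p ^ b) (p ^ 14)) := by
    intro r a b ha hb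
    rw [theta1_eq_poch (pow_ne_zero _ hp0) hp7 (zpow_ne_zero _ hp0)]
    have e1 : p ^ 7 * p ^ (2 * r) = p ^ a := by
      rw [← zpow_natCast, ← zpow_natCast, ← zpow_add₀ hp0]
      congr 1
    have e2 : p ^ 7 * (p ^ (2 * r))⁻¹ = p ^ b := by
      rw [← zpow_natCast, ← zpow_natCast, ← zpow_neg, ← zpow_add₀ hp0]
      congr 1
    rw [e1, e2, ← pow_mul]
  have hth1 : ∀ j : ℕ, theta1 p (ζ ^ j) = poch (p ^ 2) (p ^ 2) *
      (poch (ζ ^ j * -p) (p ^ 2) * poch ((ζ ^ j)⁻¹ * -p) (p ^ 2)) := fun j => by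
    rw [theta1_eq_poch hp0 hp (pow_ne_zero _ hζ0), mul_neg, mul_neg, mul_comm p, mul_comm p]
  simp only [hth1]
  rw [Fin.prod_univ_four, Fin.prod_univ_four]
  simp only [wt, Matrix.cons_val]
  rw [hth 3 13 1 (by norm_num) (by norm_num), hth 2 11 3 (by norm_num) (by norm_num),
    hth 1 9 5 (by norm_num) (by norm_num), hth 0 7 7 (by norm_num) (by norm_num)]
  have n7 : (-p) ^ 7 = -p ^ 7 := by ring
  have d (n : ℕ) : -p * (p ^ 2) ^ n = -p ^ (2 * n + 1) := by ring
  simp only [Finset.prod_range_succ, Finset.prod_range_zero, one_mul, d] at r7 s7 d7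
  simp only [n7, pow_zero, pow_one, one_mul, mul_zero, zero_add, ← pow_mul, Nat.reduceMul,
    Nat.reduceAdd] at r7 s7 d7
  simp only [thetaProd, i1, i2, i3, mul_comm (p ^ 2) (_ : ℂ), Fin.coe_ofNat_eq_mod,
    Nat.reduceMod, pow_zero, pow_one, inv_one, one_mul]
  rw [← r7]
  linear_combination poch (p ^ 2) (p ^ 2) ^ 16 * (poch (ζ * p ^ 2) (p ^ 2) *
    poch (ζ ^ 2 * p ^ 2) (p ^ 2) * poch (ζ ^ 3 * p ^ 2) (p ^ 2) * poch (ζ ^ 4 * p ^ 2) (p ^ 2) *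
    poch (ζ ^ 5 * p ^ 2) (p ^ 2) * poch (ζ ^ 6 * p ^ 2) (p ^ 2)) ^ 4 *
    (poch (-p) (p ^ 2) * s7 - poch (-p ^ 7) (p ^ 14) * d7)

end Torsion

theorem thetaProd_ne_zero_of_norm {p Z : ℂ} (hp : ‖p‖ < 1) (h1 : ‖p ^ 2 * Z‖ < 1)
    (h2 : ‖p ^ 2 * Z⁻¹‖ < 1) : thetaProd p Z ≠ 0 := by
  have hq : ‖p ^ 2‖ < 1 := norm_pow_lt_one hp two_ne_zero
  exact mul_ne_zero (poch_self_ne_zero hq) (mul_ne_zero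
    (poch_ne_zero hq (mul_pow_ne_one hq h1)) (poch_ne_zero hq (mul_pow_ne_one hq h2)))

theorem thetaProd_root_ne_zero {p : ℂ} (hp : ‖p‖ < 1) {k : ℕ} (hk : k ≠ 0) {ζ : ℂ} (hζ : ζ ^ k = 1)
    (n : ℕ) : thetaProd p (ζ ^ n) ≠ 0 := by
  have hq : ‖p ^ 2‖ < 1 := norm_pow_lt_one hp two_ne_zero
  have h1 : ‖ζ‖ = 1 := Complex.norm_eq_one_of_pow_eq_one hζ hk
  exact thetaProd_ne_zero_of_norm hp (by simpa [h1] using hq) (by simpa [h1] using hq)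

theorem theta1_root_ne_zero {p : ℂ} (hp0 : p ≠ 0) (hp : ‖p‖ < 1) {k : ℕ} (hk : k ≠ 0) {ζ : ℂ}
    (hζ : ζ ^ k = 1) (n : ℕ) : theta1 p (ζ ^ n) ≠ 0 := by
  have hq : ‖p ^ 2‖ < 1 := norm_pow_lt_one hp two_ne_zero
  have h1 : ‖ζ‖ = 1 := Complex.norm_eq_one_of_pow_eq_one hζ hk
  have h0 : ζ ≠ 0 := fun h => by simp [h] at h1
  rw [theta1_eq_poch hp0 hp (pow_ne_zero _ h0)]
  exact mul_ne_zero (poch_self_ne_zero hq) (mul_ne_zero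
    (poch_ne_zero hq (mul_pow_ne_one hq (by simpa [h1] using hp)))
    (poch_ne_zero hq (mul_pow_ne_one hq (by simpa [h1] using hp))))

theorem thetaVandermonde_eq_det_six {p : ℂ} (hp0 : p ≠ 0) (hp : ‖p‖ < 1) {X : Fin 4 → ℂ}
    (hX : ∀ j, X j ≠ 0) :
    4 * thetaVandermonde p X = poch (p ^ 2) (p ^ 2) ^ 8 * (thetaMatrix p 6 X).det := by
  obtain ⟨m, hm⟩ := exists_thetaVandermonde_six hp0 hp
  have hζ := Complex.isPrimitiveRoot_exp 6 (by norm_num)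
  set ζ := Complex.exp (2 * Real.pi * I / (6 : ℕ))
  have hζ0 : ζ ≠ 0 := hζ.ne_zero (by norm_num)
  have h := hm (fun j => ζ ^ (j : ℕ)) fun j => pow_ne_zero _ hζ0
  have hW := root_prod_ne_zero (by norm_num) hζ
  have h1 := thetaVandermonde_six_root hp0 hp hζ
  have hne := fun n => thetaProd_root_ne_zero hp (by norm_num) hζ.pow_eq_one n
  have hK : 2 * (thetaProd p ζ ^ 4 * thetaProd p (ζ ^ 2) ^ 3 * thetaProd p (ζ ^ 3) ^ 3 *
        thetaProd p (ζ ^ 4) * thetaProd p (ζ ^ 5)) ≠ 0 := by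
    have h1 := hne 1
    rw [pow_one] at h1
    simp [hne, h1]
  rw [h1] at hK
  have ha := right_ne_zero_of_mul hK
  rw [thetaVandermonde_root hp0 hp hζ0, det_thetaMatrix_root hζ.pow_eq_one hζ0] at h
  have hm4 : 4 * m = poch (p ^ 2) (p ^ 2) ^ 8 := by
    refine mul_right_cancel₀ (mul_ne_zero ha hW) ?_
    linear_combination (-2) * h + (∏ i : Fin 4, ∏ j ∈ Finset.Ioi i,
      ((ζ ^ (i : ℕ) + (ζ ^ (i : ℕ))⁻¹) - (ζ ^ (j : ℕ) + (ζ ^ (j : ℕ))⁻¹))) * h1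
  rw [hm X hX, ← hm4]; ring

theorem thetaVandermonde_mul_eq_det_seven {p : ℂ} (hp0 : p ≠ 0) (hp : ‖p‖ < 1) {X : Fin 4 → ℂ}
    (hX : ∀ j, X j ≠ 0) :
    2 * (thetaVandermonde p X * ∏ j, theta1 p (X j)) =
      poch (p ^ 2) (p ^ 2) ^ 12 * (thetaMatrix p 7 X).det := by
  obtain ⟨m, hm⟩ := exists_thetaVandermonde_seven hp0 hp
  have hζ := Complex.isPrimitiveRoot_exp 7 (by norm_num)
  set ζ := Complex.exp (2 * Real.pi * I / (7 : ℕ))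
  have hζ0 : ζ ≠ 0 := hζ.ne_zero (by norm_num)
  have h := hm (fun j => ζ ^ (j : ℕ)) fun j => pow_ne_zero _ hζ0
  have hW := root_prod_ne_zero (by norm_num) hζ
  have h1 := thetaVandermonde_seven_root hp0 hp hζ
  have ha : ∏ i, theta1 (p ^ 7) (p ^ (2 * wt i)) ≠ 0 := by
    have hne := fun n => thetaProd_root_ne_zero hp (by norm_num) hζ.pow_eq_one n
    have hne1 := hne 1
    rw [pow_one] at hne1
    have hth := fun n : ℕ => theta1_root_ne_zero hp0 hp (by norm_num) hζ.pow_eq_one n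
    refine right_ne_zero_of_mul (a := poch (p ^ 2) (p ^ 2) ^ 12) ?_
    rw [← h1]
    exact mul_ne_zero (by simp [hne, hne1]) (Finset.prod_ne_zero_iff.2 fun j _ => hth j)
  rw [thetaVandermonde_root hp0 hp hζ0, det_thetaMatrix_root hζ.pow_eq_one hζ0] at h
  have hm4 : 2 * m = poch (p ^ 2) (p ^ 2) ^ 12 := by
    refine mul_right_cancel₀ (mul_ne_zero ha hW) ?_
    linear_combination (-1) * h + (∏ i : Fin 4, ∏ j ∈ Finset.Ioi i,
      ((ζ ^ (i : ℕ) + (ζ ^ (i : ℕ))⁻¹) - (ζ ^ (j : ℕ) + (ζ ^ (j : ℕ))⁻¹))) * h1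
  rw [hm X hX, ← hm4]; ring

theorem det_thetaMatrix_six_mul {p : ℂ} (hp0 : p ≠ 0) (hp : ‖p‖ < 1) {X : Fin 4 → ℂ}
    (hX : ∀ j, X j ≠ 0) :
    (thetaMatrix p 6 X).det * ∏ j, theta1 p (X j) =
      2 * poch (p ^ 2) (p ^ 2) ^ 4 * (thetaMatrix p 7 X).det := by
  have hφ : poch (p ^ 2) (p ^ 2) ^ 8 ≠ 0 :=
    pow_ne_zero _ (poch_self_ne_zero (norm_pow_lt_one hp two_ne_zero))
  refine mul_left_cancel₀ hφ ?_
  linear_combination 2 * thetaVandermonde_mul_eq_det_seven hp0 hp hX -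
    (∏ j, theta1 p (X j)) * thetaVandermonde_eq_det_six hp0 hp hX

/-! ### The affine Weyl group as signed permutations and translations -/

/-- The signed permutation of the coordinates of `F_cl`, extended by the identity. -/
def signedPerm (σ : Equiv.Perm (Fin 4)) (s : Fin 4 → ℤˣ) : FTilde ≃ₗ[ℝ] FTilde where
  toFun u := (fun j => ((s j : ℤ) : ℝ) * u.1 (σ.symm j), u.2)
  invFun u := (fun j => ((s (σ j) : ℤ) : ℝ) * u.1 (σ j), u.2)
  map_add' u v := by ext <;> simp [mul_add]
  map_smul' c u := by ext <;> simp [mul_left_comm]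
  left_inv u := by
    refine Prod.ext (funext fun j => ?_) rfl
    have : ((s (σ j) : ℤ) : ℝ) * ((s (σ j) : ℤ) : ℝ) = 1 := by
      rw [← Int.cast_mul, ← Units.val_mul, Int.units_mul_self]; simp
    simp [← mul_assoc, this]
  right_inv u := by
    refine Prod.ext (funext fun j => ?_) rfl
    have : ((s j : ℤ) : ℝ) * ((s j : ℤ) : ℝ) = 1 := by
      rw [← Int.cast_mul, ← Units.val_mul, Int.units_mul_self]; simp
    simp [← mul_assoc, this]

/-- The translation `t_γ(u) = u + Ĩ(u, δ) γ - (Ĩ(u, γ) + Ĩ(u, δ) Ĩ(γ, γ) / 2) δ`. -/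
def transl (γ : Fin 4 → ℤ) : FTilde ≃ₗ[ℝ] FTilde where
  toFun u := (fun j => u.1 j + u.2.2.2 * γ j,
    u.2.1 - (∑ j, u.1 j * γ j + u.2.2.2 * (∑ j, (γ j : ℝ) ^ 2) / 2), u.2.2.1, u.2.2.2)
  invFun u := (fun j => u.1 j - u.2.2.2 * γ j,
    u.2.1 + (∑ j, u.1 j * γ j - u.2.2.2 * (∑ j, (γ j : ℝ) ^ 2) / 2), u.2.2.1, u.2.2.2)
  map_add' u v := by
    refine Prod.ext (funext fun j => ?_) (Prod.ext ?_ rfl)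
    · simp; ring
    · simp [Fin.sum_univ_four]; ring
  map_smul' c u := by
    refine Prod.ext (funext fun j => ?_) (Prod.ext ?_ rfl)
    · simp; ring
    · simp [Fin.sum_univ_four]; ring
  left_inv u := by
    refine Prod.ext (funext fun j => ?_) (Prod.ext ?_ rfl)
    · simp
    · simp [Fin.sum_univ_four]; ring
  right_inv u := by
    refine Prod.ext (funext fun j => ?_) (Prod.ext ?_ rfl)
    · simp
    · simp [Fin.sum_univ_four]; ring

theorem signedPerm_mul (σ σ' : Equiv.Perm (Fin 4)) (s s' : Fin 4 → ℤˣ) :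
    signedPerm σ s * signedPerm σ' s' = signedPerm (σ * σ') fun j => s j * s' (σ.symm j) := by
  refine LinearEquiv.ext fun u => Prod.ext (funext fun j => ?_) rfl
  simp only [LinearEquiv.mul_apply, signedPerm, LinearEquiv.coe_mk, LinearMap.coe_mk, AddHom.coe_mk,
    Units.val_mul, Int.cast_mul, mul_assoc]
  rfl

theorem transl_mul (γ γ' : Fin 4 → ℤ) : transl γ * transl γ' = transl (γ + γ') := by
  refine LinearEquiv.ext fun u => Prod.ext (funext fun j => ?_) (Prod.ext ?_ rfl)
  · simp [transl]; ring
  · simp [transl, Fin.sum_univ_four]; ring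

theorem transl_zero : transl 0 = 1 := by
  refine LinearEquiv.ext fun u => Prod.ext (funext fun j => ?_) (Prod.ext ?_ rfl) <;> simp [transl]

theorem signedPerm_one : signedPerm 1 1 = 1 := by
  refine LinearEquiv.ext fun u => Prod.ext (funext fun j => ?_) rfl
  simp [signedPerm]
  rfl

/-- The action of signed permutations on `ℤ⁴`. -/
def signedAct (σ : Equiv.Perm (Fin 4)) (s : Fin 4 → ℤˣ) (γ : Fin 4 → ℤ) : Fin 4 → ℤ :=
  fun j => s j * γ (σ.symm j)

theorem signedPerm_mul_transl (σ : Equiv.Perm (Fin 4)) (s : Fin 4 → ℤˣ) (γ : Fin 4 → ℤ) :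
    signedPerm σ s * transl γ = transl (signedAct σ s γ) * signedPerm σ s := by
  have hs : ∀ j, ((s j : ℤ) : ℝ) * ((s j : ℤ) : ℝ) = 1 := fun j => by
    rw [← Int.cast_mul, ← Units.val_mul, Int.units_mul_self]; simp
  refine LinearEquiv.ext fun u => Prod.ext (funext fun j => ?_) (Prod.ext ?_ rfl)
  · simp [transl, signedPerm, signedAct]; ring
  · have h1 : ∑ j, ((s j : ℤ) : ℝ) * u.1 (σ.symm j) * (signedAct σ s γ j : ℝ) =
        ∑ j, u.1 j * γ j := by
      rw [← σ.symm.sum_comp fun j => u.1 j * (γ j : ℝ)]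
      refine Finset.sum_congr rfl fun j _ => ?_
      simp only [signedAct, Int.cast_mul]
      linear_combination u.1 (σ.symm j) * (γ (σ.symm j) : ℝ) * hs j
    have h2 : ∑ j, (signedAct σ s γ j : ℝ) ^ 2 = ∑ j, (γ j : ℝ) ^ 2 := by
      rw [← σ.symm.sum_comp fun j => (γ j : ℝ) ^ 2]
      refine Finset.sum_congr rfl fun j _ => ?_
      simp only [signedAct, Int.cast_mul]
      linear_combination (γ (σ.symm j) : ℝ) ^ 2 * hs j
    change u.2.1 - (∑ j, u.1 j * γ j + u.2.2.2 * (∑ j, (γ j : ℝ) ^ 2) / 2) =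
      u.2.1 - (∑ j, ((s j : ℤ) : ℝ) * u.1 (σ.symm j) * (signedAct σ s γ j : ℝ) +
        u.2.2.2 * (∑ j, (signedAct σ s γ j : ℝ) ^ 2) / 2)
    rw [h1, h2]

/-- The linear parts of the simple reflections: permutations. -/
def genPerm : Fin 5 → Equiv.Perm (Fin 4) :=
  ![Equiv.swap 0 1, Equiv.swap 0 1, Equiv.swap 1 2, Equiv.swap 2 3, Equiv.swap 2 3]

/-- The linear parts of the simple reflections: signs. -/
def genSign : Fin 5 → Fin 4 → ℤˣ :=
  ![![-1, -1, 1, 1], 1, 1, 1, ![1, 1, -1, -1]]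

/-- The translation parts of the simple reflections. -/
def genTransl : Fin 5 → Fin 4 → ℤ := ![![1, 1, 0, 0], 0, 0, 0, 0]

theorem simpleReflection_eq (i : Fin 5) :
    simpleReflection i = transl (genTransl i) * signedPerm (genPerm i) (genSign i) := by
  refine LinearEquiv.ext fun u => ?_
  rw [simpleReflection_apply, coroot_simpleRoot, LinearEquiv.mul_apply]
  fin_cases i
  all_goals
    refine Prod.ext (funext fun j => ?_) (Prod.ext ?_ (Prod.ext ?_ ?_))
    · fin_cases j <;> simp [form, simpleRoot, cl, delta, theta, dotProduct, Fin.sum_univ_four,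
        transl, signedPerm, genTransl, genPerm, genSign, Equiv.swap_apply_def] <;> ring
    all_goals
      simp [form, simpleRoot, cl, delta, theta, dotProduct, Fin.sum_univ_four,
        transl, signedPerm, genTransl, genPerm, genSign, Equiv.swap_apply_def] <;> ring

theorem even_sum_signedAct {γ : Fin 4 → ℤ} (σ : Equiv.Perm (Fin 4)) (s : Fin 4 → ℤˣ)
    (hγ : Even (∑ j, γ j)) : Even (∑ j, signedAct σ s γ j) := by
  have h : Even (∑ j, (signedAct σ s γ j - γ (σ.symm j))) := by
    refine Finset.even_sum _ fun j _ => ?_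
    simp only [signedAct]
    rcases Int.units_eq_one_or (s j) with h | h
    · simp [h]
    · exact ⟨-γ (σ.symm j), by simp [h]; ring⟩
  rw [Finset.sum_sub_distrib, σ.symm.sum_comp γ] at h
  simpa using h.add hγ

theorem affineWeylGroup_form {w : FTilde ≃ₗ[ℝ] FTilde} (hw : w ∈ affineWeylGroup) :
    ∃ σ s γ, (∏ j, s j = 1) ∧ Even (∑ j, γ j) ∧ w = transl γ * signedPerm σ s ∧
      LinearMap.det (w : FTilde →ₗ[ℝ] FTilde) = ((Equiv.Perm.sign σ : ℤ) : ℝ) := by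
  have hstep : ∀ i w, (∃ σ s γ, (∏ j, s j = 1) ∧ Even (∑ j, γ j) ∧ w = transl γ * signedPerm σ s ∧
      LinearMap.det (w : FTilde →ₗ[ℝ] FTilde) = ((Equiv.Perm.sign σ : ℤ) : ℝ)) →
      ∃ σ s γ, (∏ j, s j = 1) ∧ Even (∑ j, γ j) ∧
        simpleReflection i * w = transl γ * signedPerm σ s ∧
      LinearMap.det ((simpleReflection i * w : FTilde ≃ₗ[ℝ] FTilde) : FTilde →ₗ[ℝ] FTilde) =
        ((Equiv.Perm.sign σ : ℤ) : ℝ) := by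
    rintro i _ ⟨σ, s, γ, hs, hγ, rfl, hdet⟩
    refine ⟨genPerm i * σ, fun j => genSign i j * s ((genPerm i).symm j),
      genTransl i + signedAct (genPerm i) (genSign i) γ, ?_, ?_, ?_, ?_⟩
    · rw [Finset.prod_mul_distrib, Equiv.prod_comp (genPerm i).symm s, hs, mul_one]
      fin_cases i <;> rfl
    · simp only [Pi.add_apply, Finset.sum_add_distrib]
      refine Even.add ?_ (even_sum_signedAct _ _ hγ)
      fin_cases i <;> decide
    · rw [simpleReflection_eq, ← transl_mul, ← signedPerm_mul]
      simp only [mul_assoc]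
      rw [← mul_assoc (signedPerm _ _) (transl γ), signedPerm_mul_transl, mul_assoc]
    · have h1 : LinearMap.det ((simpleReflection i * (transl γ * signedPerm σ s) :
          FTilde ≃ₗ[ℝ] FTilde) : FTilde →ₗ[ℝ] FTilde) = LinearMap.det
          (simpleReflection i : FTilde →ₗ[ℝ] FTilde) *
          LinearMap.det ((transl γ * signedPerm σ s : FTilde ≃ₗ[ℝ] FTilde) :
            FTilde →ₗ[ℝ] FTilde) := LinearMap.det_comp _ _
      rw [h1, hdet, det_simpleReflection, Equiv.Perm.sign_mul]
      have : Equiv.Perm.sign (genPerm i) = -1 := by fin_cases i <;> decide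
      rw [this]; simp
  induction hw using Subgroup.closure_induction_left with
  | one =>
    exact ⟨1, 1, 0, by simp, by simp, by rw [transl_zero, signedPerm_one, one_mul],
      by simp⟩
  | mul_left x hx y hy ih =>
    obtain ⟨i, rfl⟩ := hx
    exact hstep i y ih
  | inv_mul_cancel x hx y hy ih =>
    obtain ⟨i, rfl⟩ := hx
    have : (simpleReflection i)⁻¹ = simpleReflection i :=
      Module.reflection_symm _
    rw [this]
    exact hstep i y ih

theorem simpleReflection_mem (i : Fin 5) : simpleReflection i ∈ affineWeylGroup :=
  Subgroup.subset_closure ⟨i, rfl⟩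

theorem signedPerm_one_mem (σ : Equiv.Perm (Fin 4)) : signedPerm σ 1 ∈ affineWeylGroup := by
  have hσ : σ ∈ Submonoid.closure (Set.range fun i : Fin 3 => Equiv.swap i.castSucc i.succ) := by
    rw [Equiv.Perm.mclosure_swap_castSucc_succ]; trivial
  induction hσ using Submonoid.closure_induction with
  | mem x hx =>
    obtain ⟨i, rfl⟩ := hx
    have h : ∀ i : Fin 3, simpleReflection i.succ.castSucc =
        signedPerm (Equiv.swap i.castSucc i.succ) 1 := fun i => by
      rw [simpleReflection_eq]
      fin_cases i <;> exact (congrArg (· * _) transl_zero).trans (one_mul _)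
    exact h i ▸ simpleReflection_mem _
  | one => exact signedPerm_one ▸ one_mem _
  | mul x y _ _ hx hy =>
    have := mul_mem hx hy
    rwa [signedPerm_mul, show (fun j => (1 : Fin 4 → ℤˣ) j * (1 : Fin 4 → ℤˣ) (x.symm j)) = 1 from
      funext fun j => one_mul _] at this

/-- Changing the sign of the last two coordinates. -/
def flipLast : Fin 4 → ℤˣ := ![1, 1, -1, -1]

theorem signedPerm_flipLast_mem (σ : Equiv.Perm (Fin 4)) :
    signedPerm 1 (flipLast ∘ σ.symm) ∈ affineWeylGroup := by
  have h0 : signedPerm 1 flipLast ∈ affineWeylGroup := by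
    have h := mul_mem (simpleReflection_mem 4) (signedPerm_one_mem (Equiv.swap 2 3))
    rw [simpleReflection_eq, show genTransl 4 = 0 from rfl, transl_zero, one_mul,
      signedPerm_mul] at h
    convert h using 2
    · decide
    · exact funext fun j => (mul_one _).symm
  have h := mul_mem (mul_mem (signedPerm_one_mem σ) h0) (signedPerm_one_mem σ⁻¹)
  rw [signedPerm_mul, signedPerm_mul] at h
  convert h using 2
  · simp
  · ext j; simp

theorem exists_flipLast : ∀ s : Fin 4 → ℤˣ, ∏ j, s j = 1 →
    ∃ σ τ : Equiv.Perm (Fin 4), s = flipLast ∘ σ.symm * flipLast ∘ τ.symm := by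
  decide

theorem signedPerm_mem (σ : Equiv.Perm (Fin 4)) {s : Fin 4 → ℤˣ} (hs : ∏ j, s j = 1) :
    signedPerm σ s ∈ affineWeylGroup := by
  obtain ⟨τ₁, τ₂, rfl⟩ := exists_flipLast s hs
  have h := mul_mem (mul_mem (signedPerm_flipLast_mem τ₁) (signedPerm_flipLast_mem τ₂))
    (signedPerm_one_mem σ)
  rw [signedPerm_mul, signedPerm_mul] at h
  convert h using 2
  · rw [one_mul, one_mul]
  · exact funext fun j => (mul_one _).symm

theorem transl_signedAct_mem {γ : Fin 4 → ℤ} (hγ : transl γ ∈ affineWeylGroup)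
    (σ : Equiv.Perm (Fin 4)) {s : Fin 4 → ℤˣ} (hs : ∏ j, s j = 1) :
    transl (signedAct σ s γ) ∈ affineWeylGroup := by
  have h := mul_mem (mul_mem (signedPerm_mem σ hs) hγ) (inv_mem (signedPerm_mem σ hs))
  rwa [signedPerm_mul_transl, mul_inv_cancel_right] at h

theorem transl_theta_mem : transl ![1, 1, 0, 0] ∈ affineWeylGroup := by
  have h := mul_mem (simpleReflection_mem 0)
    (inv_mem (signedPerm_mem (genPerm 0) (s := genSign 0) (by decide)))
  rwa [simpleReflection_eq, mul_inv_cancel_right] at h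

theorem transl_zsmul_mem {γ : Fin 4 → ℤ} (hγ : transl γ ∈ affineWeylGroup) (n : ℤ) :
    transl (n • γ) ∈ affineWeylGroup := by
  have h : ∀ n : ℤ, transl (n • γ) = transl γ ^ n := fun n => by
    induction n with
    | zero => simp [transl_zero]
    | succ n ih => rw [add_smul, one_smul, ← transl_mul, ih, zpow_add_one]
    | pred n ih =>
      rw [zpow_sub_one, ← ih, eq_mul_inv_iff_mul_eq, transl_mul]
      congr 1
      rw [sub_smul, one_smul, sub_add_cancel]
  rw [h]
  exact zpow_mem hγ n

theorem transl_mem {γ : Fin 4 → ℤ} (hγ : Even (∑ j, γ j)) : transl γ ∈ affineWeylGroup := by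
  obtain ⟨d, hd⟩ := hγ
  rw [Fin.sum_univ_four] at hd
  have h1 : transl ![1, -1, 0, 0] ∈ affineWeylGroup := by
    convert transl_signedAct_mem transl_theta_mem 1 (s := ![1, -1, -1, 1]) (by decide) using 2
    decide
  have h2 : transl ![0, 1, -1, 0] ∈ affineWeylGroup := by
    convert transl_signedAct_mem transl_theta_mem (Equiv.swap 0 2) (s := ![1, 1, -1, -1])
      (by decide) using 2
    decide
  have h3 : transl ![0, 0, 1, -1] ∈ affineWeylGroup := by
    convert transl_signedAct_mem transl_theta_mem (Equiv.swap 0 2 * Equiv.swap 1 3)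
      (s := ![1, 1, 1, -1] * ![1, -1, 1, 1]) (by decide) using 2
    decide
  have h4 : transl ![0, 0, 1, 1] ∈ affineWeylGroup := by
    convert transl_signedAct_mem transl_theta_mem (Equiv.swap 0 2 * Equiv.swap 1 3)
      (s := 1) (by decide) using 2
    decide
  have h := mul_mem (mul_mem (transl_zsmul_mem h1 (γ 0)) (transl_zsmul_mem h2 (γ 0 + γ 1)))
    (mul_mem (transl_zsmul_mem h3 (d - γ 3)) (transl_zsmul_mem h4 d))
  rw [transl_mul, transl_mul, transl_mul] at h
  convert h using 2
  ext j
  fin_cases j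
  all_goals
    simp
    try omega

/-- The index set of the affine Weyl group: a permutation, and a sign and a translation in each
coordinate, subject to the two parity conditions of `D₄`. -/
def IsWeylIndex (x : Equiv.Perm (Fin 4) × (Fin 4 → ℤˣ × ℤ)) : Prop :=
  ∏ j, (x.2 j).1 = 1 ∧ Even (∑ j, (x.2 j).2)

/-- The element of the affine Weyl group with a given index. -/
def weylElt (x : {x // IsWeylIndex x}) : affineWeylGroup :=
  ⟨transl (fun j => (x.1.2 j).2) * signedPerm x.1.1 (fun j => (x.1.2 j).1),
    mul_mem (transl_mem x.2.2) (signedPerm_mem _ x.2.1)⟩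

theorem weylElt_apply (x : {x // IsWeylIndex x}) (u : FTilde) : (weylElt x).1 u =
    (fun j => (((x.1.2 j).1 : ℤ) : ℝ) * u.1 (x.1.1.symm j) + u.2.2.2 * ((x.1.2 j).2 : ℝ),
      u.2.1 - (∑ j, (((x.1.2 j).1 : ℤ) : ℝ) * u.1 (x.1.1.symm j) * ((x.1.2 j).2 : ℝ) +
        u.2.2.2 * (∑ j, ((x.1.2 j).2 : ℝ) ^ 2) / 2), u.2.2.1, u.2.2.2) := rfl

theorem signedPerm_transl_injective {σ σ' : Equiv.Perm (Fin 4)} {s s' : Fin 4 → ℤˣ}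
    {γ γ' : Fin 4 → ℤ} (h : transl γ * signedPerm σ s = transl γ' * signedPerm σ' s') :
    σ = σ' ∧ s = s' ∧ γ = γ' := by
  have hγ : γ = γ' := by
    funext j
    have := congrArg (fun w : FTilde ≃ₗ[ℝ] FTilde => (w Lambda0).1 j) h
    simpa [transl, signedPerm, Lambda0] using this
  have hv : ∀ j, (s j : ℤ) * ((σ.symm j : ℕ) + 1 : ℤ) = s' j * ((σ'.symm j : ℕ) + 1 : ℤ) := fun j => by
    have := congrArg (fun w : FTilde ≃ₗ[ℝ] FTilde => (w (cl fun i => ((i : ℕ) : ℝ) + 1)).1 j) h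
    have h2 : ((s j : ℤ) : ℝ) * (((σ.symm j : ℕ) : ℝ) + 1) =
        ((s' j : ℤ) : ℝ) * (((σ'.symm j : ℕ) : ℝ) + 1) := by
      simpa [transl, signedPerm, cl] using this
    exact_mod_cast h2
  have hσs : ∀ j, σ.symm j = σ'.symm j ∧ s j = s' j := fun j => by
    have := hv j
    rcases Int.units_eq_one_or (s j) with h1 | h1 <;> rcases Int.units_eq_one_or (s' j) with h2 | h2
    all_goals
      rw [h1, h2] at this
      simp only [Units.val_one, Units.val_neg, one_mul, neg_mul] at this
      refine ⟨Fin.ext (by omega), ?_⟩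
      first | omega | rw [h1, h2]
  refine ⟨?_, funext fun j => (hσs j).2, hγ⟩
  rw [← Equiv.symm_bijective.injective.eq_iff]
  exact Equiv.ext fun j => (hσs j).1

theorem weylElt_bijective : Function.Bijective weylElt := by
  constructor
  · rintro ⟨⟨σ, y⟩, hx⟩ ⟨⟨σ', y'⟩, hx'⟩ h
    obtain ⟨h1, h2, h3⟩ := signedPerm_transl_injective (congrArg Subtype.val h)
    refine Subtype.ext (Prod.ext h1 (funext fun j => Prod.ext (congrFun h2 j) (congrFun h3 j)))
  · rintro ⟨w, hw⟩
    obtain ⟨σ, s, γ, hs, hγ, rfl, -⟩ := affineWeylGroup_form hw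
    exact ⟨⟨(σ, fun j => (s j, γ j)), hs, hγ⟩, rfl⟩

theorem weylSign_weylElt (x : {x // IsWeylIndex x}) :
    weylSign (weylElt x) = ((Equiv.Perm.sign x.1.1 : ℤ) : ℝ) := by
  obtain ⟨σ, s, γ, hs, hγ, h, hdet⟩ := affineWeylGroup_form (weylElt x).2
  rw [weylSign, hdet, (signedPerm_transl_injective h).1]

/-! ### Alternating sums as determinants -/

theorem hasSum_pi_prod {β : Type*} (n : ℕ) (f : Fin n → β → ℂ) (hf : ∀ j, Summable fun b => ‖f j b‖) :
    Summable (fun y : Fin n → β => ‖∏ j, f j (y j)‖) ∧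
      HasSum (fun y : Fin n → β => ∏ j, f j (y j)) (∏ j, ∑' b, f j b) := by
  induction n with
  | zero =>
    simp only [Finset.univ_eq_empty, Finset.prod_empty]
    exact ⟨(hasSum_fintype _).summable, by simp⟩
  | succ n ih =>
    obtain ⟨h1, h2⟩ := ih (fun j => f j.succ) fun j => hf j.succ
    have h3 := (hf 0).mul_norm h1
    have h4 := (hf 0).of_norm.hasSum.mul h2 h3.of_norm
    let e : β × (Fin n → β) ≃ (Fin (n + 1) → β) := Fin.consEquiv fun _ => β
    have he : ∀ x : β × (Fin n → β), ∏ j, f j (e x j) = f 0 x.1 * ∏ j : Fin n, f j.succ (x.2 j) :=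
      fun x => by rw [Fin.prod_univ_succ]; rfl
    rw [← e.summable_iff, ← e.hasSum_iff, Fin.prod_univ_succ]
    exact ⟨h3.congr fun x => congrArg norm (he x).symm, h4.congr_fun he⟩

/-- The summand `p^{kn² + 2mn} X^{m + kn}` of a theta series, with `m = s r` for a sign `s`. -/
def signedTerm (p : ℂ) (k : ℕ) (r : ℤ) (X : ℂ) (b : ℤˣ × ℤ) : ℂ :=
  p ^ (k * b.2 ^ 2 + 2 * (b.1 * r) * b.2) * X ^ (b.1 * r + k * b.2)

theorem summable_signedTerm {p X : ℂ} (hp0 : p ≠ 0) (hp : ‖p‖ < 1) (hX : X ≠ 0) {k : ℕ} (hk : k ≠ 0)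
    (r : ℤ) : Summable fun b => ‖signedTerm p k r X b‖ := by
  refine (summable_prod_of_nonneg fun _ => norm_nonneg _).2 ⟨fun s => summable_levelTheta hp0 hp hX hk (s * r), (hasSum_fintype _).summable⟩

theorem tsum_units_prod {f : ℤˣ × ℤ → ℂ} (hf : Summable f) :
    ∑' b, f b = ∑' n, f (1, n) + ∑' n, f (-1, n) := by
  rw [hf.tsum_prod, tsum_fintype, show (Finset.univ : Finset ℤˣ) = {1, -1} from rfl,
    Finset.sum_pair (by decide)]

theorem tsum_signedTerm {p X : ℂ} (hp0 : p ≠ 0) (hp : ‖p‖ < 1) (hX : X ≠ 0) {k : ℕ} (hk : k ≠ 0)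
    (r : ℤ) : ∑' b, signedTerm p k r X b = evenTheta p k r X := by
  rw [tsum_units_prod (summable_signedTerm hp0 hp hX hk r).of_norm, evenTheta,
    levelTheta_eq_tsum hp0 hX, levelTheta_eq_tsum hp0 (inv_ne_zero hX)]
  congr 1
  · simp [signedTerm]
  · rw [← (Equiv.neg ℤ).tsum_eq]
    refine tsum_congr fun n => ?_
    rw [inv_zpow']
    simp only [signedTerm, Equiv.neg_apply]
    congr 2 <;> (push_cast; ring)

theorem tsum_sign_mul_signedTerm {p X : ℂ} (hp0 : p ≠ 0) (hp : ‖p‖ < 1) (hX : X ≠ 0) {k : ℕ}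
    (hk : k ≠ 0) (c : ℤ → ℂ) (hc : ∀ n, ‖c n‖ ≤ 1) :
    ∑' b : ℤˣ × ℤ, (((b.1 : ℤ) : ℂ) * c b.2) * signedTerm p k 0 X b = 0 := by
  rw [tsum_units_prod, ← sub_eq_zero.2 (rfl : ∑' n, c n * signedTerm p k 0 X (1, n) = _),
    sub_eq_add_neg, ← tsum_neg]
  · congr 1
    · simp
    · simp [signedTerm]
  · refine Summable.of_norm_bounded (summable_signedTerm hp0 hp hX hk 0) fun b => ?_
    rw [norm_mul, norm_mul]
    have h1 : ‖((b.1 : ℤ) : ℂ)‖ = 1 := by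
      rcases Int.units_eq_one_or b.1 with h | h <;> simp [h]
    rw [h1, one_mul]
    exact mul_le_of_le_one_left (norm_nonneg _) (hc _)

/-- The theta series twisted by `(-1)ⁿ`. -/
def altTheta (p : ℂ) (k : ℕ) (r : ℤ) (X : ℂ) : ℂ :=
  ∑' b : ℤˣ × ℤ, (-1) ^ b.2 * signedTerm p k r X b

theorem altTheta_of_odd {p X : ℂ} (hp0 : p ≠ 0) (hp : ‖p‖ < 1) (hX : X ≠ 0) {k : ℕ} (hk : Odd k)
    (r : ℤ) : altTheta p k r X = evenTheta (-p) k r X := by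
  rw [← tsum_signedTerm (neg_ne_zero.2 hp0) (by rwa [norm_neg]) hX hk.pos.ne', altTheta]
  refine tsum_congr fun b => ?_
  rw [signedTerm, signedTerm, ← mul_assoc]
  congr 1
  obtain ⟨l, rfl⟩ := hk
  rw [neg_eq_neg_one_mul p, mul_zpow]
  congr 1
  have : (((2 * l + 1 : ℕ) : ℤ) * b.2 ^ 2 + 2 * (b.1 * r) * b.2) =
      b.2 * b.2 + 2 * (l * b.2 ^ 2 + b.1 * r * b.2) := by push_cast; ring
  rw [this, zpow_add₀ (by norm_num), zpow_mul _ 2, zpow_mul]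
  rcases Int.even_or_odd b.2 with h | h
  · simp [h.neg_one_zpow]
  · simp [h.neg_one_zpow]

theorem altTheta_six_three (p X : ℂ) : altTheta p 6 3 X = 0 := by
  let e : ℤˣ × ℤ ≃ ℤˣ × ℤ :=
    { toFun := fun b => (-b.1, b.2 + b.1)
      invFun := fun b => (-b.1, b.2 + b.1)
      left_inv := fun b => by ext <;> simp
      right_inv := fun b => by ext <;> simp }
  have h : altTheta p 6 3 X = - altTheta p 6 3 X := by
    conv_lhs => rw [altTheta, ← e.tsum_eq]
    rw [altTheta, ← tsum_neg]
    refine tsum_congr fun b => ?_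
    simp only [e, Equiv.coe_fn_mk, signedTerm, Units.val_neg]
    have h1 : (-1 : ℂ) ^ (b.2 + (b.1 : ℤ)) = - (-1) ^ b.2 := by
      rw [zpow_add₀ (by norm_num)]
      rcases Int.units_eq_one_or b.1 with h | h <;> simp [h]
    rw [h1, neg_mul]
    congr 4
    · ring
    · ring
  exact self_eq_neg.1 h

theorem tsum_perm_prod {p : ℂ} (hp0 : p ≠ 0) (hp : ‖p‖ < 1) {k : ℕ} (hk : k ≠ 0) (l : Fin 4 → ℤ)
    {X : Fin 4 → ℂ} (hX : ∀ j, X j ≠ 0) {c : ℤˣ × ℤ → ℂ} (hc : ∀ b, ‖c b‖ ≤ 1) :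
    HasSum (fun x : Equiv.Perm (Fin 4) × (Fin 4 → ℤˣ × ℤ) => ((Equiv.Perm.sign x.1 : ℤ) : ℂ) *
      ∏ j, (c (x.2 j) * signedTerm p k (l (x.1.symm j)) (X j) (x.2 j)))
      (Matrix.of fun i j => ∑' b, c b * signedTerm p k (l i) (X j) b).det := by
  have hs : ∀ i j, Summable fun b => ‖c b * signedTerm p k (l i) (X j) b‖ := fun i j => by
    refine Summable.of_nonneg_of_le (fun _ => norm_nonneg _) (fun b => ?_)
      (summable_signedTerm hp0 hp (hX j) hk (l i))
    rw [norm_mul]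
    exact mul_le_of_le_one_left (norm_nonneg _) (hc b)
  have h1 := fun σ : Equiv.Perm (Fin 4) =>
    hasSum_pi_prod 4 (fun j b => c b * signedTerm p k (l (σ.symm j)) (X j) b) fun j => hs _ _
  have h2 : Summable fun x : Equiv.Perm (Fin 4) × (Fin 4 → ℤˣ × ℤ) =>
      ((Equiv.Perm.sign x.1 : ℤ) : ℂ) *
      ∏ j, (c (x.2 j) * signedTerm p k (l (x.1.symm j)) (X j) (x.2 j)) := by
    refine Summable.of_norm ((summable_prod_of_nonneg fun _ => norm_nonneg _).2
      ⟨fun σ => ?_, (hasSum_fintype _).summable⟩)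
    simp only [norm_mul]
    simpa only [norm_mul] using (h1 σ).1.mul_left ‖((Equiv.Perm.sign σ : ℤ) : ℂ)‖
  have h3 := h2.hasSum
  rw [h2.tsum_prod, tsum_fintype] at h3
  convert h3 using 1
  rw [Matrix.det_apply', ← Equiv.sum_comp (Equiv.inv (Equiv.Perm (Fin 4)))]
  refine Finset.sum_congr rfl fun σ _ => ?_
  have h4 := (((h1 σ).2.mul_left ((Equiv.Perm.sign σ : ℤ) : ℂ)).tsum_eq).symm
  refine Eq.trans ?_ h4
  simp only [Equiv.inv_apply, Equiv.Perm.sign_inv]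
  rfl

open scoped Classical in
theorem indicator_isWeylIndex (x : Equiv.Perm (Fin 4) × (Fin 4 → ℤˣ × ℤ)) :
    (if IsWeylIndex x then (1 : ℂ) else 0) = 1 / 4 * (1 + ∏ j, (-1) ^ (x.2 j).2 +
      ∏ j, (((x.2 j).1 : ℤ) : ℂ) + ∏ j, ((((x.2 j).1 : ℤ) : ℂ) * (-1) ^ (x.2 j).2)) := by
  have h1 : ∏ j, (-1 : ℂ) ^ (x.2 j).2 = (-1) ^ (∑ j, (x.2 j).2) := by
    simp only [Fin.prod_univ_four, Fin.sum_univ_four,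
      zpow_add₀ (neg_ne_zero.2 (one_ne_zero (α := ℂ)))]
  have h2 : ∏ j, (((x.2 j).1 : ℤ) : ℂ) = (((∏ j, (x.2 j).1 : ℤˣ) : ℤ) : ℂ) := by
    push_cast; rfl
  rw [Finset.prod_mul_distrib, h1, h2]
  by_cases hs : ∏ j, (x.2 j).1 = 1
  · by_cases hg : Even (∑ j, (x.2 j).2)
    · rw [if_pos ⟨hs, hg⟩, hs, hg.neg_one_zpow]; norm_num
    · rw [if_neg fun h => hg h.2, hs, (Int.not_even_iff_odd.1 hg).neg_one_zpow]; norm_num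
  · rw [if_neg fun h => hs h.1, (Int.units_eq_one_or _).resolve_left hs]; norm_num

theorem tsum_weylIndex {p : ℂ} (hp0 : p ≠ 0) (hp : ‖p‖ < 1) {k : ℕ} (hk : k ≠ 0) {l : Fin 4 → ℤ}
    (hl : ∃ i, l i = 0) {X : Fin 4 → ℂ} (hX : ∀ j, X j ≠ 0) :
    ∑' x : {x // IsWeylIndex x}, ((Equiv.Perm.sign x.1.1 : ℤ) : ℂ) *
      ∏ j, signedTerm p k (l (x.1.1.symm j)) (X j) (x.1.2 j) =
    1 / 4 * ((Matrix.of fun i j => evenTheta p k (l i) (X j)).det +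
      (Matrix.of fun i j => altTheta p k (l i) (X j)).det) := by
  classical
  obtain ⟨i₀, hi₀⟩ := hl
  have hu : ∀ s : ℤˣ, ‖((s : ℤ) : ℂ)‖ ≤ 1 := fun s => by
    rcases Int.units_eq_one_or s with h | h <;> simp [h]
  have hz : ∀ n : ℤ, ‖(-1 : ℂ) ^ n‖ ≤ 1 := fun n => by simp
  have H1 := tsum_perm_prod hp0 hp hk l hX (c := fun _ => 1) fun _ => by simp
  have H2 := tsum_perm_prod hp0 hp hk l hX (c := fun b => (-1) ^ b.2) fun b => hz _
  have H3 := tsum_perm_prod hp0 hp hk l hX (c := fun b => ((b.1 : ℤ) : ℂ) * 1) fun b => by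
    simpa using hu b.1
  have H4 := tsum_perm_prod hp0 hp hk l hX (c := fun b => ((b.1 : ℤ) : ℂ) * (-1) ^ b.2) fun b => by
    simpa using hu b.1
  rw [Matrix.det_eq_zero_of_row_eq_zero i₀ fun j => by
    rw [Matrix.of_apply, hi₀]
    exact tsum_sign_mul_signedTerm hp0 hp (hX j) hk (fun _ => 1) fun _ => by simp] at H3
  rw [Matrix.det_eq_zero_of_row_eq_zero i₀ fun j => by
    rw [Matrix.of_apply, hi₀]
    exact tsum_sign_mul_signedTerm hp0 hp (hX j) hk (fun n => (-1) ^ n) hz] at H4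
  have H := (((H1.add H2).add H3).add H4).mul_left (1 / 4)
  refine (tsum_subtype {x | IsWeylIndex x} fun x : Equiv.Perm (Fin 4) × (Fin 4 → ℤˣ × ℤ) =>
    ((Equiv.Perm.sign x.1 : ℤ) : ℂ) *
      ∏ j, signedTerm p k (l (x.1.symm j)) (X j) (x.2 j)).trans ?_
  have h0 : ∀ x : Equiv.Perm (Fin 4) × (Fin 4 → ℤˣ × ℤ), Set.indicator {x | IsWeylIndex x}
      (fun x => ((Equiv.Perm.sign x.1 : ℤ) : ℂ) *
        ∏ j, signedTerm p k (l (x.1.symm j)) (X j) (x.2 j)) x =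
      (if IsWeylIndex x then (1 : ℂ) else 0) * (((Equiv.Perm.sign x.1 : ℤ) : ℂ) *
        ∏ j, signedTerm p k (l (x.1.symm j)) (X j) (x.2 j)) := fun x => by
    simp [Set.indicator_apply]
  rw [tsum_congr h0]
  rw [add_zero, add_zero] at H
  simp only [one_mul, tsum_signedTerm hp0 hp (hX _) hk] at H
  refine (H.congr_fun fun x => ?_).tsum_eq
  rw [indicator_isWeylIndex]
  simp only [Finset.prod_mul_distrib, mul_one]
  ring

/-- The nome `p = e^{-δ/2}` at a point of the dual space. -/
def nome (x : DualC) : ℂ := Complex.exp (-(x delta) / 2)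

/-- The coordinates `Xⱼ = e^{eⱼ}` at a point of the dual space. -/
def coord (x : DualC) (j : Fin 4) : ℂ := Complex.exp (x (cl (Pi.single j 1)))

theorem dual_apply (x : DualC) (u : FTilde) : x u = ∑ j, (u.1 j : ℂ) * x (cl (Pi.single j 1)) +
    u.2.1 * x delta + u.2.2.1 * x a + u.2.2.2 * x Lambda0 := by
  have hu : u = (∑ j, u.1 j • cl (Pi.single j 1)) + u.2.1 • delta + u.2.2.1 • a +
      u.2.2.2 • Lambda0 := by
    refine Prod.ext (funext fun j => ?_) (Prod.ext ?_ (Prod.ext ?_ ?_))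
    · fin_cases j <;> simp [Fin.sum_univ_four, cl, delta, a, Lambda0]
    all_goals simp [Fin.sum_univ_four, cl, delta, a, Lambda0]
  conv_lhs => rw [hu]
  simp only [map_add, map_sum, map_smul, Complex.real_smul]

theorem nome_ne_zero (x : DualC) : nome x ≠ 0 := Complex.exp_ne_zero _

theorem coord_ne_zero (x : DualC) (j : Fin 4) : coord x j ≠ 0 := Complex.exp_ne_zero _

theorem norm_nome_lt_one {x : DualC} (hx : 0 < (x delta).re) : ‖nome x‖ < 1 := by
  rw [nome, Complex.norm_exp, Real.exp_lt_one_iff]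
  simp
  linarith

theorem alternant_eq {x : DualC} (hx : 0 < (x delta).re) {k : ℕ} (hk : k ≠ 0) {l : Fin 4 → ℤ}
    (hl : ∃ i, l i = 0) : alternant (fun j => (l j : ℝ), 0, 0, k) x =
    Complex.exp (k * x Lambda0) * (1 / 4 *
      ((Matrix.of fun i j => evenTheta (nome x) k (l i) (coord x j)).det +
      (Matrix.of fun i j => altTheta (nome x) k (l i) (coord x j)).det)) := by
  rw [← tsum_weylIndex (nome_ne_zero x) (norm_nome_lt_one hx) hk hl (coord_ne_zero x), alternant,
    ← (Equiv.ofBijective weylElt weylElt_bijective).tsum_eq, ← tsum_mul_left]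
  refine tsum_congr fun y => ?_
  rw [Equiv.ofBijective_apply, weylSign_weylElt, weylElt_apply, mul_left_comm, Complex.ofReal_intCast]
  congr 1
  rw [dual_apply]
  simp only [signedTerm, nome, coord, ← Complex.exp_int_mul, ← Complex.exp_add]
  rw [Fin.prod_univ_four, ← Complex.exp_add, ← Complex.exp_add, ← Complex.exp_add,
    ← Complex.exp_add]
  congr 1
  simp only [Fin.sum_univ_four]
  push_cast
  ring

/-! ### The characters of level one as theta quotients -/

theorem rho_eq : rho = (fun j => (wt j : ℝ), 0, 0, ((6 : ℕ) : ℝ)) := by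
  refine Prod.ext (funext fun j => ?_) (Prod.ext ?_ (Prod.ext ?_ ?_))
  · fin_cases j <;> simp [rho, Fin.sum_univ_five, fundWeight, colabel, omega, cl, Lambda0, wt] <;>
      norm_num
  all_goals
    simp [rho, Fin.sum_univ_five, fundWeight, colabel, omega, cl, Lambda0]
  norm_num

theorem rho_add_fundWeight_zero : rho + fundWeight 0 =
    (fun j => (wt j : ℝ), 0, 0, ((7 : ℕ) : ℝ)) := by
  rw [rho_eq]
  refine Prod.ext (funext fun j => ?_) (Prod.ext ?_ (Prod.ext ?_ ?_))
  all_goals simp [fundWeight, colabel, omega, Lambda0]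
  norm_num

theorem rho_add_fundWeight_one :
    rho + fundWeight 1 = (fun j => ((![4, 2, 1, 0] : Fin 4 → ℤ) j : ℝ), 0, 0, ((7 : ℕ) : ℝ)) := by
  rw [rho_eq]
  refine Prod.ext (funext fun j => ?_) (Prod.ext ?_ (Prod.ext ?_ ?_))
  · change (wt j : ℝ) + (fundWeight 1).1 j = _
    fin_cases j <;> (simp [fundWeight, colabel, omega, cl, Lambda0, wt]; try norm_num)
  all_goals simp [fundWeight, colabel, omega, cl, Lambda0]
  norm_num

theorem modularExponent_fundWeight_zero : modularExponent (fundWeight 0) = -1 / 6 := by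
  rw [modularExponent, add_comm, rho_add_fundWeight_zero, rho_eq]
  simp [form, wt, delta, dotProduct, Fin.sum_univ_four]
  norm_num

theorem modularExponent_fundWeight_one : modularExponent (fundWeight 1) = 1 / 3 := by
  rw [modularExponent, add_comm, rho_add_fundWeight_one, rho_eq]
  simp [form, wt, delta, dotProduct, Fin.sum_univ_four]
  norm_num

theorem evenTheta_neg_six (p : ℂ) (r : ℤ) (X : ℂ) : evenTheta (-p) 6 r X = evenTheta p 6 r X := by
  simp only [evenTheta, levelTheta, zpow_mul]
  norm_num

theorem thetaMatrix_neg_six (p : ℂ) (X : Fin 4 → ℂ) : thetaMatrix (-p) 6 X = thetaMatrix p 6 X := by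
  simp only [thetaMatrix, evenTheta_neg_six]

theorem evenTheta_seven_four {p X : ℂ} (hp : p ≠ 0) (hX : X ≠ 0) :
    evenTheta p 7 4 X = p⁻¹ * evenTheta p 7 3 X := by
  have h1 := levelTheta_sub hp hX 7 3
  have h2 := levelTheta_sub hp (inv_ne_zero hX) 7 3
  norm_num at h1 h2
  rw [evenTheta, evenTheta, h1, h2]
  ring

theorem det_evenTheta_seven_four {p : ℂ} {X : Fin 4 → ℂ} (hp : p ≠ 0) (hX : ∀ j, X j ≠ 0) :
    (Matrix.of fun i j => evenTheta p 7 ((![4, 2, 1, 0] : Fin 4 → ℤ) i) (X j)).det =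
      p⁻¹ * (thetaMatrix p 7 X).det := by
  have h := Matrix.det_mul_column ![p⁻¹, 1, 1, 1] (thetaMatrix p 7 X)
  rw [Fin.prod_univ_four] at h
  simp only [Matrix.cons_val, mul_one] at h
  rw [← h]
  congr 1
  ext i j
  fin_cases i <;> simp [thetaMatrix, wt, evenTheta_seven_four hp (hX j)]

theorem alternant_rho {x : DualC} (hx : 0 < (x delta).re) : alternant rho x =
    Complex.exp (6 * x Lambda0) * (1 / 4 * (thetaMatrix (nome x) 6 (coord x)).det) := by
  have h0 : (Matrix.of fun i j => altTheta (nome x) 6 (wt i) (coord x j)).det = 0 :=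
    Matrix.det_eq_zero_of_row_eq_zero 0 fun j => altTheta_six_three _ _
  rw [rho_eq, alternant_eq hx (by norm_num) ⟨3, rfl⟩, h0, add_zero]
  simp only [thetaMatrix, Nat.cast_ofNat]

theorem alternant_rho_add_zero {x : DualC} (hx : 0 < (x delta).re) :
    alternant (rho + fundWeight 0) x = Complex.exp (7 * x Lambda0) * (1 / 4 *
      ((thetaMatrix (nome x) 7 (coord x)).det + (thetaMatrix (-nome x) 7 (coord x)).det)) := by
  rw [rho_add_fundWeight_zero, alternant_eq hx (by norm_num) ⟨3, rfl⟩]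
  simp only [thetaMatrix, Nat.cast_ofNat, altTheta_of_odd (nome_ne_zero x) (norm_nome_lt_one hx)
    (coord_ne_zero x _) (k := 7) (by decide)]

theorem alternant_rho_add_one {x : DualC} (hx : 0 < (x delta).re) :
    alternant (rho + fundWeight 1) x = Complex.exp (7 * x Lambda0) * (1 / 4 * ((nome x)⁻¹ *
      ((thetaMatrix (nome x) 7 (coord x)).det - (thetaMatrix (-nome x) 7 (coord x)).det))) := by
  rw [rho_add_fundWeight_one, alternant_eq hx (by norm_num) ⟨3, rfl⟩]
  simp only [Nat.cast_ofNat, altTheta_of_odd (nome_ne_zero x) (norm_nome_lt_one hx)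
    (coord_ne_zero x _) (k := 7) (by decide)]
  rw [det_evenTheta_seven_four (nome_ne_zero x) (coord_ne_zero x),
    det_evenTheta_seven_four (neg_ne_zero.2 (nome_ne_zero x)) (coord_ne_zero x), inv_neg]
  ring

theorem alternant_zero_mul {x : DualC} (hx : 0 < (x delta).re) :
    alternant (rho + fundWeight 0) x * (2 * poch (nome x ^ 2) (nome x ^ 2) ^ 4) =
      Complex.exp (x Lambda0) * (∏ j, theta1 (nome x) (coord x j) +
        ∏ j, theta1 (-nome x) (coord x j)) * alternant rho x := by
  have h1 := det_thetaMatrix_six_mul (nome_ne_zero x) (norm_nome_lt_one hx) (coord_ne_zero x)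
  have h2 := det_thetaMatrix_six_mul (neg_ne_zero.2 (nome_ne_zero x))
    (by simpa using norm_nome_lt_one hx) (coord_ne_zero x)
  rw [thetaMatrix_neg_six, neg_sq] at h2
  rw [alternant_rho_add_zero hx, alternant_rho hx, show 7 * x Lambda0 = x Lambda0 + 6 * x Lambda0 by
    ring, Complex.exp_add]
  linear_combination -(Complex.exp (x Lambda0) * Complex.exp (6 * x Lambda0) / 4) * (h1 + h2)

theorem alternant_one_mul {x : DualC} (hx : 0 < (x delta).re) :
    alternant (rho + fundWeight 1) x * (2 * poch (nome x ^ 2) (nome x ^ 2) ^ 4) =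
      Complex.exp (x Lambda0) * (nome x)⁻¹ * (∏ j, theta1 (nome x) (coord x j) -
        ∏ j, theta1 (-nome x) (coord x j)) * alternant rho x := by
  have h1 := det_thetaMatrix_six_mul (nome_ne_zero x) (norm_nome_lt_one hx) (coord_ne_zero x)
  have h2 := det_thetaMatrix_six_mul (neg_ne_zero.2 (nome_ne_zero x))
    (by simpa using norm_nome_lt_one hx) (coord_ne_zero x)
  rw [thetaMatrix_neg_six, neg_sq] at h2
  rw [alternant_rho_add_one hx, alternant_rho hx, show 7 * x Lambda0 = x Lambda0 + 6 * x Lambda0 by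
    ring, Complex.exp_add]
  linear_combination -(Complex.exp (x Lambda0) * Complex.exp (6 * x Lambda0) / 4 * (nome x)⁻¹) *
    (h1 - h2)

theorem theta1_exp (z τ : ℂ) :
    theta1 (Complex.exp (Real.pi * I * τ)) (Complex.exp (2 * Real.pi * I * z)) =
      jacobiTheta₂ z τ := by
  refine tsum_congr fun n => ?_
  rw [jacobiTheta₂_term, ← Complex.exp_int_mul, ← Complex.exp_int_mul, ← Complex.exp_add]
  congr 1
  push_cast
  ring

theorem theta1_neg_left (p X : ℂ) : theta1 (-p) X = theta1 p (-X) := by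
  refine tsum_congr fun n => ?_
  rw [neg_eq_neg_one_mul p, neg_eq_neg_one_mul X, mul_zpow, mul_zpow, sq, zpow_mul]
  rcases Int.even_or_odd n with h | h <;> simp [h.neg_one_zpow]

theorem theta1_neg_exp (z τ : ℂ) :
    theta1 (-Complex.exp (Real.pi * I * τ)) (Complex.exp (2 * Real.pi * I * z)) =
      jacobiTheta₂ (z + 1 / 2) τ := by
  rw [theta1_neg_left, ← theta1_exp, mul_add, Complex.exp_add,
    show 2 * Real.pi * I * (1 / 2 : ℂ) = Real.pi * I by ring, Complex.exp_pi_mul_I, mul_neg_one]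

theorem theta1_nome_coord (x : DualC) (j : Fin 4) : theta1 (nome x) (coord x j) =
    jacobiTheta₂ (x (cl (Pi.single j 1)) / (2 * Real.pi * I)) (-(x delta) / (2 * Real.pi * I)) := by
  have := Complex.two_pi_I_ne_zero
  rw [← theta1_exp, nome, coord]
  congr 2 <;> field_simp

theorem theta1_neg_nome_coord (x : DualC) (j : Fin 4) : theta1 (-nome x) (coord x j) =
    jacobiTheta₂ (x (cl (Pi.single j 1)) / (2 * Real.pi * I) + 1 / 2)
      (-(x delta) / (2 * Real.pi * I)) := by
  have := Complex.two_pi_I_ne_zero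
  rw [← theta1_neg_exp, nome, coord]
  congr 2
  · congr 1; field_simp
  · field_simp

theorem im_modulus_pos {x : DualC} (hx : 0 < (x delta).re) :
    0 < (-(x delta) / (2 * Real.pi * I)).im := by
  have : -(x delta) / (2 * Real.pi * I) = ((2 * Real.pi)⁻¹ : ℝ) * (x delta * I) := by
    have := Complex.two_pi_I_ne_zero
    have : (Real.pi : ℂ) ≠ 0 := by exact_mod_cast Real.pi_ne_zero
    push_cast
    field_simp
    simp
  rw [this, Complex.im_ofReal_mul]
  simp
  positivity

theorem continuous_eval (u : FTilde) : Continuous fun x : DualC => x u := by fun_prop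

theorem continuousAt_theta1_nome {x : DualC} (hx : 0 < (x delta).re) (j : Fin 4) :
    ContinuousAt (fun y : DualC => theta1 (nome y) (coord y j)) x := by
  simp only [theta1_nome_coord]
  refine ContinuousAt.comp (f := fun y : DualC => (y (cl (Pi.single j 1)) / (2 * Real.pi * I),
    -(y delta) / (2 * Real.pi * I))) (g := fun w : ℂ × ℂ => jacobiTheta₂ w.1 w.2)
    (continuousAt_jacobiTheta₂ _ (im_modulus_pos hx)) ?_
  fun_prop

theorem continuousAt_theta1_neg_nome {x : DualC} (hx : 0 < (x delta).re) (j : Fin 4) :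
    ContinuousAt (fun y : DualC => theta1 (-nome y) (coord y j)) x := by
  simp only [theta1_neg_nome_coord]
  refine ContinuousAt.comp (f := fun y : DualC => (y (cl (Pi.single j 1)) / (2 * Real.pi * I) + 1 / 2,
    -(y delta) / (2 * Real.pi * I))) (g := fun w : ℂ × ℂ => jacobiTheta₂ w.1 w.2)
    (continuousAt_jacobiTheta₂ _ (im_modulus_pos hx)) ?_
  fun_prop

theorem continuous_nome : Continuous nome := by
  unfold nome
  fun_prop

theorem poch_self (q : ℂ) : poch q q = ∏' n : ℕ, (1 - q ^ (n + 1)) := by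
  simp only [poch, pow_succ']

theorem continuousAt_poch_nome {x : DualC} (hx : 0 < (x delta).re) :
    ContinuousAt (fun y : DualC => poch (nome y ^ 2) (nome y ^ 2)) x := by
  have hq : nome x ^ 2 ∈ Metric.ball (0 : ℂ) 1 := by
    simpa using norm_pow_lt_one (norm_nome_lt_one hx) two_ne_zero
  have h := (ModularForm.differentiableOn_tprod_one_sub_pow.continuousOn).continuousAt
    (Metric.isOpen_ball.mem_nhds hq)
  simp only [poch_self]
  exact ContinuousAt.comp (g := fun q : ℂ => ∏' n : ℕ, (1 - q ^ (n + 1)))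
    (f := fun y : DualC => nome y ^ 2) h (continuous_nome.pow 2).continuousAt

/-- The element `ρ` of the classical part, as a direction in the dual space. -/
def rhoDirection : DualC :=
  LinearMap.toContinuousLinearMap
    { toFun := fun u => ((∑ j, (wt j : ℝ) * u.1 j : ℝ) : ℂ)
      map_add' := by intro u v; simp [mul_add, Finset.sum_add_distrib]
      map_smul' := by intro c u; simp [Finset.mul_sum, mul_left_comm] }

theorem rhoDirection_apply (u : FTilde) :
    rhoDirection u = ((∑ j, (wt j : ℝ) * u.1 j : ℝ) : ℂ) := rfl

theorem eventually_thetaVandermonde_ne_zero {p : ℂ} (hp0 : p ≠ 0) (hp : ‖p‖ < 1) :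
    ∀ᶠ ε : ℝ in 𝓝[>] 0, thetaVandermonde p (fun j => Complex.exp (ε * wt j)) ≠ 0 := by
  have key : ∀ m : ℤ, ∀ᶠ ε : ℝ in 𝓝[>] 0, thetaProd p (Complex.exp (ε * m)) ≠ 0 := by
    intro m
    have h : ∀ m : ℤ, ∀ᶠ ε : ℝ in 𝓝[>] 0, ‖p ^ 2 * Complex.exp (ε * m)‖ < 1 := by
      intro m
      have hc : Continuous fun ε : ℝ => ‖p ^ 2 * Complex.exp (ε * m)‖ := by fun_prop
      refine ((hc.tendsto 0).mono_left nhdsWithin_le_nhds).eventually_lt_const ?_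
      simpa using norm_pow_lt_one hp two_ne_zero
    filter_upwards [h m, h (-m)] with ε h1 h2
    refine thetaProd_ne_zero_of_norm hp h1 ?_
    rw [← Complex.exp_neg]
    simpa using h2
  have key2 : ∀ i j : Fin 4, i < j → ∀ᶠ ε : ℝ in 𝓝[>] 0,
      levelTheta p 2 0 (Complex.exp (ε * wt j)) * levelTheta p 2 1 (Complex.exp (ε * wt i)) -
      levelTheta p 2 0 (Complex.exp (ε * wt i)) * levelTheta p 2 1 (Complex.exp (ε * wt j)) ≠ 0 := by
    intro i j hij
    filter_upwards [key (wt j + wt i), key (wt j - wt i), self_mem_nhdsWithin] with ε h1 h2 h3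
    have h3 : (0 : ℝ) < ε := h3
    rw [levelTheta_two_addition' hp0 hp (Complex.exp_ne_zero _) (Complex.exp_ne_zero _)]
    refine mul_ne_zero ?_ (mul_ne_zero ?_ ?_)
    · rw [← Complex.exp_neg, ← Complex.exp_neg]
      have hw : (wt j : ℝ) < wt i ∧ (0 : ℝ) ≤ wt j := by
        fin_cases i <;> fin_cases j <;> (simp [wt] at hij ⊢; try norm_num)
      have : Real.cosh (ε * wt j) < Real.cosh (ε * wt i) := by
        rw [Real.cosh_lt_cosh, abs_of_nonneg, abs_of_nonneg]
        · exact mul_lt_mul_of_pos_left hw.1 h3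
        · exact mul_nonneg h3.le (hw.2.trans hw.1.le)
        · exact mul_nonneg h3.le hw.2
      rw [Real.cosh_eq, Real.cosh_eq] at this
      have h4 : Real.exp (ε * wt i) + Real.exp (-(ε * wt i)) -
        (Real.exp (ε * wt j) + Real.exp (-(ε * wt j))) ≠ 0 := by
        intro h; linarith
      exact_mod_cast h4
    · rw [← Complex.exp_add]
      convert h1 using 3
      push_cast; ring
    · rw [← Complex.exp_neg, ← Complex.exp_add]
      convert h2 using 3
      push_cast; ring
  have key3 : ∀ᶠ ε : ℝ in 𝓝[>] 0, ∀ i j : Fin 4, i < j →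
      levelTheta p 2 0 (Complex.exp (ε * wt j)) * levelTheta p 2 1 (Complex.exp (ε * wt i)) -
      levelTheta p 2 0 (Complex.exp (ε * wt i)) * levelTheta p 2 1 (Complex.exp (ε * wt j)) ≠ 0 := by
    simp only [eventually_all]
    exact key2
  filter_upwards [key3] with ε h
  rw [thetaVandermonde]
  exact Finset.prod_ne_zero_iff.2 fun i _ => Finset.prod_ne_zero_iff.2 fun j hj =>
    h i j (Finset.mem_Ioi.1 hj)

theorem neBot_regular (τ : UpperHalfPlane) :
    (𝓝[{y | y ∈ Y ∧ alternant rho y ≠ 0}] (point τ 0 0)).NeBot := by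
  set x := point τ 0 0 with hxd
  have hxY : x ∈ Y := point_mem_Y τ 0 0
  have hd : ∀ ε : ℝ, (x + ε • rhoDirection) delta = x delta := by
    intro ε
    simp [rhoDirection_apply, delta]
  have hc : ∀ ε : ℝ, coord (x + ε • rhoDirection) = fun j => Complex.exp (ε * wt j) := by
    intro ε
    funext j
    have h0 : x (cl (Pi.single j 1)) = 0 := by simp [hxd, point, cl]
    rw [coord, add_apply, h0, zero_add, smul_apply,
      rhoDirection_apply]
    simp [cl, Pi.single_apply]
  have ht : Tendsto (fun ε : ℝ => x + ε • rhoDirection) (𝓝[>] 0)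
      (𝓝[{y | y ∈ Y ∧ alternant rho y ≠ 0}] x) := by
    refine tendsto_nhdsWithin_iff.2 ⟨?_, ?_⟩
    · have : Continuous fun ε : ℝ => x + ε • rhoDirection := by fun_prop
      have h0 := this.tendsto 0
      have h1 : x + (0 : ℝ) • rhoDirection = x := ContinuousLinearMap.ext fun u => by simp
      rw [h1] at h0
      exact h0.mono_left nhdsWithin_le_nhds
    · have hp := norm_nome_lt_one hxY.2
      filter_upwards [eventually_thetaVandermonde_ne_zero (nome_ne_zero x) hp] with ε hε
      have hn : nome (x + ε • rhoDirection) = nome x := by rw [nome, hd, nome]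
      refine ⟨⟨?_, ?_⟩, ?_⟩
      · have : (x + ε • rhoDirection) a = x a := by simp [rhoDirection_apply, a]
        rw [this, hxY.1]
      · rw [hd]; exact hxY.2
      · rw [alternant_rho (by rw [hd]; exact hxY.2), hn, hc]
        refine mul_ne_zero (Complex.exp_ne_zero _) (mul_ne_zero (by norm_num) fun h => hε ?_)
        have := thetaVandermonde_eq_det_six (nome_ne_zero x) hp
          (X := fun j => Complex.exp (ε * wt j)) fun j => Complex.exp_ne_zero _
        rw [h, mul_zero] at this
        simpa using this
  exact ht.neBot

theorem ch_eq_of_mul_eq {lam : FTilde} {τ : UpperHalfPlane} {N M : DualC → ℂ}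
    (h : ∀ x : DualC, 0 < (x delta).re → alternant (rho + lam) x * M x = N x * alternant rho x)
    (hN : ContinuousAt N (point τ 0 0)) (hM : ContinuousAt M (point τ 0 0))
    (hM0 : M (point τ 0 0) ≠ 0) :
    ch lam (point τ 0 0) = N (point τ 0 0) / M (point τ 0 0) := by
  have := neBot_regular τ
  refine Tendsto.limUnder_eq ?_
  refine (((hN.div hM hM0).tendsto).mono_left nhdsWithin_le_nhds).congr' ?_
  filter_upwards [self_mem_nhdsWithin, mem_nhdsWithin_of_mem_nhds (hM.eventually_ne hM0)]
    with y hy hMy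
  rw [Pi.div_apply, div_eq_div_iff hMy hy.2, h y hy.1.2]

theorem point_delta (τ : UpperHalfPlane) : point τ 0 0 delta = -(2 * Real.pi * I * τ) := by
  simp [point, delta]

theorem nome_point (τ : UpperHalfPlane) : nome (point τ 0 0) = Complex.exp (Real.pi * I * τ) := by
  rw [nome, point_delta]
  congr 1
  ring

theorem coord_point (τ : UpperHalfPlane) (j : Fin 4) : coord (point τ 0 0) j = 1 := by
  simp [coord, point, cl]

theorem point_Lambda0 (τ : UpperHalfPlane) : point τ 0 0 Lambda0 = 0 := by
  simp [point, Lambda0]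

theorem prod_theta1_point (τ : UpperHalfPlane) :
    ∏ j, theta1 (nome (point τ 0 0)) (coord (point τ 0 0) j) = jacobiTheta₂ 0 τ ^ 4 := by
  simp only [coord_point, nome_point]
  rw [← theta1_exp]
  simp

theorem prod_theta1_neg_point (τ : UpperHalfPlane) :
    ∏ j, theta1 (-nome (point τ 0 0)) (coord (point τ 0 0) j) = jacobiTheta₂ (1 / 2) τ ^ 4 := by
  simp only [coord_point, nome_point]
  rw [← zero_add (1 / 2 : ℂ), ← theta1_neg_exp]
  simp

theorem poch_nome_point (τ : UpperHalfPlane) :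
    poch (nome (point τ 0 0) ^ 2) (nome (point τ 0 0) ^ 2) ≠ 0 :=
  poch_self_ne_zero (norm_pow_lt_one (norm_nome_lt_one (point_mem_Y τ 0 0).2) two_ne_zero)

theorem eta_pow_four (τ : UpperHalfPlane) : eta τ ^ 4 =
    Complex.exp (Real.pi * I * τ / 3) *
      poch (nome (point τ 0 0) ^ 2) (nome (point τ 0 0) ^ 2) ^ 4 := by
  rw [eta, ModularForm.eta, mul_pow, poch_self]
  congr 1
  · rw [Function.Periodic.qParam, ← Complex.exp_nat_mul]
    congr 1
    push_cast
    ring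
  · congr 2
    funext n
    rw [ModularForm.eta_q_eq_pow, nome_point, ← Complex.exp_nat_mul _ 2]
    congr 3
    push_cast
    ring

theorem etaChi_zero (τ : UpperHalfPlane) :
    etaChi 0 τ = (jacobiTheta₂ 0 τ ^ 4 + jacobiTheta₂ (1 / 2) τ ^ 4) / 2 := by
  have hx := (point_mem_Y τ 0 0).2
  have hφ := poch_nome_point τ
  have h := ch_eq_of_mul_eq (τ := τ) (fun x hx => alternant_zero_mul hx)
    (((continuous_eval Lambda0).cexp.continuousAt).mul
      ((tendsto_finsetProd _ fun j _ => continuousAt_theta1_nome hx j).add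
        (tendsto_finsetProd _ fun j _ => continuousAt_theta1_neg_nome hx j)))
    (continuousAt_const.mul ((continuousAt_poch_nome hx).pow 4))
    (mul_ne_zero two_ne_zero (pow_ne_zero _ hφ))
  rw [etaChi, chiNat, chi, h, prod_theta1_point, prod_theta1_neg_point, point_Lambda0, eta_pow_four,
    modularExponent_fundWeight_zero, point_delta]
  have he : Complex.exp (Real.pi * I * τ / 3) *
      Complex.exp (-((-1 / 6 : ℝ) : ℂ) * -(2 * Real.pi * I * τ)) = 1 := by
    rw [← Complex.exp_add, Complex.exp_eq_one_iff]
    exact ⟨0, by push_cast; ring⟩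
  rw [Complex.exp_zero]
  generalize Complex.exp (-_ * _) = E at he ⊢
  generalize Complex.exp (Real.pi * I * τ / 3) = E' at he ⊢
  field_simp
  linear_combination (jacobiTheta₂ 0 τ ^ 4 + jacobiTheta₂ (1 / 2) τ ^ 4) * he

theorem etaChi_one (τ : UpperHalfPlane) :
    etaChi 1 τ = (jacobiTheta₂ 0 τ ^ 4 - jacobiTheta₂ (1 / 2) τ ^ 4) / 2 := by
  have hx := (point_mem_Y τ 0 0).2
  have hφ := poch_nome_point τ
  have h := ch_eq_of_mul_eq (τ := τ) (fun x hx => alternant_one_mul hx)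
    ((((continuous_eval Lambda0).cexp.continuousAt).mul
      (continuous_nome.continuousAt.inv₀ (nome_ne_zero _))).mul
      ((tendsto_finsetProd _ fun j _ => continuousAt_theta1_nome hx j).sub
        (tendsto_finsetProd _ fun j _ => continuousAt_theta1_neg_nome hx j)))
    (continuousAt_const.mul ((continuousAt_poch_nome hx).pow 4))
    (mul_ne_zero two_ne_zero (pow_ne_zero _ hφ))
  rw [etaChi, chiNat, chi, h, prod_theta1_point, prod_theta1_neg_point, point_Lambda0, eta_pow_four,
    modularExponent_fundWeight_one, point_delta]
  have he : Complex.exp (Real.pi * I * τ / 3) *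
      Complex.exp (-((1 / 3 : ℝ) : ℂ) * -(2 * Real.pi * I * τ)) * (nome (point τ 0 0))⁻¹ = 1 := by
    rw [nome_point, ← Complex.exp_neg, ← Complex.exp_add, ← Complex.exp_add, Complex.exp_eq_one_iff]
    exact ⟨0, by push_cast; ring⟩
  have hn := nome_ne_zero (point τ 0 0)
  rw [Complex.exp_zero]
  generalize Complex.exp (-_ * _) = E at he ⊢
  generalize Complex.exp (Real.pi * I * τ / 3) = E' at he ⊢
  field_simp
  field_simp at he
  linear_combination (jacobiTheta₂ 0 τ ^ 4 - jacobiTheta₂ (1 / 2) τ ^ 4) * he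

/-! ### Functions on the upper half-plane transforming under the modular group -/

section Modular

open UpperHalfPlane hiding I
open scoped ModularForm MatrixGroups Manifold

theorem coe_S_smul (z : ℍ) : ((ModularGroup.S • z : ℍ) : ℂ) = -1 / z := by
  rw [modular_S_smul, coe_mk, inv_neg, neg_div, one_div]

theorem coe_T_smul (z : ℍ) : ((ModularGroup.T • z : ℍ) : ℂ) = z + 1 := by
  rw [modular_T_smul, coe_vadd, add_comm, ofReal_one]

theorem denom_T (z : ℍ) : denom ModularGroup.T z = 1 := by
  rw [ModularGroup.denom_apply]
  simp [ModularGroup.T]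

theorem slash_eq_of_smul {k : ℤ} {f g : ℍ → ℂ} {γ : SL(2, ℤ)}
    (h : ∀ z : ℍ, f (γ • z) = denom γ z ^ k * g z) : f ∣[k] γ = g := by
  funext z
  rw [ModularForm.SL_slash_apply, h, zpow_neg]
  field_simp [denom_ne_zero γ z]

theorem smul_eq_of_slash {k : ℤ} {f g : ℍ → ℂ} {γ : SL(2, ℤ)} (h : f ∣[k] γ = g) (z : ℍ) :
    f (γ • z) = denom γ z ^ k * g z := by
  rw [← h, ModularForm.SL_slash_apply, zpow_neg]
  field_simp [denom_ne_zero γ z]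

/-- A level one cusp form of weight less than twelve vanishes. -/
theorem eq_zero_of_weight_lt_twelve {k : ℤ} (hk : k < 12) {f : ℍ → ℂ} (hf : Holo f)
    (hS : ∀ z : ℍ, f (ModularGroup.S • z) = (z : ℂ) ^ k * f z)
    (hT : ∀ z : ℍ, f (ModularGroup.T • z) = f z) (h0 : Tendsto f atImInfty (𝓝 0)) (z : ℍ) :
    f z = 0 := by
  have hS' : f ∣[k] ModularGroup.S = f := slash_eq_of_smul fun z => by
    rw [hS, ModularGroup.denom_S]
  have hT' : f ∣[k] ModularGroup.T = f := slash_eq_of_smul fun z => by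
    rw [hT, denom_T, one_zpow, one_mul]
  have hγ := SlashInvariantForm.slash_action_generators_SL2Z hS' hT'
  let F : CuspForm 𝒮ℒ k :=
    { toFun := f
      slash_action_eq' := by
        rintro A ⟨A, rfl⟩
        exact hγ A
      holo' := hf
      zero_at_cusps' := by
        intro c hc
        rw [Subgroup.IsArithmetic.isCusp_iff_isCusp_SL2Z] at hc
        rw [OnePoint.isZeroAt_iff_forall_SL2Z hc]
        intro γ _
        rw [hγ]
        exact h0 }
  have hF : F = 0 :=
    rank_zero_iff_forall_zero.1 (CuspForm.rank_eq_zero_of_weight_lt_twelve hk) F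
  exact congrArg (fun G : CuspForm 𝒮ℒ k => G z) hF

theorem tendsto_of_hasSum {f : ℍ → ℂ} {c : ℕ → ℂ}
    (hf : ∀ τ : ℍ, HasSum (fun m => c m • Function.Periodic.qParam 1 τ ^ m) (f τ)) :
    Tendsto f atImInfty (𝓝 (c 0)) := by
  set q : ℍ → ℂ := fun τ => Function.Periodic.qParam 1 τ with hq
  have hq0 : ∀ τ, q τ ≠ 0 := fun τ => Function.Periodic.qParam_ne_zero _
  have hb : IsBoundedAtImInfty fun τ => (f τ - c 0) / q τ := by
    refine isBoundedAtImInfty_of_hasSum_qExpansion (h := 1) (c := fun m => c (m + 1)) one_pos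
      fun τ => ?_
    have h1 := ((hasSum_nat_add_iff' 1).2 (hf τ)).div_const (q τ)
    simp only [Finset.sum_range_one, pow_zero, smul_eq_mul, mul_one] at h1
    refine h1.congr_fun fun m => ?_
    have := hq0 τ
    simp only [hq] at this ⊢
    rw [smul_eq_mul, pow_succ]
    field_simp
  have h2 : Tendsto (fun τ => q τ * ((f τ - c 0) / q τ)) atImInfty (𝓝 0) :=
    (qParam_tendsto_atImInfty one_pos).zero_mul_isBoundedUnder_le
      ((Asymptotics.isBigO_one_iff ℝ).1 hb)
  have h3 := h2.add_const (c 0)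
  rw [zero_add] at h3
  refine h3.congr fun τ => ?_
  rw [mul_div_cancel₀ _ (hq0 τ), sub_add_cancel]

theorem tendsto_E2 : Tendsto EisensteinSeries.E2 atImInfty (𝓝 1) := by
  have := tendsto_of_hasSum (f := EisensteinSeries.E2) (c := fun m : ℕ =>
    (if m = 0 then 1 else -24 * (ArithmeticFunction.sigma 1 m : ℂ))) fun τ => by
    simpa only [Function.Periodic.qParam, ofReal_one, div_one] using
      EisensteinSeries.hasSum_qExpansion_E2 (z := τ)
  simpa using this

theorem tendsto_eisenstein {k : ℕ} (hk : 3 ≤ k) (hk2 : Even k) :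
    Tendsto (ModularForm.E hk) atImInfty (𝓝 1) := by
  have := tendsto_of_hasSum
    (ModularForm.hasSum_qExpansion (ModularForm.E hk) one_pos one_mem_strictPeriods_SL)
  rwa [EisensteinSeries.E_qExpansion_coeff_zero hk hk2] at this

theorem eisenstein_S {k : ℕ} (hk : 3 ≤ k) (z : ℍ) :
    ModularForm.E hk (ModularGroup.S • z) = (z : ℂ) ^ k * ModularForm.E hk z := by
  have h := smul_eq_of_slash (γ := ModularGroup.S)
    ((ModularForm.E hk).slash_action_eq' _ ⟨ModularGroup.S, rfl⟩) z
  rwa [ModularGroup.denom_S, zpow_natCast] at h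

theorem eisenstein_T {k : ℕ} (hk : 3 ≤ k) (z : ℍ) :
    ModularForm.E hk (ModularGroup.T • z) = ModularForm.E hk z := by
  have h := smul_eq_of_slash (γ := ModularGroup.T)
    ((ModularForm.E hk).slash_action_eq' _ ⟨ModularGroup.T, rfl⟩) z
  rwa [denom_T, one_zpow, one_mul] at h

theorem tendsto_qDeriv {f : ℍ → ℂ} (hf : Holo f) {c : ℂ} (hc : Tendsto f atImInfty (𝓝 c)) :
    Tendsto (qDeriv f) atImInfty (𝓝 0) := by
  obtain ⟨M, A, hM⟩ := isBoundedAtImInfty_iff.1 (hc.isBigO_one ℝ : IsBoundedAtImInfty f)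
  have him : Tendsto (fun z : ℍ => z.im) atImInfty atTop := tendsto_comap
  have hlim : Tendsto (fun z : ℍ => ‖(2 * Real.pi * I : ℂ)⁻¹‖ * (M / (z.im / 2))) atImInfty (𝓝 0) := by
    have := (tendsto_const_nhds (x := M)).div_atTop (him.atTop_div_const (two_pos (α := ℝ)))
    simpa using this.const_mul ‖(2 * Real.pi * I : ℂ)⁻¹‖
  refine squeeze_zero_norm' ?_ hlim
  filter_upwards [him.eventually_ge_atTop (2 * A)] with z hz
  rw [qDeriv, Derivative.normalizedDerivOfComplex, norm_mul]
  refine mul_le_mul_of_nonneg_left ?_ (norm_nonneg _)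
  have hz0 := z.im_pos
  have hball : ∀ w ∈ Metric.closedBall (z : ℂ) (z.im / 2), z.im / 2 ≤ w.im := by
    intro w hw
    have h1 : |(w - z).im| ≤ z.im / 2 := (abs_im_le_norm _).trans (by simpa [dist_eq_norm] using hw)
    rw [sub_im, coe_im] at h1
    linarith [(abs_le.1 h1).1]
  refine norm_deriv_le_of_forall_mem_sphere_norm_le (half_pos hz0)
    ((UpperHalfPlane.mdifferentiable_iff.1 hf).diffContOnCl_ball fun w hw =>
      (half_pos hz0).trans_le (hball w hw)) fun w hw => ?_
  have hw' := hball w (Metric.sphere_subset_closedBall hw)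
  have hw0 : 0 < w.im := (half_pos hz0).trans_le hw'
  rw [Function.comp_apply, ofComplex_apply_of_im_pos hw0]
  refine hM _ ?_
  rw [mk_im]
  linarith

theorem serreDerivative_smul_eq {k : ℤ} {f g : ℍ → ℂ} (hf : Holo f) {γ : SL(2, ℤ)}
    (h : ∀ z : ℍ, f (γ • z) = denom γ z ^ k * g z) (z : ℍ) :
    Derivative.serreDerivative k f (γ • z) =
      denom γ z ^ (k + 2) * Derivative.serreDerivative k g z := by
  refine smul_eq_of_slash ?_ z
  rw [Derivative.serreDerivative_slash_equivariant hf, slash_eq_of_smul h]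

theorem E2_S (z : ℍ) : EisensteinSeries.E2 (ModularGroup.S • z) =
    (z : ℂ) ^ 2 * (EisensteinSeries.E2 z + 6 / (Real.pi * I * z)) := by
  have h := smul_eq_of_slash (EisensteinSeries.E2_slash_action ModularGroup.S) z
  rw [ModularGroup.denom_S, Pi.sub_apply, Pi.smul_apply, EisensteinSeries.D2_S, riemannZeta_two] at h
  rw [h]
  have hz := z.ne_zero
  have hpi : (Real.pi : ℂ) ≠ 0 := ofReal_ne_zero.2 Real.pi_ne_zero
  rw [smul_eq_mul]
  norm_cast
  congr 1
  push_cast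
  field_simp
  linear_combination (-6 : ℂ) * I_sq

theorem E2_T (z : ℍ) : EisensteinSeries.E2 (ModularGroup.T • z) = EisensteinSeries.E2 z := by
  have h := smul_eq_of_slash (EisensteinSeries.E2_slash_action ModularGroup.T) z
  simpa [denom_T, EisensteinSeries.D2_T] using h

theorem qDeriv_E2_S (z : ℍ) : qDeriv EisensteinSeries.E2 (ModularGroup.S • z) =
    (z : ℂ) ^ 4 * (qDeriv EisensteinSeries.E2 z + EisensteinSeries.E2 z / (Real.pi * I * z) +
      3 / (Real.pi * I * z) ^ 2) := by
  have hz := z.ne_zero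
  have hpi : (Real.pi : ℂ) ≠ 0 := ofReal_ne_zero.2 Real.pi_ne_zero
  have hsl : EisensteinSeries.E2 ∣[(2 : ℤ)] ModularGroup.S =
      fun w : ℍ => EisensteinSeries.E2 w + 6 / (Real.pi * I * w) :=
    slash_eq_of_smul fun w => by rw [E2_S, ModularGroup.denom_S]; norm_cast
  have h := congrFun (Derivative.normalizedDerivOfComplex_SL_slash E2_mdifferentiable
    (k := 2) (γ := ModularGroup.S)) z
  rw [hsl] at h
  have hd : qDeriv (fun w : ℍ => EisensteinSeries.E2 w + 6 / (Real.pi * I * w)) z =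
      qDeriv EisensteinSeries.E2 z - 3 / (Real.pi * I * z) ^ 2 := by
    have h1 := (UpperHalfPlane.mdifferentiableAt_iff.1 (E2_mdifferentiable z)).hasDerivAt
    have h2 : HasDerivAt (fun w : ℂ => 6 / (Real.pi * I) * w⁻¹)
        (6 / (Real.pi * I) * -((z : ℂ) ^ 2)⁻¹) z := (hasDerivAt_inv hz).const_mul _
    have h3 : HasDerivAt ((fun w : ℍ => EisensteinSeries.E2 w + 6 / (Real.pi * I * w)) ∘ ofComplex)
        _ (z : ℂ) := (h1.add h2).congr_of_eventuallyEq (by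
      filter_upwards [isOpen_upperHalfPlaneSet.mem_nhds z.im_pos] with w hw
      simp only [Function.comp_apply, ofComplex_apply_of_im_pos hw, Pi.add_apply, coe_mk]
      congr 1
      rw [← div_div, div_eq_mul_inv _ w])
    rw [qDeriv, Derivative.normalizedDerivOfComplex, h3.deriv, qDeriv,
      Derivative.normalizedDerivOfComplex]
    field_simp
    ring
  have h4 := smul_eq_of_slash (f := qDeriv EisensteinSeries.E2) (k := 2 + 2) (γ := ModularGroup.S)
    rfl z
  rw [h4, ModularGroup.denom_S]
  replace h := hd.symm.trans h
  have hS10 : ((ModularGroup.S 1 0 : ℤ) : ℂ) = 1 := by simp [ModularGroup.S]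
  simp only [Pi.sub_apply, ModularGroup.denom_S] at h
  rw [hS10] at h
  rw [eq_add_of_sub_eq h.symm, show (2 + 2 : ℤ) = (4 : ℕ) from rfl, zpow_natCast]
  congr 1
  push_cast
  field_simp
  ring

/-- Ramanujan's differential equation for `E₂`. -/
theorem qDeriv_E2 (z : ℍ) : qDeriv EisensteinSeries.E2 z =
    (EisensteinSeries.E2 z ^ 2 - ModularForm.E₄ z) / 12 := by
  have hE := E2_mdifferentiable
  have h := eq_zero_of_weight_lt_twelve (k := 4) (by norm_num)
    (f := fun z => qDeriv EisensteinSeries.E2 z -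
      (EisensteinSeries.E2 z * EisensteinSeries.E2 z - ModularForm.E₄ z) * (1 / 12))
    ((Derivative.normalizedDerivOfComplex_mdifferentiable hE).sub
      (((hE.mul hE).sub (ModularForm.E₄).holo').mul mdifferentiable_const))
    (fun z => by
      have hz := z.ne_zero
      have hpi : (Real.pi : ℂ) ≠ 0 := ofReal_ne_zero.2 Real.pi_ne_zero
      rw [qDeriv_E2_S, E2_S, ModularForm.E₄, eisenstein_S]
      norm_cast
      field_simp
      ring)
    (fun z => by
      have h1 := smul_eq_of_slash (f := qDeriv EisensteinSeries.E2) (k := 2 + 2)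
        (γ := ModularGroup.T) rfl z
      have h2 := congrFun (Derivative.normalizedDerivOfComplex_SL_slash E2_mdifferentiable
        (k := 2) (γ := ModularGroup.T)) z
      rw [EisensteinSeries.E2_slash_action, EisensteinSeries.D2_T, smul_zero, sub_zero] at h2
      rw [denom_T, one_zpow, one_mul] at h1
      rw [h1, E2_T, ModularForm.E₄, eisenstein_T, qDeriv, h2]
      simp [ModularGroup.T])
    (by
      have h1 := (tendsto_qDeriv hE tendsto_E2).sub
        (((tendsto_E2.mul tendsto_E2).sub (tendsto_eisenstein (k := 4) (by norm_num) ⟨2, rfl⟩)).mul_const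
          (1 / 12))
      simpa using h1) z
  linear_combination h

end Modular

/-! ### The fourth powers of the theta constants -/

section ThetaConstants

open UpperHalfPlane hiding I
open scoped ModularForm MatrixGroups Manifold

/-- The fourth power of the theta constant `θ₃`. -/
def thetaThree (τ : ℍ) : ℂ := jacobiTheta₂ 0 τ ^ 4

/-- The fourth power of the theta constant `θ₄`. -/
def thetaFour (τ : ℍ) : ℂ := jacobiTheta₂ (1 / 2) τ ^ 4

/-- The fourth power of the theta constant `θ₂`. -/
def thetaTwo (τ : ℍ) : ℂ := (Complex.exp (Real.pi * I * τ / 4) * jacobiTheta₂ (τ / 2) τ) ^ 4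

theorem holo_of_differentiableAt {f : ℍ → ℂ} {g : ℂ → ℂ} (h : ∀ τ : ℍ, f τ = g τ)
    (hg : ∀ w : ℂ, 0 < w.im → DifferentiableAt ℂ g w) : Holo f := by
  refine UpperHalfPlane.mdifferentiable_iff.2 fun w hw => ?_
  refine (hg w hw).differentiableWithinAt.congr (fun v hv => ?_) ?_
  · rw [Function.comp_apply, h, ofComplex_apply_of_im_pos hv]
  · rw [Function.comp_apply, h, ofComplex_apply_of_im_pos hw]

theorem holo_thetaThree : Holo thetaThree :=
  holo_of_differentiableAt (fun _ => rfl) fun _ hw => (differentiableAt_jacobiTheta₂_snd 0 hw).pow 4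

theorem holo_thetaFour : Holo thetaFour :=
  holo_of_differentiableAt (fun _ => rfl) fun _ hw =>
    (differentiableAt_jacobiTheta₂_snd (1 / 2) hw).pow 4

theorem holo_thetaTwo : Holo thetaTwo := by
  refine holo_of_differentiableAt (g := fun v : ℂ =>
    (Complex.exp (Real.pi * I * v / 4) * jacobiTheta₂ (v / 2) v) ^ 4) (fun _ => rfl) fun w hw => ?_
  have h1 : DifferentiableAt ℂ (fun v : ℂ => jacobiTheta₂ (v / 2) v) w :=
    DifferentiableAt.comp (g := fun p : ℂ × ℂ => jacobiTheta₂ p.1 p.2) (f := fun v : ℂ => (v / 2, v)) w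
      (hasFDerivAt_jacobiTheta₂ _ hw).differentiableAt (by fun_prop)
  have h2 : DifferentiableAt ℂ (fun v : ℂ => Complex.exp (Real.pi * I * v / 4)) w := by fun_prop
  exact (h2.mul h1).pow 4

theorem jacobiTheta₂_zero_add_one (τ : ℂ) : jacobiTheta₂ 0 (τ + 1) = jacobiTheta₂ (1 / 2) τ := by
  rw [← zero_add (1 / 2 : ℂ), ← theta1_neg_exp, ← theta1_exp, mul_add, Complex.exp_add, mul_one,
    Complex.exp_pi_mul_I, mul_neg_one]

theorem thetaThree_T (τ : ℍ) : thetaThree (ModularGroup.T • τ) = thetaFour τ := by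
  rw [thetaThree, thetaFour, coe_T_smul, jacobiTheta₂_zero_add_one]

theorem thetaFour_T (τ : ℍ) : thetaFour (ModularGroup.T • τ) = thetaThree τ := by
  rw [thetaThree, thetaFour, coe_T_smul, ← jacobiTheta₂_zero_add_one, add_assoc, one_add_one_eq_two,
    jacobiTheta₂_add_right]

theorem thetaTwo_T (τ : ℍ) : thetaTwo (ModularGroup.T • τ) = -thetaTwo τ := by
  have h : jacobiTheta₂ ((τ + 1 : ℂ) / 2) (τ + 1) = jacobiTheta₂ ((τ : ℂ) / 2) τ := by
    refine tsum_congr fun n => ?_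
    rw [jacobiTheta₂_term, jacobiTheta₂_term, Complex.exp_eq_exp_iff_exists_int]
    obtain ⟨m, hm⟩ := Int.even_mul_succ_self n
    refine ⟨m, ?_⟩
    have hm' : (n : ℂ) * (n + 1) = m + m := by exact_mod_cast hm
    linear_combination (Real.pi * I : ℂ) * hm'
  rw [thetaTwo, thetaTwo, coe_T_smul, h, mul_pow, mul_pow, ← Complex.exp_nat_mul,
    ← Complex.exp_nat_mul, show ((4 : ℕ) : ℂ) * (Real.pi * I * (τ + 1) / 4) =
      (4 : ℕ) * (Real.pi * I * τ / 4) + Real.pi * I by push_cast; ring, Complex.exp_add,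
    Complex.exp_pi_mul_I]
  ring

theorem neg_I_mul_cpow_half_pow_four (τ : ℂ) : ((-I * τ) ^ (1 / 2 : ℂ)) ^ 4 = -τ ^ 2 := by
  rw [← Complex.cpow_nat_mul, show ((4 : ℕ) : ℂ) * (1 / 2) = (2 : ℕ) by norm_num,
    Complex.cpow_natCast, mul_pow, neg_sq, I_sq]
  ring

theorem thetaThree_S (τ : ℍ) :
    thetaThree (ModularGroup.S • τ) = (τ : ℂ) ^ 2 * -thetaThree τ := by
  have h := jacobiTheta₂_functional_equation 0 τ
  have hz := τ.ne_zero
  have h4 := neg_I_mul_cpow_half_pow_four τ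
  have h5 : ((-I * (τ : ℂ)) ^ (1 / 2 : ℂ)) ^ 4 ≠ 0 := by
    rw [h4]; exact neg_ne_zero.2 (pow_ne_zero _ hz)
  rw [thetaThree, thetaThree, h, coe_S_smul, mul_pow, mul_pow, one_div, inv_pow, ← one_div, h4]
  simp only [zero_div, ne_eq, OfNat.ofNat_ne_zero, not_false_eq_true, zero_pow, mul_zero,
    Complex.exp_zero, one_pow]
  field_simp

theorem thetaFour_S (τ : ℍ) : thetaFour (ModularGroup.S • τ) = (τ : ℂ) ^ 2 * -thetaTwo τ := by
  have h := jacobiTheta₂_functional_equation (τ / 2) τ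
  have hz := τ.ne_zero
  have h4 := neg_I_mul_cpow_half_pow_four τ
  rw [thetaTwo, thetaFour, h, coe_S_smul, show (τ : ℂ) / 2 / τ = 1 / 2 by field_simp,
    show -Real.pi * I * ((τ : ℂ) / 2) ^ 2 / τ = -(Real.pi * I * τ / 4) by field_simp; ring,
    Complex.exp_neg]
  have he := Complex.exp_ne_zero (Real.pi * I * τ / 4)
  rw [show ∀ a b c d : ℂ, (a * (b * c * d)) ^ 4 = (a * c) ^ 4 * b ^ 4 * d ^ 4 by intros; ring,
    mul_inv_cancel₀ he, one_div ((-I * (τ : ℂ)) ^ _), inv_pow, h4]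
  field_simp

theorem thetaTwo_S (τ : ℍ) : thetaTwo (ModularGroup.S • τ) = (τ : ℂ) ^ 2 * -thetaFour τ := by
  have h := thetaFour_S (ModularGroup.S • τ)
  have hz := τ.ne_zero
  have hSS : ModularGroup.S • ModularGroup.S • τ = τ := by
    ext
    rw [coe_S_smul, coe_S_smul]
    field_simp
  rw [hSS, coe_S_smul] at h
  rw [h]
  field_simp

theorem tendsto_jacobiTheta₂_zero :
    Tendsto (fun τ : ℍ => jacobiTheta₂ 0 τ) atImInfty (𝓝 1) := by
  have him : Tendsto (fun z : ℍ => z.im) atImInfty atTop := tendsto_comap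
  have h1 : Tendsto (fun τ : ℂ => Real.exp (-Real.pi * τ.im)) (comap im atTop) (𝓝 0) :=
    Real.tendsto_exp_atBot.comp ((tendsto_comap).const_mul_atTop_of_neg (by
      simpa using Real.pi_pos))
  have h2 := isBigO_at_im_infty_jacobiTheta_sub_one.trans_tendsto h1
  have h3 : Tendsto (fun τ : ℍ => (τ : ℂ)) atImInfty (comap im atTop) :=
    tendsto_comap_iff.2 him
  have h4 := (h2.comp h3).add_const 1
  rw [zero_add] at h4
  refine h4.congr fun τ => ?_
  rw [Function.comp_apply, sub_add_cancel, jacobiTheta_eq_jacobiTheta₂]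

theorem tendsto_thetaThree : Tendsto thetaThree atImInfty (𝓝 1) := by
  have h := tendsto_jacobiTheta₂_zero.pow 4
  rw [one_pow] at h
  exact h

theorem tendsto_thetaFour : Tendsto thetaFour atImInfty (𝓝 1) := by
  have h : Tendsto (fun τ : ℍ => ModularGroup.T • τ) atImInfty atImInfty := by
    refine tendsto_comap_iff.2 ?_
    have : (UpperHalfPlane.im ∘ fun τ : ℍ => ModularGroup.T • τ) = UpperHalfPlane.im := by
      funext τ
      rw [Function.comp_apply, modular_T_smul, vadd_im]
    rw [this]
    exact tendsto_comap
  exact (tendsto_thetaThree.comp h).congr fun τ => thetaThree_T τ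

theorem tendsto_thetaTwo : Tendsto thetaTwo atImInfty (𝓝 0) := by
  have him : Tendsto (fun z : ℍ => z.im) atImInfty atTop := tendsto_comap
  have hsum : Summable fun n : ℤ => ‖jacobiTheta₂_term n (I / 2) I‖ :=
    ((summable_jacobiTheta₂_term_iff (I / 2) I).2 (by simp)).norm
  have hbound : ∀ᶠ τ : ℍ in atImInfty, ‖jacobiTheta₂ ((τ : ℂ) / 2) τ‖ ≤
      ∑' n : ℤ, ‖jacobiTheta₂_term n (I / 2) I‖ := by
    filter_upwards [him.eventually_ge_atTop 1] with τ hτ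
    refine tsum_of_norm_bounded hsum.hasSum fun n => ?_
    rw [norm_jacobiTheta₂_term, norm_jacobiTheta₂_term, Real.exp_le_exp]
    have h1 : ((τ : ℂ) / 2).im = τ.im / 2 := by simp
    have h2 : (I / 2 : ℂ).im = 1 / 2 := by simp
    rw [h1, h2, Complex.I_im, coe_im]
    have h3 : (0 : ℝ) ≤ n * (n + 1) := by
      have : (0 : ℤ) ≤ n * (n + 1) := by
        rcases le_or_gt 0 n with h | h
        · positivity
        · nlinarith
      exact_mod_cast this
    nlinarith [mul_nonneg Real.pi_pos.le (mul_nonneg h3 (sub_nonneg.2 hτ))]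
  have hexp : Tendsto (fun τ : ℍ => Complex.exp (Real.pi * I * τ / 4)) atImInfty (𝓝 0) := by
    rw [tendsto_zero_iff_norm_tendsto_zero]
    have h1 : Tendsto (fun τ : ℍ => Real.exp (-(Real.pi / 4) * τ.im)) atImInfty (𝓝 0) :=
      Real.tendsto_exp_atBot.comp (him.const_mul_atTop_of_neg (by
        have := Real.pi_pos
        linarith))
    refine h1.congr fun τ => ?_
    rw [Complex.norm_exp]
    congr 1
    simp
    ring
  have h := (hexp.zero_mul_isBoundedUnder_le (g := fun τ : ℍ => jacobiTheta₂ ((τ : ℂ) / 2) τ)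
    ⟨_, eventually_map.2 hbound⟩).pow 4
  rw [zero_pow four_ne_zero] at h
  exact h

/-- Jacobi's identity between the fourth powers of the theta constants. -/
theorem thetaThree_eq (τ : ℍ) : thetaThree τ = thetaFour τ + thetaTwo τ := by
  have hJ : Holo fun z => thetaThree z - thetaFour z - thetaTwo z :=
    (holo_thetaThree.sub holo_thetaFour).sub holo_thetaTwo
  have h := eq_zero_of_weight_lt_twelve (k := 4) (by norm_num)
    (f := fun z => (thetaThree z - thetaFour z - thetaTwo z) *
      (thetaThree z - thetaFour z - thetaTwo z)) (hJ.mul hJ)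
    (fun z => by
      rw [thetaThree_S, thetaFour_S, thetaTwo_S, show (4 : ℤ) = (4 : ℕ) from rfl, zpow_natCast]
      ring)
    (fun z => by
      rw [thetaThree_T, thetaFour_T, thetaTwo_T]
      ring)
    (by
      have h1 := (tendsto_thetaThree.sub tendsto_thetaFour).sub tendsto_thetaTwo
      simpa using h1.mul h1) τ
  have h2 := mul_self_eq_zero.1 h
  linear_combination h2

end ThetaConstants

/-! ### The differential equations -/

section DifferentialEquations

open UpperHalfPlane hiding I
open scoped ModularForm MatrixGroups Manifold

theorem etaChi_zero_eq (τ : ℍ) : etaChi 0 τ = (thetaThree τ + thetaFour τ) * (1 / 2) := by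
  rw [etaChi_zero, thetaThree, thetaFour]
  ring

theorem etaChi_one_eq (τ : ℍ) : etaChi 1 τ = (thetaThree τ - thetaFour τ) * (1 / 2) := by
  rw [etaChi_one, thetaThree, thetaFour]
  ring

theorem holo_etaChi_zero : Holo (etaChi 0) := by
  rw [show etaChi 0 = _ from funext etaChi_zero_eq]
  exact (holo_thetaThree.add holo_thetaFour).mul mdifferentiable_const

theorem holo_etaChi_one : Holo (etaChi 1) := by
  rw [show etaChi 1 = _ from funext etaChi_one_eq]
  exact (holo_thetaThree.sub holo_thetaFour).mul mdifferentiable_const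

theorem etaChi_zero_T (τ : ℍ) : etaChi 0 (ModularGroup.T • τ) = etaChi 0 τ := by
  rw [etaChi_zero_eq, etaChi_zero_eq, thetaThree_T, thetaFour_T]
  ring

theorem etaChi_one_T (τ : ℍ) : etaChi 1 (ModularGroup.T • τ) = -etaChi 1 τ := by
  rw [etaChi_one_eq, etaChi_one_eq, thetaThree_T, thetaFour_T]
  ring

theorem etaChi_zero_S (τ : ℍ) : etaChi 0 (ModularGroup.S • τ) =
    (τ : ℂ) ^ 2 * (-(1 / 2) * (etaChi 0 τ + 3 * etaChi 1 τ)) := by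
  rw [etaChi_zero_eq, etaChi_zero_eq, etaChi_one_eq, thetaThree_S, thetaFour_S]
  linear_combination (1 / 2) * (τ : ℂ) ^ 2 * thetaThree_eq τ

theorem etaChi_one_S (τ : ℍ) : etaChi 1 (ModularGroup.S • τ) =
    (τ : ℂ) ^ 2 * (-(1 / 2) * (etaChi 0 τ - etaChi 1 τ)) := by
  rw [etaChi_one_eq, etaChi_zero_eq, etaChi_one_eq, thetaThree_S, thetaFour_S]
  linear_combination (-(1 / 2)) * (τ : ℂ) ^ 2 * thetaThree_eq τ

theorem tendsto_etaChi_zero : Tendsto (etaChi 0) atImInfty (𝓝 1) := by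
  rw [show etaChi 0 = _ from funext etaChi_zero_eq]
  have h := (tendsto_thetaThree.add tendsto_thetaFour).mul_const (1 / 2)
  rw [show (1 + 1 : ℂ) * (1 / 2) = 1 by norm_num] at h
  exact h

theorem tendsto_etaChi_one : Tendsto (etaChi 1) atImInfty (𝓝 0) := by
  rw [show etaChi 1 = _ from funext etaChi_one_eq]
  have h := (tendsto_thetaThree.sub tendsto_thetaFour).mul_const (1 / 2)
  rw [sub_self, zero_mul] at h
  exact h

theorem eisenstein_four_eq (τ : ℍ) :
    ModularForm.E₄ τ = etaChi 0 τ ^ 2 + 3 * etaChi 1 τ ^ 2 := by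
  have hA := holo_etaChi_zero
  have hB := holo_etaChi_one
  have h := eq_zero_of_weight_lt_twelve (k := 4) (by norm_num)
    (f := fun z => etaChi 0 z * etaChi 0 z + 3 * (etaChi 1 z * etaChi 1 z) - ModularForm.E₄ z)
    (((hA.mul hA).add (mdifferentiable_const.mul (hB.mul hB))).sub (ModularForm.E₄).holo')
    (fun z => by
      rw [etaChi_zero_S, etaChi_one_S, ModularForm.E₄, eisenstein_S]
      norm_cast
      ring)
    (fun z => by
      rw [etaChi_zero_T, etaChi_one_T, ModularForm.E₄, eisenstein_T]
      ring)
    (by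
      have h1 := ((tendsto_etaChi_zero.mul tendsto_etaChi_zero).add
        ((tendsto_etaChi_one.mul tendsto_etaChi_one).const_mul 3)).sub
        (tendsto_eisenstein (k := 4) (by norm_num) ⟨2, rfl⟩)
      simpa using h1) τ
  linear_combination -h

theorem eisenstein_six_eq (τ : ℍ) :
    ModularForm.E₆ τ = etaChi 0 τ ^ 3 - 9 * etaChi 0 τ * etaChi 1 τ ^ 2 := by
  have hA := holo_etaChi_zero
  have hB := holo_etaChi_one
  have h := eq_zero_of_weight_lt_twelve (k := 6) (by norm_num)
    (f := fun z => etaChi 0 z * (etaChi 0 z * etaChi 0 z) -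
      9 * (etaChi 0 z * (etaChi 1 z * etaChi 1 z)) - ModularForm.E₆ z)
    (((hA.mul (hA.mul hA)).sub (mdifferentiable_const.mul (hA.mul (hB.mul hB)))).sub
      (ModularForm.E₆).holo')
    (fun z => by
      rw [etaChi_zero_S, etaChi_one_S, ModularForm.E₆, eisenstein_S]
      norm_cast
      ring)
    (fun z => by
      rw [etaChi_zero_T, etaChi_one_T, ModularForm.E₆, eisenstein_T]
      ring)
    (by
      have h1 := ((tendsto_etaChi_zero.mul (tendsto_etaChi_zero.mul tendsto_etaChi_zero)).sub
        ((tendsto_etaChi_zero.mul (tendsto_etaChi_one.mul tendsto_etaChi_one)).const_mul 9)).sub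
        (tendsto_eisenstein (k := 6) (by norm_num) ⟨3, rfl⟩)
      simpa using h1) τ
  linear_combination -h

/-- The defect of the first differential equation, for the Serre derivative. -/
def defectZero (τ : ℍ) : ℂ :=
  Derivative.serreDerivative 2 (etaChi 0) τ +
    (1 / 6 * (etaChi 0 τ * etaChi 0 τ) - 1 / 2 * (etaChi 1 τ * etaChi 1 τ))

/-- The defect of the second differential equation, for the Serre derivative. -/
def defectOne (τ : ℍ) : ℂ :=
  Derivative.serreDerivative 2 (etaChi 1) τ - 1 / 3 * (etaChi 0 τ * etaChi 1 τ)

theorem holo_defectZero : Holo defectZero :=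
  (Derivative.serreDerivative_mdifferentiable 2 holo_etaChi_zero).add
    ((mdifferentiable_const.mul (holo_etaChi_zero.mul holo_etaChi_zero)).sub
      (mdifferentiable_const.mul (holo_etaChi_one.mul holo_etaChi_one)))

theorem holo_defectOne : Holo defectOne :=
  (Derivative.serreDerivative_mdifferentiable 2 holo_etaChi_one).sub
    (mdifferentiable_const.mul (holo_etaChi_zero.mul holo_etaChi_one))

theorem serreDerivative_linear_combination {f g : ℍ → ℂ} (hf : Holo f) (hg : Holo g) (k a b : ℂ)
    (τ : ℍ) : Derivative.serreDerivative k (fun z => a * f z + b * g z) τ =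
      a * Derivative.serreDerivative k f τ + b * Derivative.serreDerivative k g τ := by
  have h1 : Holo (a • f) := mdifferentiable_const.mul hf
  have h2 : Holo (b • g) := mdifferentiable_const.mul hg
  have h := congrFun (Derivative.serreDerivative_add k (a • f) (b • g) h1 h2) τ
  rw [Derivative.serreDerivative_smul k a f hf, Derivative.serreDerivative_smul k b g hg] at h
  exact h

theorem serreDerivative_S {f g : ℍ → ℂ} (hf : Holo f)
    (h : ∀ z : ℍ, f (ModularGroup.S • z) = (z : ℂ) ^ 2 * g z) (z : ℍ) :
    Derivative.serreDerivative 2 f (ModularGroup.S • z) =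
      (z : ℂ) ^ 4 * Derivative.serreDerivative 2 g z := by
  have := serreDerivative_smul_eq (k := 2) (γ := ModularGroup.S) hf
    (fun z => by rw [h, ModularGroup.denom_S]; norm_cast) z
  rw [ModularGroup.denom_S, show (2 + 2 : ℤ) = (4 : ℕ) from rfl, zpow_natCast] at this
  exact_mod_cast this

theorem serreDerivative_T {f g : ℍ → ℂ} (hf : Holo f)
    (h : ∀ z : ℍ, f (ModularGroup.T • z) = g z) (z : ℍ) :
    Derivative.serreDerivative 2 f (ModularGroup.T • z) = Derivative.serreDerivative 2 g z := by
  have := serreDerivative_smul_eq (k := 2) (γ := ModularGroup.T) hf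
    (fun z => by rw [h, denom_T, one_zpow, one_mul]) z
  rw [denom_T, one_zpow, one_mul] at this
  exact_mod_cast this

theorem defectZero_S (τ : ℍ) : defectZero (ModularGroup.S • τ) =
    (τ : ℂ) ^ 4 * (-(1 / 2) * (defectZero τ + 3 * defectOne τ)) := by
  rw [defectZero, serreDerivative_S holo_etaChi_zero (g := fun z => (-(1 / 2)) * etaChi 0 z +
    (-(3 / 2)) * etaChi 1 z) (fun z => by rw [etaChi_zero_S]; ring),
    serreDerivative_linear_combination holo_etaChi_zero holo_etaChi_one, etaChi_zero_S, etaChi_one_S,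
    defectZero, defectOne]
  ring

theorem defectOne_S (τ : ℍ) : defectOne (ModularGroup.S • τ) =
    (τ : ℂ) ^ 4 * (-(1 / 2) * (defectZero τ - defectOne τ)) := by
  rw [defectOne, serreDerivative_S holo_etaChi_one (g := fun z => (-(1 / 2)) * etaChi 0 z +
    (1 / 2) * etaChi 1 z) (fun z => by rw [etaChi_one_S]; ring),
    serreDerivative_linear_combination holo_etaChi_zero holo_etaChi_one, etaChi_zero_S, etaChi_one_S,
    defectZero, defectOne]
  ring

theorem defectZero_T (τ : ℍ) : defectZero (ModularGroup.T • τ) = defectZero τ := by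
  rw [defectZero, serreDerivative_T holo_etaChi_zero etaChi_zero_T, etaChi_zero_T, etaChi_one_T,
    defectZero]
  ring

theorem defectOne_T (τ : ℍ) : defectOne (ModularGroup.T • τ) = -defectOne τ := by
  rw [defectOne, serreDerivative_T holo_etaChi_one (g := fun z => 0 * etaChi 0 z +
    (-1) * etaChi 1 z) (fun z => by rw [etaChi_one_T]; ring),
    serreDerivative_linear_combination holo_etaChi_zero holo_etaChi_one, etaChi_zero_T, etaChi_one_T,
    defectOne]
  ring

theorem tendsto_serreDerivative {f : ℍ → ℂ} (hf : Holo f) {c : ℂ}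
    (hc : Tendsto f atImInfty (𝓝 c)) (k : ℂ) :
    Tendsto (Derivative.serreDerivative k f) atImInfty (𝓝 (-(k / 12 * c))) := by
  have h := (tendsto_qDeriv hf hc).sub ((tendsto_E2.const_mul (k * 12⁻¹)).mul hc)
  rw [show 0 - k * 12⁻¹ * 1 * c = -(k / 12 * c) by ring] at h
  exact h

theorem tendsto_defectZero : Tendsto defectZero atImInfty (𝓝 0) := by
  have h := (tendsto_serreDerivative holo_etaChi_zero tendsto_etaChi_zero 2).add
    (((tendsto_etaChi_zero.mul tendsto_etaChi_zero).const_mul (1 / 6)).sub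
      ((tendsto_etaChi_one.mul tendsto_etaChi_one).const_mul (1 / 2)))
  rw [show -(2 / 12 * 1) + (1 / 6 * (1 * 1) - 1 / 2 * (0 * 0)) = (0 : ℂ) by norm_num] at h
  exact h

theorem tendsto_defectOne : Tendsto defectOne atImInfty (𝓝 0) := by
  have h := (tendsto_serreDerivative holo_etaChi_one tendsto_etaChi_one 2).sub
    ((tendsto_etaChi_zero.mul tendsto_etaChi_one).const_mul (1 / 3))
  rw [show -(2 / 12 * 0) - 1 / 3 * (1 * 0) = (0 : ℂ) by norm_num] at h
  exact h

theorem defect_weight_six (τ : ℍ) :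
    etaChi 0 τ * defectZero τ + 3 * (etaChi 1 τ * defectOne τ) = 0 := by
  refine eq_zero_of_weight_lt_twelve (k := 6) (by norm_num)
    (f := fun z => etaChi 0 z * defectZero z + 3 * (etaChi 1 z * defectOne z))
    ((holo_etaChi_zero.mul holo_defectZero).add
      (mdifferentiable_const.mul (holo_etaChi_one.mul holo_defectOne)))
    (fun z => ?_) (fun z => ?_) ?_ τ
  · rw [etaChi_zero_S, etaChi_one_S, defectZero_S, defectOne_S, show (6 : ℤ) = (6 : ℕ) from rfl,
      zpow_natCast]
    ring
  · rw [etaChi_zero_T, etaChi_one_T, defectZero_T, defectOne_T]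
    ring
  · simpa using (tendsto_etaChi_zero.mul tendsto_defectZero).add
      ((tendsto_etaChi_one.mul tendsto_defectOne).const_mul 3)

theorem defect_weight_eight (τ : ℍ) :
    (etaChi 0 τ * etaChi 0 τ - 3 * (etaChi 1 τ * etaChi 1 τ)) * defectZero τ -
      6 * (etaChi 0 τ * etaChi 1 τ * defectOne τ) = 0 := by
  refine eq_zero_of_weight_lt_twelve (k := 8) (by norm_num)
    (f := fun z => (etaChi 0 z * etaChi 0 z - 3 * (etaChi 1 z * etaChi 1 z)) * defectZero z -
      6 * (etaChi 0 z * etaChi 1 z * defectOne z))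
    ((((holo_etaChi_zero.mul holo_etaChi_zero).sub
      (mdifferentiable_const.mul (holo_etaChi_one.mul holo_etaChi_one))).mul holo_defectZero).sub
      (mdifferentiable_const.mul ((holo_etaChi_zero.mul holo_etaChi_one).mul holo_defectOne)))
    (fun z => ?_) (fun z => ?_) ?_ τ
  · rw [etaChi_zero_S, etaChi_one_S, defectZero_S, defectOne_S, show (8 : ℤ) = (8 : ℕ) from rfl,
      zpow_natCast]
    ring
  · rw [etaChi_zero_T, etaChi_one_T, defectZero_T, defectOne_T]
    ring
  · simpa using (((tendsto_etaChi_zero.mul tendsto_etaChi_zero).sub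
      ((tendsto_etaChi_one.mul tendsto_etaChi_one).const_mul 3)).mul tendsto_defectZero).sub
      (((tendsto_etaChi_zero.mul tendsto_etaChi_one).mul tendsto_defectOne).const_mul 6)

theorem etaChi_discriminant_ne_zero (τ : ℍ) :
    etaChi 1 τ * (etaChi 0 τ ^ 2 - etaChi 1 τ ^ 2) ≠ 0 := by
  intro h0
  have h := ModularForm.discriminant_eq_E₄_cube_sub_E₆_sq τ
  rw [eisenstein_four_eq, eisenstein_six_eq] at h
  refine ModularForm.discriminant_ne_zero τ ?_
  rw [h]
  linear_combination 27 / 1728 * (etaChi 1 τ * (etaChi 0 τ ^ 2 - etaChi 1 τ ^ 2)) * h0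

theorem defectZero_eq_zero (τ : ℍ) : defectZero τ = 0 := by
  have h1 := defect_weight_six τ
  have h2 := defect_weight_eight τ
  have h3 := etaChi_discriminant_ne_zero τ
  have h4 : (etaChi 1 τ * (etaChi 0 τ ^ 2 - etaChi 1 τ ^ 2)) * defectZero τ = 0 := by
    linear_combination (2 / 3 * etaChi 0 τ * etaChi 1 τ) * h1 + (1 / 3 * etaChi 1 τ) * h2
  exact (mul_eq_zero.1 h4).resolve_left h3

theorem defectOne_eq_zero (τ : ℍ) : defectOne τ = 0 := by
  have h1 := defect_weight_six τ
  have h3 := etaChi_discriminant_ne_zero τ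
  rw [defectZero_eq_zero] at h1
  have h4 : etaChi 1 τ ≠ 0 := left_ne_zero_of_mul h3
  have h5 : etaChi 1 τ * defectOne τ = 0 := by linear_combination 1 / 3 * h1
  exact (mul_eq_zero.1 h5).resolve_left h4

theorem etaLog_eq (τ : ℍ) : etaLog τ = 1 / 24 * EisensteinSeries.E2 τ := by
  have h := ModularForm.logDeriv_eta_eq_E2 τ
  have h1 : deriv (eta ∘ ofComplex) (τ : ℂ) = deriv ModularForm.eta τ := by
    refine Filter.EventuallyEq.deriv_eq ?_
    filter_upwards [isOpen_upperHalfPlaneSet.mem_nhds τ.im_pos] with w hw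
    rw [Function.comp_apply, eta, ofComplex_apply_of_im_pos hw]
  have hpi : (Real.pi : ℂ) ≠ 0 := ofReal_ne_zero.2 Real.pi_ne_zero
  rw [etaLog, qDeriv, Derivative.normalizedDerivOfComplex, h1, mul_div_assoc]
  rw [logDeriv_apply] at h
  rw [eta, h]
  field_simp
  ring

theorem E2_eq (τ : ℍ) : E2 τ = EisensteinSeries.E2 τ :=
  (EisensteinSeries.E2_eq_tsum_cexp τ).symm

theorem E4_eq (τ : ℍ) : E4 τ = ModularForm.E₄ τ := by
  have h := EisensteinSeries.q_expansion_bernoulli (k := 4) (by norm_num) ⟨2, rfl⟩ τ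
  rw [show bernoulli 4 = -1 / 30 by decide +kernel] at h
  rw [ModularForm.E₄, h, E4]
  simp only [qExp, zpow_natCast]
  norm_num

theorem E6_eq (τ : ℍ) : E6 τ = ModularForm.E₆ τ := by
  have h := EisensteinSeries.q_expansion_bernoulli (k := 6) (by norm_num) ⟨3, rfl⟩ τ
  rw [show bernoulli 6 = 1 / 42 by decide +kernel] at h
  rw [ModularForm.E₆, h, E6]
  simp only [qExp, zpow_natCast]
  norm_num

theorem holo_etaLog : Holo etaLog := by
  rw [show etaLog = _ from funext etaLog_eq]
  exact mdifferentiable_const.mul E2_mdifferentiable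

theorem qDeriv_etaChi_zero (τ : ℍ) : qDeriv (etaChi 0) τ =
    4 * etaChi 0 τ * etaLog τ - 1 / 6 * etaChi 0 τ ^ 2 + 1 / 2 * etaChi 1 τ ^ 2 := by
  have h := defectZero_eq_zero τ
  rw [defectZero, Derivative.serreDerivative_apply] at h
  rw [etaLog_eq]
  linear_combination h

theorem qDeriv_etaChi_one (τ : ℍ) : qDeriv (etaChi 1) τ =
    4 * etaChi 1 τ * etaLog τ + 1 / 3 * (etaChi 0 τ * etaChi 1 τ) := by
  have h := defectOne_eq_zero τ
  rw [defectOne, Derivative.serreDerivative_apply] at h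
  rw [etaLog_eq]
  linear_combination h

theorem qDeriv_etaLog (τ : ℍ) : qDeriv etaLog τ =
    2 * etaLog τ ^ 2 - 1 / (2 ^ 5 * 3 ^ 2) * (etaChi 0 τ ^ 2 + 3 * etaChi 1 τ ^ 2) := by
  have h1 : etaLog = (1 / 24 : ℂ) • EisensteinSeries.E2 := funext etaLog_eq
  have h2 := congrFun (Derivative.normalizedDerivOfComplex_smul (1 / 24)
    EisensteinSeries.E2 E2_mdifferentiable) τ
  rw [← h1, Pi.smul_apply, smul_eq_mul] at h2
  rw [qDeriv, h2, etaLog_eq, ← eisenstein_four_eq]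
  linear_combination (1 / 24 : ℂ) * qDeriv_E2 τ

end DifferentialEquations

end EllipticD4

end

open EllipticD4 in
theorem proposition7p2 :
    (Holo (etaChi 0) ∧ Holo (etaChi 1) ∧ Holo etaLog) ∧
    ∀ τ : UpperHalfPlane,
      qDeriv (etaChi 0) τ =
        4 * etaChi 0 τ * etaLog τ - 1 / 6 * etaChi 0 τ ^ 2 + 1 / 2 * etaChi 1 τ ^ 2 ∧
      qDeriv (etaChi 1) τ =
        4 * etaChi 1 τ * etaLog τ + 1 / 3 * (etaChi 0 τ * etaChi 1 τ) ∧
      qDeriv etaLog τ =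
        2 * etaLog τ ^ 2 - 1 / (2 ^ 5 * 3 ^ 2) * (etaChi 0 τ ^ 2 + 3 * etaChi 1 τ ^ 2) ∧
      E2 τ = 24 * etaLog τ ∧
      E4 τ = etaChi 0 τ ^ 2 + 3 * etaChi 1 τ ^ 2 ∧
      E6 τ = etaChi 0 τ ^ 3 - 9 * etaChi 0 τ * etaChi 1 τ ^ 2 := by
  refine ⟨⟨holo_etaChi_zero, holo_etaChi_one, holo_etaLog⟩, fun τ => ⟨qDeriv_etaChi_zero τ,
    qDeriv_etaChi_one τ, qDeriv_etaLog τ, ?_, ?_, ?_⟩⟩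
  · rw [E2_eq, etaLog_eq]
    ring
  · rw [E4_eq, eisenstein_four_eq]
  · rw [E6_eq, eisenstein_six_eq]
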